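/- **Setting.** For $1\le R<\infty$ let $\Omega_R\subset\mathbb R^2$ be the disk of radius $R$ centred at $0$, and let $\Omega_\infty=\mathbb R^2$. Let $H_R$ be the space of $u\in L^2(\Omega_R)^2$ with $\operatorname{div}u=0$ and $u\cdot\mathbf n=0$ on $\partial\Omega_R$, and let $V_R$ be the space of $u\in H^1(\Omega_R)^2$ with $\operatorname{div}u=0$ and $u=0$ on $\partial\Omega_R$, with the inner product $(u,v)+(\nabla u,\nabla v)$ (no boundary condition if $R=\infty$); $V_R'$ is its dual. Fix a vector field of the form $$\sigma_1(x)=\Bigl(-\frac{x_2}{r^2}\int_0^r\rho g(\rho)\,d\rho,\ \frac{x_1}{r^2}\int_0^r\rho g(\rho)\,d\rho\Bigr),\qquad r=|x|,\quad g\in C_0^\infty(\mathbb R),$$ whose vorticity $\partial_1\sigma_1^2-\partial_2\sigma_1^1$ is supported in the closed unit disk and has integral $1$. For $m\in\mathbb R$ let $\sigma_m=m\sigma_1$ and let $E_m=\sigma_m+H_\infty$. Let $\overline\sigma_m=\mathbf P_{V_R}\sigma_m$ if $R<\infty$, the $H^1(\Omega_R)$-orthogonal projection onto $V_R$ of the restriction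 of $\sigma_m$ to $\Omega_R$, and $\overline\sigma_m=\sigma_m$ if $R=\infty$. **Weak solutions.** Let $\nu,T>0$ and $f\in L^2([0,T];H_R)$. For $R<\infty$ and $u_0\in H_R$, a weak solution is a $u\in L^2([0,T];V_R)$ with $\partial_tu\in L^2([0,T];V_R')$ and $u(0)=u_0$ such that $$\langle\partial_tu,v\rangle+\int_{\Omega_R}(u\cdot\nabla u)\cdot v+\nu\int_{\Omega_R}\nabla u\cdot\nabla v=\int_{\Omega_R}f\cdot v\qquad\text{for a.e. }t\in[0,T]\text{ and all }v\in V_R.$$ For $R=\infty$ and $u_0\in E_m$, a weak solution is a measurable $u$ with $u(t)-\sigma_m\in V_\infty$ for a.e. $t$, $\nabla u\in L^2([0,T];L^2(\mathbb R^2))$, $\partial_tu\in L^2([0,T];V_\infty')$ and $u(0)=u_0$ such that the same equation holds for a.e. $t$ and all $v\in V_\infty$. Here $\partial_tu$ and $u(0)=u_0$ are understood through $u(t)-u_0=\int_0^t\partial_tu\,ds$ in $V_R'$. **Theorem.** There is a function $C\ge0$ of one real variable (a universal one) such that, with $C=C(\|\nabla\sigma_1\|_{L^2\cap L^\infty(\mathbb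 R^2)})$, where $\|\cdot\|_{L^2\cap L^\infty}=\|\cdot\|_{L^2}+\|\cdot\|_{L^\infty}$, the following holds for all $\sigma_1$, $m\in\mathbb R$, $\nu,T>0$, $R\in[1,\infty]$, all $f$ and $u_0$ as above ($u_0\in H_R$ if $R<\infty$, $u_0\in E_m$ if $R=\infty$), and every weak solution $u$. After modification on a null set of times, $u-\overline\sigma_m\in C([0,T];L^2(\Omega_R))$ with $u(0)=u_0$; all integrals below converge; and for every $t\in[0,T]$ $$\begin{aligned}&\|(u-\overline\sigma_m)(t)\|_{L^2(\Omega_R)}^2+2\nu\int_0^t\|\nabla(u-\overline\sigma_m)\|_{L^2(\Omega_R)}^2\\&\quad=\|u_0-\overline\sigma_m\|_{L^2(\Omega_R)}^2-2\int_0^t\!\int_{\Omega_R}\bigl((u-\overline\sigma_m)\cdot\nabla\overline\sigma_m\bigr)\cdot(u-\overline\sigma_m)\\&\qquad-2\nu\int_0^t\!\int_{\Omega_R}\nabla\overline\sigma_m\cdot\nabla(u-\overline\sigma_m)+2\int_0^t\!\int_{\Omega_R}f\cdot(u-\overline\sigma_m)\end{aligned}$$ and $$\|(u-\overline\sigma_m)(t)\|_{L^2(\Omega_R)}^2+\nu\int_0^t\|\nabla(u-\overline\sigma_m)\|_{L^2(\Omega_R)}^2\le\Bigl(\|u_0-\overline\sigma_m\|_{L^2(\Omega_R)}^2+Cm^2\nu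 t+\|f\|_{L^2([0,t];L^2(\Omega_R))}^2\Bigr)e^{(C|m|+1)t}.$$ -/

import Mathlib

open MeasureTheory Set
open scoped ContDiff RealInnerProductSpace NNReal

noncomputable section

namespace NSEnergy

/-- The Euclidean plane. -/
abbrev E := EuclideanSpace ℝ (Fin 2)

/-- Real 2×2 arrays with the Frobenius norm; a gradient `∇u` has `(i, j)` entry `∂ᵢ uʲ`. -/
abbrev M := EuclideanSpace ℝ (Fin 2 × Fin 2)

/-- The Lebesgue space `L²(Ω; F)`. -/
abbrev L2 (Ω : Set E) (F : Type) [NormedAddCommGroup F] := Lp F 2 (volume.restrict Ω)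

/-- The Hilbert space of pairs `(u, G)` with `u ∈ L²(Ω; ℝ²)`, `G ∈ L²(Ω; ℝ²ˣ²)` and inner product
`(u, v) + (G, K)`. Vector fields `u` in `H¹(Ω)` are identified with the pairs `(u, ∇u)`, so that
this inner product is the one of `H¹(Ω)`. -/
abbrev X (Ω : Set E) := WithLp 2 (L2 Ω E × L2 Ω M)

/-- The classical gradient of a vector field, `(i, j) ↦ ∂ᵢ uʲ`. -/
def grad (u : E → E) (x : E) : M :=
  WithLp.toLp 2 fun p => fderiv ℝ u x (EuclideanSpace.single p.1 1) p.2

/-- The vorticity `∂₁ u² - ∂₂ u¹`. -/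
def vort (u : E → E) (x : E) : ℝ := grad u x (0, 1) - grad u x (1, 0)

/-- The convective term `(u · ∇)u` for `u` with gradient `G`; more generally `u · G`. -/
def conv (u : E → E) (G : E → M) (x : E) : E :=
  WithLp.toLp 2 fun j => ∑ i, u x i * G x (i, j)

/-! ### Function spaces -/

/-- `H¹₀(Ω)`: the closure in `H¹(Ω)` of the smooth vector fields with compact support in `Ω`
(these are the fields of `H¹(Ω)` with zero trace if `Ω` is a disk, and all of `H¹(ℝ²)` if
`Ω = ℝ²`). -/
def H10 (Ω : Set E) : Submodule ℝ (X Ω) :=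
  (Submodule.span ℝ {p : X Ω | ∃ φ : E → E, ContDiff ℝ ∞ φ ∧ HasCompactSupport φ ∧
    tsupport φ ⊆ Ω ∧ p.fst =ᵐ[volume.restrict Ω] φ ∧
    p.snd =ᵐ[volume.restrict Ω] grad φ}).topologicalClosure

/-- The trace of a gradient, as a linear functional. -/
def traceL : M →L[ℝ] ℝ :=
  EuclideanSpace.proj ((0, 0) : Fin 2 × Fin 2) + EuclideanSpace.proj ((1, 1) : Fin 2 × Fin 2)

/-- The divergence `(u, G) ↦ tr G` as an operator from `H¹(Ω)` to `L²(Ω)`. -/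
def divL (Ω : Set E) : X Ω →L[ℝ] L2 Ω ℝ :=
  (traceL.compLpL 2 (volume.restrict Ω)) ∘L (WithLp.sndL 2 ℝ (L2 Ω E) (L2 Ω M))

/-- The space `V(Ω)` of divergence-free fields in `H¹(Ω)` that vanish on the boundary. -/
def V (Ω : Set E) : Submodule ℝ (X Ω) := H10 Ω ⊓ LinearMap.ker (divL Ω).toLinearMap

theorem isClosed_V (Ω : Set E) : IsClosed (V Ω : Set (X Ω)) :=
  (Submodule.isClosed_topologicalClosure _).inter (divL Ω).isClosed_ker

instance completeSpace_V (Ω : Set E) : CompleteSpace (V Ω) :=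
  (isClosed_V Ω).completeSpace_coe

/-- Membership in the space `H(Ω)` of fields `u ∈ L²(Ω)` with `div u = 0` in `Ω` and `u · n = 0` on
`∂Ω`, both in the weak sense: `u` is orthogonal in `L²(Ω)` to all gradients. -/
def InH (Ω : Set E) (u : L2 Ω E) : Prop :=
  ∀ φ : E → ℝ, ContDiff ℝ ∞ φ → HasCompactSupport φ → ∫ x in Ω, fderiv ℝ φ x (u x) = 0

/-! ### The stationary vector fields -/

/-- The radial vector field
`σ(x) = (-x₂/r² ∫₀ʳ ρ g(ρ) dρ, x₁/r² ∫₀ʳ ρ g(ρ) dρ)`, `r = |x|`. -/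
def sigma (g : ℝ → ℝ) (x : E) : E :=
  WithLp.toLp 2 ![-(x 1) / ‖x‖ ^ 2 * ∫ ρ in (0 : ℝ)..‖x‖, ρ * g ρ,
    x 0 / ‖x‖ ^ 2 * ∫ ρ in (0 : ℝ)..‖x‖, ρ * g ρ]

/-- An admissible choice of the field `σ₁`: `σ₁ = sigma g` for a smooth, compactly supported `g`,
the vorticity of `σ₁` being supported in the unit disk and having total mass one. -/
structure Profile where
  g : ℝ → ℝ
  smooth : ContDiff ℝ ∞ g
  compact : HasCompactSupport g
  supp : tsupport (vort (sigma g)) ⊆ Metric.closedBall 0 1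
  mass : ∫ x, vort (sigma g) x = 1

/-- `σₘ = m σ₁`. -/
def Profile.sig (P : Profile) (m : ℝ) (x : E) : E := m • sigma P.g x

/-- `‖∇σ₁‖` in `L²(ℝ²) ∩ L^∞(ℝ²)`. -/
def Profile.gradNorm (P : Profile) : ℝ :=
  (eLpNorm (grad (sigma P.g)) 2 volume).toReal + (eLpNorm (grad (sigma P.g)) ⊤ volume).toReal

/-! The restrictions of `σₘ` and `∇σₘ` to disks are square integrable. -/

theorem sigma_eq (g : ℝ → ℝ) (x : E) :
    sigma g x = (∫ s in (0 : ℝ)..1, s * g (‖x‖ * s)) • (WithLp.toLp 2 ![-(x 1), x 0] : E) := by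
  rcases eq_or_ne x 0 with rfl | hx
  · ext i
    fin_cases i <;> simp [sigma]
  · have hr : ‖x‖ ≠ 0 := norm_ne_zero_iff.2 hx
    have h : ∫ ρ in (0 : ℝ)..‖x‖, ρ * g ρ = ‖x‖ ^ 2 * ∫ s in (0 : ℝ)..1, s * g (‖x‖ * s) := by
      have h1 := intervalIntegral.mul_integral_comp_mul_left (a := 0) (b := 1)
        (f := fun ρ : ℝ => ρ * g ρ) ‖x‖
      simp only [mul_zero, mul_one] at h1
      rw [← h1, pow_two, mul_assoc]
      simp only [mul_assoc, intervalIntegral.integral_const_mul]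
    ext i
    fin_cases i <;> simp only [sigma, h] <;> simp <;> field_simp

theorem norm_rot (x : E) : ‖(WithLp.toLp 2 ![-(x 1), x 0] : E)‖ = ‖x‖ := by
  simp [EuclideanSpace.norm_eq, Fin.sum_univ_two, add_comm]

theorem sigma_lip (P : Profile) (R : ℝ) :
    ∃ C : ℝ≥0, LipschitzOnWith C (sigma P.g) (Metric.ball 0 R) := by
  obtain ⟨L, hL⟩ := P.smooth.lipschitzWith_of_hasCompactSupport P.compact (by simp)
  obtain ⟨B, hB⟩ := P.compact.exists_bound_of_continuous P.smooth.continuous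
  have hc : ∀ r : ℝ, IntervalIntegrable (fun s : ℝ => s * P.g (r * s)) volume 0 1 := fun r =>
    (continuous_id.mul (P.smooth.continuous.comp (continuous_const_mul r))).intervalIntegrable _ _
  have hb : ∀ r : ℝ, |∫ s in (0 : ℝ)..1, s * P.g (r * s)| ≤ B := by
    intro r
    have := intervalIntegral.norm_integral_le_of_norm_le_const (a := (0 : ℝ)) (b := 1) (C := B)
      (f := fun s : ℝ => s * P.g (r * s)) (by
        intro s hs
        rw [uIoc_of_le zero_le_one] at hs
        have h1 := hB (r * s)
        rw [norm_mul, Real.norm_of_nonneg hs.1.le]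
        nlinarith [norm_nonneg (P.g (r * s)), hs.1, hs.2])
    simpa using this
  have hl : ∀ r r' : ℝ, |(∫ s in (0 : ℝ)..1, s * P.g (r * s)) -
      ∫ s in (0 : ℝ)..1, s * P.g (r' * s)| ≤ L * |r - r'| := by
    intro r r'
    rw [← intervalIntegral.integral_sub (hc r) (hc r')]
    have := intervalIntegral.norm_integral_le_of_norm_le_const (a := (0 : ℝ)) (b := 1)
      (C := L * |r - r'|) (f := fun s : ℝ => s * P.g (r * s) - s * P.g (r' * s)) (by
        intro s hs
        rw [uIoc_of_le zero_le_one] at hs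
        have h1 := hL.dist_le_mul (r * s) (r' * s)
        rw [Real.dist_eq, Real.dist_eq, ← sub_mul, abs_mul, abs_of_pos hs.1] at h1
        rw [← mul_sub, norm_mul, Real.norm_of_nonneg hs.1.le, Real.norm_eq_abs]
        have h2 : (0 : ℝ) ≤ L * |r - r'| := by positivity
        have h3 : (L : ℝ) * (|r - r'| * s) ≤ L * |r - r'| := by nlinarith [hs.2]
        nlinarith [abs_nonneg (P.g (r * s) - P.g (r' * s)), hs.1, hs.2])
    simpa using this
  refine ⟨Real.toNNReal (B + L * |R|), LipschitzOnWith.of_dist_le_mul fun x _ y hy => ?_⟩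
  have hB0 : 0 ≤ B := (norm_nonneg _).trans (hB 0)
  rw [Real.coe_toNNReal _ (by positivity), dist_eq_norm, dist_eq_norm, sigma_eq, sigma_eq]
  set a := ∫ s in (0 : ℝ)..1, s * P.g (‖x‖ * s)
  set b := ∫ s in (0 : ℝ)..1, s * P.g (‖y‖ * s)
  have hJ : (WithLp.toLp 2 ![-((x - y) 1), (x - y) 0] : E) =
      (WithLp.toLp 2 ![-(x 1), x 0] : E) - WithLp.toLp 2 ![-(y 1), y 0] := by
    ext i
    fin_cases i <;> simp
    ring
  have key : a • (WithLp.toLp 2 ![-(x 1), x 0] : E) - b • (WithLp.toLp 2 ![-(y 1), y 0] : E) =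
      a • (WithLp.toLp 2 ![-((x - y) 1), (x - y) 0] : E) +
        (a - b) • (WithLp.toLp 2 ![-(y 1), y 0] : E) := by
    rw [hJ, smul_sub, sub_smul]
    abel
  rw [key]
  refine (norm_add_le _ _).trans ?_
  rw [norm_smul, norm_smul, norm_rot, norm_rot, Real.norm_eq_abs, Real.norm_eq_abs]
  have h1 : |a| ≤ B := hb _
  have h2 : |a - b| ≤ L * ‖x - y‖ := (hl _ _).trans
    (mul_le_mul_of_nonneg_left (abs_norm_sub_norm_le x y) L.coe_nonneg)
  have h3 : ‖y‖ ≤ |R| := ((mem_ball_zero_iff.1 hy).le).trans (le_abs_self R)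
  calc |a| * ‖x - y‖ + |a - b| * ‖y‖ ≤ B * ‖x - y‖ + (L * ‖x - y‖) * |R| := by gcongr
    _ = (B + L * |R|) * ‖x - y‖ := by ring

theorem sig_lip (P : Profile) (m R : ℝ) :
    ∃ C : ℝ≥0, LipschitzOnWith C (P.sig m) (Metric.ball 0 R) := by
  obtain ⟨C, hC⟩ := sigma_lip P R
  refine ⟨‖m‖₊ * C, LipschitzOnWith.of_dist_le_mul fun x hx y hy => ?_⟩
  have := hC.dist_le_mul x hx y hy
  simp only [Profile.sig, dist_smul₀, NNReal.coe_mul, coe_nnnorm, mul_assoc]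
  gcongr

theorem memLp_sig (P : Profile) (m R : ℝ) :
    MemLp (P.sig m) 2 (volume.restrict (Metric.ball 0 R)) := by
  obtain ⟨C, hC⟩ := sig_lip P m R
  have : IsFiniteMeasure (volume.restrict (Metric.ball (0 : E) R)) :=
    isFiniteMeasure_restrict.2 measure_ball_lt_top.ne
  refine MemLp.of_bound (hC.continuousOn.aestronglyMeasurable measurableSet_ball) (C * R) ?_
  filter_upwards [ae_restrict_mem measurableSet_ball] with x hx
  have hR : 0 < R := Metric.pos_of_mem_ball hx
  have h1 := hC.dist_le_mul x hx 0 (Metric.mem_ball_self hR)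
  have h0 : P.sig m 0 = 0 := by simp [Profile.sig, sigma_eq]
  rw [h0, dist_zero_right, dist_zero_right] at h1
  exact h1.trans (mul_le_mul_of_nonneg_left (mem_ball_zero_iff.1 hx).le C.coe_nonneg)

theorem measurable_grad (u : E → E) : Measurable (grad u) := by
  refine (WithLp.measurable_toLp 2 _).comp (measurable_pi_lambda _ fun p => ?_)
  exact (by fun_prop : Measurable fun y : E => y p.2).comp
    (measurable_fderiv_apply_const ℝ u (EuclideanSpace.single p.1 1))

theorem memLp_grad_sig (P : Profile) (m R : ℝ) :
    MemLp (grad (P.sig m)) 2 (volume.restrict (Metric.ball 0 R)) := by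
  obtain ⟨C, hC⟩ := sig_lip P m R
  have : IsFiniteMeasure (volume.restrict (Metric.ball (0 : E) R)) :=
    isFiniteMeasure_restrict.2 measure_ball_lt_top.ne
  refine MemLp.of_bound (measurable_grad _).aestronglyMeasurable (Real.sqrt (4 * (C : ℝ) ^ 2)) ?_
  filter_upwards [ae_restrict_mem measurableSet_ball] with x hx
  have h1 := norm_fderiv_le_of_lipschitzOn ℝ (Metric.isOpen_ball.mem_nhds hx) hC
  have h2 : ∀ i j : Fin 2,
      ‖fderiv ℝ (P.sig m) x (EuclideanSpace.single i 1) j‖ ^ 2 ≤ (C : ℝ) ^ 2 := by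
    intro i j
    refine pow_le_pow_left₀ (norm_nonneg _) ?_ 2
    refine (PiLp.norm_apply_le _ j).trans ((ContinuousLinearMap.le_opNorm _ _).trans ?_)
    simpa using h1
  rw [EuclideanSpace.norm_eq]
  refine Real.sqrt_le_sqrt ?_
  simp only [grad, Fintype.sum_prod_type, Fin.sum_univ_two]
  linarith [h2 0 0, h2 0 1, h2 1 0, h2 1 1]

/-- `σₘ` restricted to the disk of radius `R`, as an element of `H¹`. -/
def Profile.sigRestr (P : Profile) (m R : ℝ) : X (Metric.ball 0 R) :=
  WithLp.toLp 2 ((memLp_sig P m R).toLp _, (memLp_grad_sig P m R).toLp _)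

/-- `σ̄ₘ = P_{V_R} σₘ`: restriction to the disk of radius `R` followed by the `H¹`-orthogonal
projection onto `V_R`. -/
def Profile.sigBar (P : Profile) (m R : ℝ) : X (Metric.ball 0 R) :=
  (V (Metric.ball 0 R)).starProjection (P.sigRestr m R)

/-! ### Weak solutions of the Navier-Stokes equations -/

/-- Lebesgue measure on the time interval `(0, T]`. -/
abbrev timeMeas (T : ℝ) : Measure ℝ := volume.restrict (Ioc 0 T)

/-- `u = S + w` satisfies the Navier-Stokes equations on `Ω` during `[0, T]` in the weak sense,
with viscosity `ν`, forcing `f ∈ L²(0, T; H(Ω))` and initial velocity `S + w₀`, `w₀ ∈ H(Ω)`. Here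
`S` is a fixed time-independent vector field with gradient `DS`, and `w(t) ∈ V(Ω)` for almost
every `t`. The functional `g(t)` is `∂ₜu(t) ∈ V(Ω)'`: that `∂ₜu = g` and `u(0) = S + w₀` is expressed
by `u(t) - u(0) = ∫₀ᵗ g` in `V(Ω)'`, where `L²(Ω)` acts on `V(Ω)` by the `L²` inner product. -/
structure IsWeakNS (Ω : Set E) (S : E → E) (DS : E → M) (ν T : ℝ) (f : ℝ → L2 Ω E)
    (w₀ : L2 Ω E) (w : ℝ → X Ω) : Prop where
  init_mem : InH Ω w₀
  force_mem : ∀ᵐ t ∂timeMeas T, InH Ω (f t)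
  force_memLp : MemLp f 2 (timeMeas T)
  meas : AEStronglyMeasurable w (timeMeas T)
  mem_V : ∀ᵐ t ∂timeMeas T, w t ∈ V Ω
  eqn : ∃ g : ℝ → StrongDual ℝ (V Ω), MemLp g 2 (timeMeas T) ∧
    (∀ᵐ t ∂timeMeas T, ∀ v : V Ω,
      ⟪(w t).fst - w₀, (v : X Ω).fst⟫ = ∫ s in (0 : ℝ)..t, g s v) ∧
    (∀ᵐ t ∂timeMeas T, ∀ v : V Ω,
      g t v
        + (∫ x in Ω, ⟪conv (fun y => S y + (w t).fst y) (fun y => DS y + (w t).snd y) x,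
            (v : X Ω).fst x⟫)
        + ν * (∫ x in Ω, ⟪DS x + (w t).snd x, (v : X Ω).snd x⟫)
      = ⟪f t, (v : X Ω).fst⟫)

/-- Weak solutions on the disk of radius `R`: `u ∈ L²(0, T; V_R)`, `∂ₜu ∈ L²(0, T; V_R')`,
`u(0) = u₀ ∈ H_R`. -/
def IsWeakNSDisk (R ν T : ℝ) (f : ℝ → L2 (Metric.ball 0 R) E) (u₀ : L2 (Metric.ball 0 R) E)
    (u : ℝ → X (Metric.ball 0 R)) : Prop :=
  IsWeakNS (Metric.ball 0 R) (fun _ => 0) (fun _ => 0) ν T f u₀ u ∧ MemLp u 2 (timeMeas T)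

/-- Weak solutions in the plane, in the affine space `Eₘ = σₘ + H(ℝ²)`: the velocity is
`u = σₘ + w`, with initial velocity `u₀ = σₘ + w₀ ∈ Eₘ`, with `u(t) ∈ Eₘ` and
`∇u ∈ L²(0, T; L²(ℝ²))` (equivalently `∇w ∈ L²(0, T; L²(ℝ²))`, as `∇σₘ ∈ L²(ℝ²)`). -/
def IsWeakNSPlane (P : Profile) (m ν T : ℝ) (f : ℝ → L2 univ E) (w₀ : L2 univ E)
    (w : ℝ → X univ) : Prop :=
  IsWeakNS univ (P.sig m) (grad (P.sig m)) ν T f w₀ w ∧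
    MemLp (fun t => (w t).snd) 2 (timeMeas T)

/-! ### The energy identity and the energy bound -/

/-- All integrals in the energy identity converge. `D` is the gradient of the background field
`σ̄ₘ`, and `w = u - σ̄ₘ`. -/
def EnergyIntegrable (Ω : Set E) (T : ℝ) (D : E → M) (f : ℝ → L2 Ω E) (w : ℝ → X Ω) : Prop :=
  (∀ᵐ s ∂timeMeas T,
    IntegrableOn (fun x => ⟪conv (w s).fst D x, (w s).fst x⟫) Ω ∧
    IntegrableOn (fun x => ⟪D x, (w s).snd x⟫) Ω) ∧
  IntervalIntegrable (fun s => ‖(w s).snd‖ ^ 2) volume 0 T ∧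
  IntervalIntegrable (fun s => ∫ x in Ω, ⟪conv (w s).fst D x, (w s).fst x⟫) volume 0 T ∧
  IntervalIntegrable (fun s => ∫ x in Ω, ⟪D x, (w s).snd x⟫) volume 0 T ∧
  IntervalIntegrable (fun s => ⟪f s, (w s).fst⟫) volume 0 T

/-- The energy identity at time `t` for `w = u - σ̄ₘ`, where `w₀ = w(0)`, `wt = w(t)` and
`D = ∇σ̄ₘ`. -/
def EnergyIdentity (Ω : Set E) (ν t : ℝ) (D : E → M) (f : ℝ → L2 Ω E) (w₀ : L2 Ω E)
    (w : ℝ → X Ω) (wt : L2 Ω E) : Prop :=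
  ‖wt‖ ^ 2 + 2 * ν * ∫ s in (0 : ℝ)..t, ‖(w s).snd‖ ^ 2 =
    ‖w₀‖ ^ 2 - 2 * (∫ s in (0 : ℝ)..t, ∫ x in Ω, ⟪conv (w s).fst D x, (w s).fst x⟫)
      - 2 * ν * (∫ s in (0 : ℝ)..t, ∫ x in Ω, ⟪D x, (w s).snd x⟫)
      + 2 * ∫ s in (0 : ℝ)..t, ⟪f s, (w s).fst⟫

/-- The energy bound at time `t` for `w = u - σ̄ₘ` with constant `C`. -/
def EnergyBound (Ω : Set E) (C m ν t : ℝ) (f : ℝ → L2 Ω E) (w₀ : L2 Ω E)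
    (w : ℝ → X Ω) (wt : L2 Ω E) : Prop :=
  ‖wt‖ ^ 2 + ν * (∫ s in (0 : ℝ)..t, ‖(w s).snd‖ ^ 2) ≤
    (‖w₀‖ ^ 2 + C * m ^ 2 * ν * t + ∫ s in (0 : ℝ)..t, ‖f s‖ ^ 2) * Real.exp ((C * |m| + 1) * t)

end NSEnergy

end

open MeasureTheory Set
open scoped ContDiff RealInnerProductSpace NNReal

noncomputable section

namespace NSEnergy

open Filter Topology
open scoped ENNReal Convolution

/-! ### Absolutely continuous curves in Hilbert spaces -/

/-! Write `b` for the background field and `w = u - b`. Tested with `w` itself, the equation for `w`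
is an energy balance. Two things have to be justified: that `w` is an admissible test field whose
squared norm may be differentiated, and that the terms containing `b` are controlled independently
of the radius.

The time derivative is handled by `lions_magenes`: if `w` is square integrable in time with values
in `V` and its weak derivative is square integrable with values in the dual, then `w` has a
continuous `L²` representative and `‖w‖²` is the integral of twice the duality pairing. Its abstract
form needs the initial datum in the `L²` closure of `V`. This is the density of `V` in `H`
(`InH.mem_closure_univ`, `InH.mem_closure_ball`), obtained by mollification, preceded in a disk by a
contraction of the support.

Of the four convective terms, `b·∇w` and `w·∇w` vanish against `w` by skew-symmetry, where
Ladyzhenskaya's inequality makes the cubic form continuous. The term `b·∇b` vanishes because `b` has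
the form `β(|x|) x^⊥`: particles move on circles, so the acceleration `-β² x` is the gradient of a
radial pressure and is orthogonal to `V`. Only `w·∇b` survives (`integral_conv_background`). Young's
inequality absorbs half of the dissipation, and Gronwall's lemma gives the bound from estimates of
`∇b` in `L^∞` by a multiple of `|m|` and in `L²` by a multiple of `|m|`.

Uniformity in the radius comes from an explicit formula for the projection. The field `z = β(|x|)
x^⊥` with `β(r) = 2 I₁(r) / r` is divergence free and satisfies `Δz = z`, so it is orthogonal to
`H¹₀` in `H¹`. Subtracting from `σₘ` the multiple of `z` that cancels it on the boundary circle
therefore gives the projection (`sigBar_eq_barX`). Outside the unit disk the angular velocity of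
`σ₁` is proportional to `r⁻²`, while `|∇z|` is at most `4R` times the boundary value of `β`. The
correction thus has gradient of size `|m| / R` on a disk of area `πR²`, which is bounded both in
`L^∞` and in `L²`. -/

theorem absolutelyContinuousOnInterval_of_dist_le {Y Z : Type*} [PseudoMetricSpace Y]
    [PseudoMetricSpace Z] {f : ℝ → Y} {g : ℝ → Z} {a b C : ℝ}
    (hg : AbsolutelyContinuousOnInterval g a b)
    (h : ∀ s ∈ uIcc a b, ∀ t ∈ uIcc a b, dist (f s) (f t) ≤ C * dist (g s) (g t)) :
    AbsolutelyContinuousOnInterval f a b := by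
  rw [absolutelyContinuousOnInterval_iff] at hg ⊢
  intro ε hε
  obtain ⟨δ, hδ, H⟩ := hg (ε / (|C| + 1)) (by positivity)
  refine ⟨δ, hδ, fun I hI hI' => ?_⟩
  have h1 := H I hI hI'
  have h2 : ∑ i ∈ Finset.range I.1, dist (f (I.2 i).1) (f (I.2 i).2) ≤
      (|C| + 1) * ∑ i ∈ Finset.range I.1, dist (g (I.2 i).1) (g (I.2 i).2) := by
    rw [Finset.mul_sum]
    refine Finset.sum_le_sum fun i hi => ?_
    have h3 := hI.1 i hi
    refine (h _ h3.1 _ h3.2).trans ?_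
    gcongr
    exact (le_abs_self C).trans (by linarith)
  refine h2.trans_lt ?_
  rw [lt_div_iff₀ (by positivity)] at h1
  linarith

theorem integrable_inner_of_memLp {α F : Type*} [MeasurableSpace α] {μ : Measure α}
    [NormedAddCommGroup F] [InnerProductSpace ℝ F] {f g : α → F} (hf : MemLp f 2 μ)
    (hg : MemLp g 2 μ) : Integrable (fun x => ⟪f x, g x⟫) μ :=
  (hf.norm.integrable_mul hg.norm).mono' (hf.1.inner hg.1)
    (Eventually.of_forall fun _ => norm_inner_le_norm _ _)

section Hilbert

variable {H : Type*} [NormedAddCommGroup H] [InnerProductSpace ℝ H] [CompleteSpace H]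

/-- Increments of the curve are dominated by those of `∫ ‖z‖`. On a bounded interval the curve is
bounded, so its squared norm inherits absolute continuity. The difference of the two sides is then
absolutely continuous with derivative zero almost everywhere, hence constant. -/
theorem norm_sq_add_integral {T : ℝ} {z : ℝ → H} (hz : IntervalIntegrable z volume 0 T)
    (z₀ : H) {t : ℝ} (hT : 0 ≤ T) (ht : t ∈ Icc 0 T) :
    ‖z₀ + ∫ s in (0 : ℝ)..t, z s‖ ^ 2 =
      ‖z₀‖ ^ 2 + 2 * ∫ s in (0 : ℝ)..t, ⟪z₀ + ∫ r in (0 : ℝ)..s, z r, z s⟫ := by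
  set y : ℝ → H := fun s => z₀ + ∫ r in (0 : ℝ)..s, z r with hy
  have hyc : ContinuousOn y (uIcc 0 T) :=
    continuousOn_const.add (intervalIntegral.continuousOn_primitive_interval' hz left_mem_uIcc)
  obtain ⟨B, hB⟩ := isCompact_uIcc.exists_bound_of_continuousOn hyc
  have hyz : IntervalIntegrable (fun s => ⟪y s, z s⟫) volume 0 T := by
    rw [intervalIntegrable_iff_integrableOn_Ioc_of_le hT] at hz ⊢
    refine Integrable.mono' (hz.norm.const_mul B)
      (((hyc.mono ?_).aestronglyMeasurable measurableSet_Ioc).inner hz.aestronglyMeasurable) ?_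
    · rw [uIcc_of_le hT]
      exact Ioc_subset_Icc_self
    · filter_upwards [ae_restrict_mem measurableSet_Ioc] with s hs
      have := hB s (by rw [uIcc_of_le hT]; exact Ioc_subset_Icc_self hs)
      exact (norm_inner_le_norm _ _).trans (by gcongr)
  have hsub : ∀ s ∈ uIcc 0 T, ∀ t ∈ uIcc 0 T,
      ‖y s - y t‖ ≤ |(∫ r in (0 : ℝ)..s, ‖z r‖) - ∫ r in (0 : ℝ)..t, ‖z r‖| := by
    intro s hs t ht
    have h1 : IntervalIntegrable z volume 0 s := hz.mono_set (uIcc_subset_uIcc left_mem_uIcc hs)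
    have h2 : IntervalIntegrable z volume 0 t := hz.mono_set (uIcc_subset_uIcc left_mem_uIcc ht)
    rw [hy, add_sub_add_left_eq_sub, intervalIntegral.integral_interval_sub_left h1 h2,
      intervalIntegral.integral_interval_sub_left h1.norm h2.norm]
    exact intervalIntegral.norm_integral_le_abs_integral_norm
  have hac1 : AbsolutelyContinuousOnInterval (fun s => ‖y s‖ ^ 2) 0 T := by
    refine absolutelyContinuousOnInterval_of_dist_le (C := 2 * B)
      (hz.norm.absolutelyContinuousOnInterval_intervalIntegral left_mem_uIcc) fun s hs t ht => ?_
    rw [Real.dist_eq, Real.dist_eq]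
    have h1 := (abs_norm_sub_norm_le (y s) (y t)).trans (hsub s hs t ht)
    have h2 : |‖y s‖ + ‖y t‖| ≤ 2 * B := by
      rw [abs_of_nonneg (by positivity)]
      linarith [hB s hs, hB t ht]
    rw [sq_sub_sq, abs_mul]
    exact mul_le_mul h2 h1 (abs_nonneg _) ((abs_nonneg _).trans h2)
  have hac := hac1.sub
    ((hyz.absolutelyContinuousOnInterval_intervalIntegral left_mem_uIcc).const_mul 2)
  obtain ⟨c, hc⟩ := hac.const_of_ae_hasDerivAt_zero (by
    filter_upwards [hz.ae_hasDerivAt_integral, hyz.ae_hasDerivAt_integral] with s h1 h2 hs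
    have h3 := (((h1 hs 0 left_mem_uIcc).const_add z₀).norm_sq).sub
      ((h2 hs 0 left_mem_uIcc).const_mul 2)
    simpa only [hy, sub_self] using h3)
  have h0 := hc 0 left_mem_uIcc
  have h1 := hc t (by rwa [uIcc_of_le hT])
  simp only [hy, Pi.sub_apply, intervalIntegral.integral_same, add_zero, mul_zero, sub_zero]
    at h0 h1
  linarith

end Hilbert

/-! ### The Lions-Magenes lemma -/

section LionsMagenes

variable {Y H : Type*} [NormedAddCommGroup Y] [InnerProductSpace ℝ Y] [CompleteSpace Y]
  [NormedAddCommGroup H] [InnerProductSpace ℝ H] [CompleteSpace H]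

open ContinuousLinearMap in
/-- The resolvent of the positive operator `i† i` at `-ε`. -/
theorem exists_resolvent (i : Y →L[ℝ] H) {ε : ℝ} (hε : 0 < ε) :
    ∃ R : Y →L[ℝ] Y, (∀ u v, ⟪R u, v⟫ = ⟪u, R v⟫) ∧
      (∀ u, adjoint i (i (R u)) = R (adjoint i (i u))) ∧
      (∀ u, R (adjoint i (i u)) = u - ε • R u) ∧ (∀ u, ε * ‖R u‖ ≤ ‖u‖) ∧
      ∀ w, ‖i (R (adjoint i w))‖ ≤ ‖w‖ := by
  set B : Y →L[ℝ] Y →L[ℝ] ℝ :=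
    (innerSL ℝ).comp ((adjoint i).comp i) + ε • (innerSL ℝ : Y →L[ℝ] Y →L[ℝ] ℝ) with hB
  have hBa : ∀ u v, B u v = ⟪i u, i v⟫ + ε * ⟪u, v⟫ := fun u v => by
    simp only [hB, add_apply, comp_apply, smul_apply, smul_eq_mul]
    exact congrArg₂ (· + ·) (adjoint_inner_left i v (i u)) rfl
  have hco : IsCoercive B := by
    refine ⟨ε, hε, fun u => ?_⟩
    rw [hBa, real_inner_self_eq_norm_mul_norm, real_inner_self_eq_norm_mul_norm]
    nlinarith [mul_self_nonneg ‖i u‖]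
  set S := hco.continuousLinearEquivOfBilin
  have hS : ∀ u, S u = adjoint i (i u) + ε • u := by
    intro u
    refine ext_inner_right ℝ fun v => ?_
    rw [hco.continuousLinearEquivOfBilin_apply, hBa, inner_add_left, adjoint_inner_left,
      real_inner_smul_left]
  have hSR : ∀ u, adjoint i (i (S.symm u)) + ε • S.symm u = u := fun u => by
    rw [← hS, S.apply_symm_apply]
  have hRS : ∀ u, S.symm (adjoint i (i u)) + ε • S.symm u = u := fun u => by
    rw [← map_smul, ← map_add, ← hS, S.symm_apply_apply]
  -- Both norm bounds follow from this identity: discard one of the two nonnegative terms on the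
  -- left and apply the Cauchy-Schwarz inequality on the right.
  have hpos : ∀ u, ‖i (S.symm u)‖ ^ 2 + ε * ‖S.symm u‖ ^ 2 = ⟪u, S.symm u⟫ := fun u => by
    have h := congrArg (fun x => ⟪x, S.symm u⟫) (hSR u)
    simp only [inner_add_left, adjoint_inner_left, real_inner_smul_left,
      real_inner_self_eq_norm_sq] at h
    exact h
  refine ⟨S.symm.toContinuousLinearMap, fun u v => ?_, fun u => ?_, fun u => ?_, fun u => ?_,
    fun w => ?_⟩ <;> simp only [ContinuousLinearEquiv.coe_coe]
  · have h := congrArg (fun x => ⟪x, S.symm v⟫) (hSR u)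
    have h' := congrArg (fun x => ⟪S.symm u, x⟫) (hSR v)
    simp only [inner_add_left, inner_add_right, adjoint_inner_left, adjoint_inner_right,
      real_inner_smul_left, real_inner_smul_right] at h h'
    rw [← h, ← h']
  · exact add_right_cancel ((hSR u).trans (hRS u).symm)
  · exact eq_sub_of_add_eq (hRS u)
  · have h1 := hpos u
    have h2 := real_inner_le_norm u (S.symm u)
    rcases eq_or_lt_of_le (norm_nonneg (S.symm u)) with h0 | h0
    · rw [← h0, mul_zero]
      exact norm_nonneg _
    · nlinarith [sq_nonneg ‖i (S.symm u)‖]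
  · have h1 := hpos (adjoint i w)
    rw [adjoint_inner_left] at h1
    have h2 := real_inner_le_norm w (i (S.symm (adjoint i w)))
    rcases eq_or_lt_of_le (norm_nonneg (i (S.symm (adjoint i w)))) with h0 | h0
    · rw [← h0]
      exact norm_nonneg _
    · nlinarith [mul_nonneg hε.le (sq_nonneg ‖S.symm (adjoint i w)‖)]

open ContinuousLinearMap in
/-- Bounded symmetric operators `R n` commuting with `i† i`, such that `R n i† i → 1` strongly. -/
theorem exists_approx_inverse (i : Y →L[ℝ] H) (hi : Function.Injective i) :
    ∃ R : ℕ → Y →L[ℝ] Y, (∀ n u v, ⟪R n u, v⟫ = ⟪u, R n v⟫) ∧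
      (∀ n u, adjoint i (i (R n u)) = R n (adjoint i (i u))) ∧
      (∀ n u, ‖R n (adjoint i (i u))‖ ≤ 2 * ‖u‖) ∧
      (∀ n w, ‖i (R n (adjoint i w))‖ ≤ ‖w‖) ∧
      ∀ u, Tendsto (fun n => R n (adjoint i (i u))) atTop (𝓝 u) := by
  have hε : ∀ n : ℕ, (0 : ℝ) < 1 / (n + 1) := fun n => by positivity
  choose R h1 h2 h3 h4 h5 using fun n : ℕ => exists_resolvent i (hε n)
  have h4' : ∀ (n : ℕ) u, ‖(1 / ((n : ℝ) + 1)) • R n u‖ ≤ ‖u‖ := fun n u => by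
    rw [norm_smul, Real.norm_of_nonneg (hε n).le]
    exact h4 n u
  refine ⟨R, h1, h2, fun n u => ?_, h5, fun u => ?_⟩
  · rw [h3]
    exact (norm_sub_le _ _).trans (by linarith [h4' n u])
  -- Since `R i† i u = u - ε R u`, the claim is `ε R u → 0`. On the range of `i† i` this term is at
  -- most `2 ε ‖z‖`. That range is dense, because a vector `x` orthogonal to it satisfies `‖i x‖² =
  -- 0`. The contraction bound `ε ‖R u‖ ≤ ‖u‖` carries the limit over to all `u`.
  · have hdense : Dense (Set.range (fun z => adjoint i (i z))) := by
      have : (LinearMap.range ((adjoint i).comp i).toLinearMap).topologicalClosure = ⊤ := by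
        rw [Submodule.topologicalClosure_eq_top_iff, eq_bot_iff]
        intro x hx
        have h6 := hx (adjoint i (i x)) ⟨x, rfl⟩
        rw [adjoint_inner_left, inner_self_eq_zero] at h6
        exact hi (by simpa using h6)
      rw [← Submodule.dense_iff_topologicalClosure_eq_top] at this
      exact this
    rw [Metric.tendsto_atTop]
    intro δ hδ
    obtain ⟨_, ⟨z, rfl⟩, hz⟩ := hdense.exists_dist_lt u (half_pos hδ)
    obtain ⟨N, hN⟩ := exists_nat_gt (4 * ‖z‖ / δ)
    refine ⟨N, fun n hn => ?_⟩
    rw [h3, dist_eq_norm, sub_sub_cancel_left, norm_neg]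
    have e : (1 / ((n : ℝ) + 1)) • R n u = (1 / ((n : ℝ) + 1)) • R n (u - adjoint i (i z)) +
        (1 / ((n : ℝ) + 1)) • R n (adjoint i (i z)) := by
      rw [← smul_add, ← map_add, sub_add_cancel]
    rw [e]
    refine (norm_add_le _ _).trans_lt ?_
    have h6 := h4' n (u - adjoint i (i z))
    rw [dist_eq_norm] at hz
    have h7 : ‖(1 / ((n : ℝ) + 1)) • R n (adjoint i (i z))‖ ≤ 1 / ((n : ℝ) + 1) * (2 * ‖z‖) := by
      rw [norm_smul, Real.norm_of_nonneg (hε n).le, h3]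
      gcongr
      exact (norm_sub_le _ _).trans (by linarith [h4' n z])
    have h8 : 1 / ((n : ℝ) + 1) * (2 * ‖z‖) < δ / 2 := by
      rw [div_lt_iff₀ hδ] at hN
      have : (N : ℝ) ≤ n := by exact_mod_cast hn
      rw [one_div, inv_mul_lt_iff₀ (by positivity)]
      nlinarith
    linarith

open ContinuousLinearMap in
-- The curve `y = i† w₀ + ∫ h` takes values in `Y` and equals `i† i w` almost everywhere, but it
-- cannot be paired directly to give `‖i w‖²`. Applying `i R n` produces absolutely continuous
-- curves that approximate `i w` and obey the chain rule exactly. Symmetry and commutation turn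
-- their derivative into `2 ⟪P n (P n w), h⟫`, in which only `w` and `h` occur, both square
-- integrable in time, so the limit can be taken.
theorem lions_magenes {T : ℝ} (hT : 0 < T) (i : Y →L[ℝ] H) (hi : Function.Injective i)
    {w₀ : H} (hw₀ : w₀ ∈ closure (Set.range i)) {w h : ℝ → Y}
    (hw : MemLp w 2 (timeMeas T)) (hh : MemLp h 2 (timeMeas T))
    (hwh : ∀ᵐ t ∂timeMeas T, ∀ v, ⟪i (w t) - w₀, i v⟫ = ∫ s in (0 : ℝ)..t, ⟪h s, v⟫) :
    ∃ z : ℝ → H, ContinuousOn z (Icc 0 T) ∧ (∀ᵐ t ∂timeMeas T, z t = i (w t)) ∧ z 0 = w₀ ∧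
      ∀ t ∈ Icc 0 T, ‖z t‖ ^ 2 = ‖w₀‖ ^ 2 + 2 * ∫ s in (0 : ℝ)..t, ⟪h s, w s⟫ := by
  obtain ⟨R, hsymm, hcomm, hbdd, hbdd', hlim⟩ := exists_approx_inverse i hi
  have hhi : IntervalIntegrable h volume 0 T := by
    rw [intervalIntegrable_iff_integrableOn_Ioc_of_le hT.le]
    exact hh.integrable one_le_two
  have hsubset : ∀ t ∈ Icc 0 T, uIcc 0 t ⊆ uIcc 0 T := fun t ht =>
    uIcc_subset_uIcc left_mem_uIcc (by rwa [uIcc_of_le hT.le])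
  set P : ℕ → Y →L[ℝ] Y := fun n => (R n).comp ((adjoint i).comp i) with hP
  have hPb : ∀ n u, ‖P n u‖ ≤ 2 * ‖u‖ := hbdd
  have hPl : ∀ u, Tendsto (fun n => P n u) atTop (𝓝 u) := hlim
  set y : ℝ → Y := fun t => adjoint i w₀ + ∫ s in (0 : ℝ)..t, h s with hy
  have hyw : ∀ᵐ t ∂timeMeas T, y t = adjoint i (i (w t)) := by
    filter_upwards [hwh, ae_restrict_mem measurableSet_Ioc] with t ht htm
    refine ext_inner_right ℝ fun v => ?_
    have h1 : IntervalIntegrable h volume 0 t := hhi.mono_set (hsubset t (Ioc_subset_Icc_self htm))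
    have h2 : ⟪∫ s in (0 : ℝ)..t, h s, v⟫ = ∫ s in (0 : ℝ)..t, ⟪h s, v⟫ := by
      rw [real_inner_comm]
      refine ((innerSL ℝ v).intervalIntegral_comp_comm h1).symm.trans ?_
      exact intervalIntegral.integral_congr fun s _ => real_inner_comm _ _
    rw [hy, inner_add_left, adjoint_inner_left, adjoint_inner_left, h2, ← ht v, inner_sub_left]
    ring
  -- the regularized curves
  set z : ℕ → ℝ → H := fun n t => i (R n (y t)) with hz
  have hQ : ∀ (Q : Y →L[ℝ] H), ∀ t ∈ Icc 0 T, ‖Q (y t)‖ ^ 2 = ‖Q (y 0)‖ ^ 2 +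
      2 * ∫ s in (0 : ℝ)..t, ⟪Q (y s), Q (h s)⟫ := by
    intro Q t ht
    have hQi : ∀ s ∈ Icc 0 T, Q (y s) = Q (adjoint i w₀) + ∫ r in (0 : ℝ)..s, Q (h r) := by
      intro s hs
      rw [hy, map_add, Q.intervalIntegral_comp_comm (hhi.mono_set (hsubset s hs))]
    have hQh : IntervalIntegrable (fun r => Q (h r)) volume 0 T := by
      rw [intervalIntegrable_iff_integrableOn_Ioc_of_le hT.le] at hhi ⊢
      exact Q.integrable_comp hhi
    have h1 := norm_sq_add_integral hQh (Q (adjoint i w₀)) hT.le ht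
    rw [hQi t ht, hQi 0 ⟨le_rfl, hT.le⟩, intervalIntegral.integral_same, add_zero, h1]
    congr 2
    refine intervalIntegral.integral_congr fun s hs => ?_
    rw [uIcc_of_le ht.1] at hs
    simp only [hQi s ⟨hs.1, hs.2.trans ht.2⟩]
  have hmem : ∀ n, MemLp (fun s => P n (w s)) 2 (timeMeas T) := fun n => (P n).comp_memLp' hw
  -- the error controlling the convergence
  set d : ℕ → ℝ → ℝ := fun n s => ‖P n (w s) - w s‖ * ‖h s‖ with hd
  have hdi : ∀ n, Integrable (d n) (timeMeas T) := fun n =>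
    ((hmem n).sub hw).norm.integrable_mul hh.norm
  set e : ℕ → ℝ := fun n => ∫ s, d n s ∂timeMeas T with he
  have he0 : Tendsto e atTop (𝓝 0) := by
    have := tendsto_integral_of_dominated_convergence (μ := timeMeas T) (F := d) (f := fun _ => 0)
      (fun s => 3 * (‖w s‖ * ‖h s‖)) (fun n => (hdi n).aestronglyMeasurable)
      ((hw.norm.integrable_mul hh.norm).const_mul 3) (fun n => Eventually.of_forall fun s => by
        have : ‖P n (w s) - w s‖ ≤ 3 * ‖w s‖ :=
          (norm_sub_le _ _).trans (by linarith [hPb n (w s)])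
        rw [hd, Real.norm_of_nonneg (by positivity)]
        nlinarith [norm_nonneg (h s)])
      (Eventually.of_forall fun s => by
        have := ((hPl (w s)).sub_const (w s)).norm.mul_const ‖h s‖
        simpa using this)
    simpa using this
  have hint : ∀ {F : ℝ → ℝ} {G : ℝ → ℝ} {t : ℝ}, t ∈ Icc 0 T → Integrable G (timeMeas T) →
      (∀ s, 0 ≤ G s) → (∀ᵐ s ∂timeMeas T, |F s| ≤ G s) →
      |∫ s in (0 : ℝ)..t, F s| ≤ ∫ s, G s ∂timeMeas T := by
    intro F G t ht hG hG0 hFG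
    have hss : Ioc 0 t ⊆ Ioc 0 T := Ioc_subset_Ioc_right ht.2
    have hGt : IntegrableOn G (Ioc 0 t) := IntegrableOn.mono_set hG hss
    rw [intervalIntegral.integral_of_le ht.1]
    calc |∫ s in Ioc 0 t, F s| ≤ ∫ s in Ioc 0 t, G s :=
          norm_integral_le_of_norm_le (f := F) hGt (ae_restrict_of_ae_restrict_of_subset hss hFG)
      _ ≤ ∫ s in Ioc 0 T, G s :=
          setIntegral_mono_set hG (Eventually.of_forall hG0) hss.eventuallyLE
  -- The chain rule applied with `R n - R m` turns the integrand into a pairing of `(P n - P m)² w`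
  -- with `h`. One factor is bounded in norm by 4 and the other is split through `w`. The factor 8
  -- is this 4 times the 2 of the chain rule.
  have hdiff : ∀ n m, ∀ t ∈ Icc 0 T,
      ‖z n t - z m t‖ ^ 2 ≤ ‖z n 0 - z m 0‖ ^ 2 + 8 * (e n + e m) := by
    intro n m t ht
    have h1 := hQ (i.comp (R n - R m)) t ht
    simp only [comp_apply, sub_apply, map_sub] at h1
    rw [h1]
    have h2 := hint (F := fun s => ⟪i (R n (y s)) - i (R m (y s)), i (R n (h s)) - i (R m (h s))⟫)
      (G := fun s => 4 * (d n s + d m s)) ht (((hdi n).add (hdi m)).const_mul 4)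
      (fun s => by positivity) (by
        filter_upwards [hyw] with s hs
        have h3 : ⟪i (R n (y s)) - i (R m (y s)), i (R n (h s)) - i (R m (h s))⟫ =
            ⟪(P n - P m) ((P n - P m) (w s)), h s⟫ := by
          rw [hs]
          have h4 : ∀ a b u v, ⟪i (R a u), i (R b v)⟫ = ⟪R b (adjoint i (i (R a u))), v⟫ := by
            intro a b u v
            rw [hsymm, adjoint_inner_left]
          simp only [inner_sub_left, inner_sub_right, h4, hP, sub_apply, comp_apply, map_sub]
          ring
        rw [h3]
        refine (norm_inner_le_norm (𝕜 := ℝ) _ _).trans ?_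
        have h5 : ∀ u, ‖(P n - P m) u‖ ≤ 4 * ‖u‖ := fun u => by
          rw [sub_apply]
          exact (norm_sub_le _ _).trans (by linarith [hPb n u, hPb m u])
        have h6 : ‖(P n - P m) (w s)‖ ≤ ‖P n (w s) - w s‖ + ‖P m (w s) - w s‖ := by
          rw [sub_apply, ← sub_sub_sub_cancel_right _ _ (w s)]
          exact norm_sub_le _ _
        have h7 := h5 ((P n - P m) (w s))
        simp only [hd]
        nlinarith [norm_nonneg (h s)])
    rw [integral_const_mul, integral_add (hdi n) (hdi m)] at h2
    have h3 := le_abs_self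
      (∫ s in (0 : ℝ)..t, ⟪i (R n (y s)) - i (R m (y s)), i (R n (h s)) - i (R m (h s))⟫)
    have h4 : ∫ s in Ioc 0 T, d n s = e n := rfl
    have h5 : ∫ s in Ioc 0 T, d m s = e m := rfl
    simp only [hz]
    linarith
  have hy0 : y 0 = adjoint i w₀ := by simp [hy]
  -- Here the hypothesis on `w₀` enters: the maps `i R n i†` are contractions and converge to the
  -- identity on the range of `i`, hence on its closure.
  have hz0 : Tendsto (fun n => z n 0) atTop (𝓝 w₀) := by
    rw [Metric.tendsto_atTop]
    intro δ hδ
    obtain ⟨_, ⟨v, rfl⟩, hv⟩ := Metric.mem_closure_iff.1 hw₀ (δ / 3) (by positivity)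
    obtain ⟨N, hN⟩ := Metric.tendsto_atTop.1 ((i.continuous.tendsto v).comp (hPl v)) (δ / 3)
      (by positivity)
    refine ⟨N, fun n hn => ?_⟩
    have h1 := hN n hn
    have h2 := hbdd' n (w₀ - i v)
    have h3 : z n 0 - w₀ =
        i (R n (adjoint i (w₀ - i v))) + (i (P n v) - i v) - (w₀ - i v) := by
      simp only [hz, hy0, hP, map_sub, comp_apply]
      abel
    rw [dist_eq_norm] at hv ⊢
    rw [Function.comp_apply, dist_eq_norm] at h1
    rw [h3]
    have h4 := norm_sub_le (i (R n (adjoint i (w₀ - i v))) + (i (P n v) - i v)) (w₀ - i v)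
    have h5 := norm_add_le (i (R n (adjoint i (w₀ - i v)))) (i (P n v) - i v)
    linarith
  have hcau : UniformCauchySeqOn z atTop (Icc 0 T) := by
    rw [Metric.uniformCauchySeqOn_iff]
    intro δ hδ
    obtain ⟨N₁, hN₁⟩ := Metric.cauchySeq_iff.1 hz0.cauchySeq (δ / 2) (by positivity)
    obtain ⟨N₂, hN₂⟩ := Metric.tendsto_atTop.1 he0 (δ ^ 2 / 32) (by positivity)
    refine ⟨max N₁ N₂, fun m hm n hn t ht => ?_⟩
    have h1 := hN₁ m (le_of_max_le_left hm) n (le_of_max_le_left hn)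
    have h2 := hN₂ m (le_of_max_le_right hm)
    have h3 := hN₂ n (le_of_max_le_right hn)
    rw [Real.dist_0_eq_abs] at h2 h3
    have h4 := hdiff m n t ht
    rw [dist_eq_norm] at h1 ⊢
    have h5 : ‖z m 0 - z n 0‖ ^ 2 < (δ / 2) ^ 2 := by gcongr
    refine lt_of_pow_lt_pow_left₀ 2 hδ.le ?_
    nlinarith [le_abs_self (e m), le_abs_self (e n)]
  have hex : ∀ t, ∃ x, t ∈ Icc 0 T → Tendsto (fun n => z n t) atTop (𝓝 x) := by
    intro t
    by_cases ht : t ∈ Icc 0 T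
    · obtain ⟨x, hx⟩ := cauchySeq_tendsto_of_complete (hcau.cauchySeq ht)
      exact ⟨x, fun _ => hx⟩
    · exact ⟨0, fun h => absurd h ht⟩
  choose Z hZ using hex
  have hyc : ContinuousOn y (Icc 0 T) := by
    rw [← uIcc_of_le hT.le]
    exact continuousOn_const.add
      (intervalIntegral.continuousOn_primitive_interval' hhi left_mem_uIcc)
  refine ⟨Z, (hcau.tendstoUniformlyOn_of_tendsto hZ).continuousOn (Frequently.of_forall fun n =>
    (i.comp (R n)).continuous.comp_continuousOn hyc), ?_,
    tendsto_nhds_unique (hZ 0 ⟨le_rfl, hT.le⟩) hz0, fun t ht => ?_⟩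
  · filter_upwards [hyw, ae_restrict_mem measurableSet_Ioc] with t ht htm
    refine tendsto_nhds_unique (hZ t (Ioc_subset_Icc_self htm)) ?_
    simp only [hz, ht]
    exact (i.continuous.tendsto _).comp (hPl (w t))
  · refine tendsto_nhds_unique ((hZ t ht).norm.pow 2) ?_
    have h1 : ∀ n, ‖z n t‖ ^ 2 = ‖z n 0‖ ^ 2 + 2 * ∫ s in (0 : ℝ)..t, ⟪P n (P n (w s)), h s⟫ := by
      intro n
      rw [show z n t = (i.comp (R n)) (y t) from rfl, hQ (i.comp (R n)) t ht]
      congr 2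
      rw [intervalIntegral.integral_of_le ht.1, intervalIntegral.integral_of_le ht.1]
      refine integral_congr_ae (ae_restrict_of_ae_restrict_of_subset
        (Ioc_subset_Ioc_right ht.2) ?_)
      filter_upwards [hyw] with s hs
      rw [hs, comp_apply, comp_apply, ← adjoint_inner_left, ← hsymm]
      rfl
    simp only [h1]
    refine (hz0.norm.pow 2).add (Tendsto.const_mul 2 ?_)
    rw [tendsto_iff_norm_sub_tendsto_zero]
    have h2 : Tendsto (fun n => 3 * e n) atTop (𝓝 0) := by simpa using he0.const_mul 3
    refine squeeze_zero (fun _ => norm_nonneg _) (fun n => ?_) h2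
    have hi1 : IntegrableOn (fun s => ⟪P n (P n (w s)), h s⟫) (Ioc 0 t) :=
      IntegrableOn.mono_set (s := Ioc 0 t) (t := Ioc 0 T)
        (integrable_inner_of_memLp ((P n).comp_memLp' (hmem n)) hh) (Ioc_subset_Ioc_right ht.2)
    have hi2 : IntegrableOn (fun s => ⟪h s, w s⟫) (Ioc 0 t) :=
      IntegrableOn.mono_set (s := Ioc 0 t) (t := Ioc 0 T)
        (integrable_inner_of_memLp hh hw) (Ioc_subset_Ioc_right ht.2)
    rw [← intervalIntegral.integral_sub
      ((intervalIntegrable_iff_integrableOn_Ioc_of_le ht.1).2 hi1)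
      ((intervalIntegrable_iff_integrableOn_Ioc_of_le ht.1).2 hi2), he, ← integral_const_mul]
    refine hint ht ((hdi n).const_mul 3) (fun s => by positivity)
      (Eventually.of_forall fun s => ?_)
    rw [real_inner_comm, ← inner_sub_right]
    refine (norm_inner_le_norm (𝕜 := ℝ) _ _).trans ?_
    have h5 : P n (P n (w s)) - w s = P n (P n (w s) - w s) + (P n (w s) - w s) := by
      rw [map_sub]
      abel
    have h6 : ‖P n (P n (w s)) - w s‖ ≤ 3 * ‖P n (w s) - w s‖ := by
      rw [h5]
      exact (norm_add_le _ _).trans (by linarith [hPb n (P n (w s) - w s)])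
    simp only [hd]
    nlinarith [norm_nonneg (h s)]

end LionsMagenes

/-! ### Gradients and the convective term -/

theorem grad_apply (u : E → E) (x : E) (i j : Fin 2) :
    grad u x (i, j) = fderiv ℝ u x (EuclideanSpace.single i 1) j := rfl

theorem conv_apply (u : E → E) (G : E → M) (x : E) (j : Fin 2) :
    conv u G x j = ∑ i, u x i * G x (i, j) := rfl

theorem eq_sum_single (v : E) : v = ∑ i, v i • EuclideanSpace.single i (1 : ℝ) := by
  ext j
  fin_cases j <;> simp [Fin.sum_univ_two]

theorem conv_grad (u φ : E → E) (x : E) : conv u (grad φ) x = fderiv ℝ φ x (u x) := by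
  ext j
  rw [conv_apply]
  conv_rhs => rw [eq_sum_single (u x)]
  simp [Fin.sum_univ_two, grad_apply]

theorem norm_sq_M (A : M) : ‖A‖ ^ 2 = A (0, 0) ^ 2 + A (0, 1) ^ 2 + (A (1, 0) ^ 2 + A (1, 1) ^ 2) := by
  rw [EuclideanSpace.real_norm_sq_eq, Fintype.sum_prod_type]
  simp [Fin.sum_univ_two]

theorem norm_sq_E (v : E) : ‖v‖ ^ 2 = v 0 ^ 2 + v 1 ^ 2 := by
  rw [EuclideanSpace.real_norm_sq_eq, Fin.sum_univ_two]

theorem norm_conv_le (u : E → E) (G : E → M) (x : E) : ‖conv u G x‖ ≤ ‖u x‖ * ‖G x‖ := by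
  refine le_of_sq_le_sq ?_ (by positivity)
  rw [mul_pow, norm_sq_M, norm_sq_E, norm_sq_E, conv_apply, conv_apply, Fin.sum_univ_two,
    Fin.sum_univ_two]
  nlinarith [sq_nonneg (u x 0 * G x (1, 0) - u x 1 * G x (0, 0)),
    sq_nonneg (u x 0 * G x (1, 1) - u x 1 * G x (0, 1))]

theorem norm_fderiv_le_norm_grad (φ : E → E) (x : E) : ‖fderiv ℝ φ x‖ ≤ ‖grad φ x‖ := by
  refine ContinuousLinearMap.opNorm_le_bound _ (norm_nonneg _) fun v => ?_
  rw [mul_comm, ← conv_grad (fun _ => v)]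
  exact norm_conv_le _ _ _

theorem continuous_grad {u : E → E} (hu : ContDiff ℝ 1 u) : Continuous (grad u) := by
  refine (PiLp.continuous_toLp 2 _).comp (continuous_pi fun p => ?_)
  have := (hu.continuous_fderiv one_ne_zero).clm_apply
    (continuous_const (y := (EuclideanSpace.single p.1 (1 : ℝ) : E)))
  fun_prop

theorem grad_add {u v : E → E} {x : E} (hu : DifferentiableAt ℝ u x)
    (hv : DifferentiableAt ℝ v x) : grad (u + v) x = grad u x + grad v x := by
  ext p
  simp [grad, fderiv_add hu hv]

theorem grad_const_smul {u : E → E} {x : E} (c : ℝ) (hu : DifferentiableAt ℝ u x) :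
    grad (c • u) x = c • grad u x := by
  ext p
  simp [grad, fderiv_const_smul hu]

theorem grad_eq_zero_of_notMem {u : E → E} {x : E} (hx : x ∉ tsupport u) : grad u x = 0 := by
  ext p
  simp [grad, fderiv_of_notMem_tsupport ℝ hx]

theorem hasCompactSupport_grad {u : E → E} (hu : HasCompactSupport u) :
    HasCompactSupport (grad u) :=
  HasCompactSupport.intro hu fun _ hx => grad_eq_zero_of_notMem hx

/-! ### Test functions -/

/-- The pairs `(φ, ∇φ)`, `φ` smooth with compact support in `Ω`. -/
def testFields (Ω : Set E) : Set (X Ω) :=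
  {p : X Ω | ∃ φ : E → E, ContDiff ℝ ∞ φ ∧ HasCompactSupport φ ∧
    tsupport φ ⊆ Ω ∧ p.fst =ᵐ[volume.restrict Ω] φ ∧
    p.snd =ᵐ[volume.restrict Ω] grad φ}

/-- Since single test fields already form a subspace, elements of `H10` are limits of test fields,
and closed conditions need only be checked on one test field at a time. -/
theorem span_testFields (Ω : Set E) :
    (Submodule.span ℝ (testFields Ω) : Set (X Ω)) = testFields Ω := by
  refine Subset.antisymm (fun p hp => ?_) Submodule.subset_span
  induction hp using Submodule.span_induction with
  | mem p hp => exact hp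
  | zero =>
    refine ⟨0, contDiff_const, HasCompactSupport.zero, by simp, ?_, ?_⟩
    · exact Lp.coeFn_zero _ _ _
    · filter_upwards [Lp.coeFn_zero M 2 (volume.restrict Ω)] with x hx
      have : grad 0 x = 0 := grad_eq_zero_of_notMem (by simp)
      rw [this]
      exact hx
  | add p q _ _ hp hq =>
    obtain ⟨φ, h1, h2, h3, h4, h5⟩ := hp
    obtain ⟨ψ, k1, k2, k3, k4, k5⟩ := hq
    refine ⟨φ + ψ, h1.add k1, h2.add k2, (tsupport_add φ ψ).trans (union_subset h3 k3), ?_, ?_⟩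
    · filter_upwards [Lp.coeFn_add p.fst q.fst, h4, k4] with x hx h h'
      rw [WithLp.add_fst, hx, Pi.add_apply, Pi.add_apply, h, h']
    · filter_upwards [Lp.coeFn_add p.snd q.snd, h5, k5] with x hx h h'
      rw [WithLp.add_snd, hx, Pi.add_apply, h, h',
        grad_add (h1.differentiable (by simp) x) (k1.differentiable (by simp) x)]
  | smul c p _ hp =>
    obtain ⟨φ, h1, h2, h3, h4, h5⟩ := hp
    refine ⟨c • φ, h1.const_smul c, h2.smul_left (f := fun _ => c),
      (tsupport_smul_subset_right (fun _ => c) φ).trans h3, ?_, ?_⟩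
    · filter_upwards [Lp.coeFn_smul c p.fst, h4] with x hx h
      rw [WithLp.smul_fst, hx, Pi.smul_apply, Pi.smul_apply, h]
    · filter_upwards [Lp.coeFn_smul c p.snd, h5] with x hx h
      rw [WithLp.smul_snd, hx, Pi.smul_apply, h,
        grad_const_smul c (h1.differentiable (by simp) x)]

theorem coe_H10 (Ω : Set E) : (H10 Ω : Set (X Ω)) = closure (testFields Ω) := by
  rw [← span_testFields]
  rfl

theorem H10_subset_of_isClosed {Ω : Set E} {s : Set (X Ω)} (hs : IsClosed s)
    (h : testFields Ω ⊆ s) {p : X Ω} (hp : p ∈ H10 Ω) : p ∈ s := by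
  have : p ∈ closure (testFields Ω) := by rwa [← coe_H10]
  exact closure_minimal h hs this

theorem exists_seq_testFields {Ω : Set E} {p : X Ω} (hp : p ∈ H10 Ω) :
    ∃ q : ℕ → X Ω, (∀ n, q n ∈ testFields Ω) ∧ Tendsto q atTop (𝓝 p) := by
  have : p ∈ closure (testFields Ω) := by rwa [← coe_H10]
  exact mem_closure_iff_seq_limit.1 this

theorem testFields_subset_H10 (Ω : Set E) : testFields Ω ⊆ (H10 Ω : Set (X Ω)) := by
  rw [coe_H10]
  exact subset_closure

/-! ### Integration by parts -/

/-- The row-wise divergence `(div K)ʲ = ∑ᵢ ∂ᵢ Kⁱʲ`. -/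
def divM (K : E → M) (x : E) : E :=
  WithLp.toLp 2 fun j => ∑ i, fderiv ℝ K x (EuclideanSpace.single i 1) (i, j)

theorem continuous_divM {K : E → M} (hK : ContDiff ℝ 1 K) : Continuous (divM K) := by
  refine (PiLp.continuous_toLp 2 _).comp (continuous_pi fun j => ?_)
  refine continuous_finsetSum _ fun i _ => ?_
  have := (hK.continuous_fderiv one_ne_zero).clm_apply
    (continuous_const (y := (EuclideanSpace.single i (1 : ℝ) : E)))
  fun_prop

theorem integral_fderiv_mul_eq_neg {f g : E → ℝ} (hf : ContDiff ℝ 1 f) (hg : ContDiff ℝ 1 g)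
    (hc : HasCompactSupport g) (v : E) :
    ∫ x, fderiv ℝ g x v * f x = -∫ x, g x * fderiv ℝ f x v := by
  have hf' : Continuous fun x => fderiv ℝ f x v :=
    (hf.continuous_fderiv one_ne_zero).clm_apply continuous_const
  have hg' : Continuous fun x => fderiv ℝ g x v :=
    (hg.continuous_fderiv one_ne_zero).clm_apply continuous_const
  have hc' : HasCompactSupport fun x => fderiv ℝ g x v := hc.fderiv_apply ℝ v
  simp only [mul_comm (fderiv ℝ g _ v), mul_comm (g _)]
  exact integral_mul_fderiv_eq_neg_fderiv_mul_of_integrable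
    ((hf'.mul hg.continuous).integrable_of_hasCompactSupport hc.mul_left)
    ((hf.continuous.mul hg').integrable_of_hasCompactSupport hc'.mul_left)
    ((hf.continuous.mul hg.continuous).integrable_of_hasCompactSupport hc.mul_left)
    (fun x _ => hf.differentiable one_ne_zero x) (fun x _ => hg.differentiable one_ne_zero x)

theorem fderiv_comp_proj {ι : Type} [Fintype ι] {f : E → EuclideanSpace ℝ ι} {x : E}
    (hf : DifferentiableAt ℝ f x) (v : E) (i : ι) :
    fderiv ℝ (fun y => f y i) x v = fderiv ℝ f x v i := by
  have := ((EuclideanSpace.proj i : EuclideanSpace ℝ ι →L[ℝ] ℝ).hasFDerivAt.comp x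
    hf.hasFDerivAt).fderiv
  exact congrArg (fun L => L v) this

theorem integral_inner_grad_eq_neg {φ : E → E} {K : E → M} (hφ : ContDiff ℝ 1 φ)
    (hc : HasCompactSupport φ) (hK : ContDiff ℝ 1 K) :
    ∫ x, ⟪grad φ x, K x⟫ = -∫ x, ⟪φ x, divM K x⟫ := by
  have hφj : ∀ j, ContDiff ℝ 1 fun x => φ x j := fun j =>
    (EuclideanSpace.proj j : E →L[ℝ] ℝ).contDiff.comp hφ
  have hKj : ∀ q, ContDiff ℝ 1 fun x => K x q := fun q =>
    (EuclideanSpace.proj q : M →L[ℝ] ℝ).contDiff.comp hK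
  have hcj : ∀ j, HasCompactSupport fun x => φ x j := fun j =>
    hc.comp_left (g := fun v : E => v j) rfl
  have h1 : ∀ i j, ∫ x, grad φ x (i, j) * K x (i, j) =
      -∫ x, φ x j * fderiv ℝ K x (EuclideanSpace.single i 1) (i, j) := by
    intro i j
    have := integral_fderiv_mul_eq_neg (hKj (i, j)) (hφj j) (hcj j) (EuclideanSpace.single i 1)
    simpa only [grad_apply, fderiv_comp_proj (hφ.differentiable one_ne_zero _),
      fderiv_comp_proj (hK.differentiable one_ne_zero _)] using this
  have hi1 : ∀ i j, Integrable fun x => grad φ x (i, j) * K x (i, j) := by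
    intro i j
    refine Continuous.integrable_of_hasCompactSupport ?_ (HasCompactSupport.mul_right
      ((hasCompactSupport_grad hc).comp_left (g := fun v : M => v (i, j)) rfl))
    have := continuous_grad hφ
    have := (hKj (i, j)).continuous
    fun_prop
  have hi2 : ∀ i j, Integrable fun x =>
      φ x j * fderiv ℝ K x (EuclideanSpace.single i 1) (i, j) := by
    intro i j
    refine Continuous.integrable_of_hasCompactSupport ?_ (hcj j).mul_right
    have := (hK.continuous_fderiv one_ne_zero).clm_apply
      (continuous_const (y := (EuclideanSpace.single i (1 : ℝ) : E)))
    have := (hφj j).continuous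
    fun_prop
  have e1 : ∀ x, ⟪grad φ x, K x⟫ = ∑ i, ∑ j, grad φ x (i, j) * K x (i, j) := fun x => by
    simp [PiLp.inner_apply, Fintype.sum_prod_type, mul_comm]
  have e2 : ∀ x, ⟪φ x, divM K x⟫ =
      ∑ i, ∑ j, φ x j * fderiv ℝ K x (EuclideanSpace.single i 1) (i, j) := fun x => by
    simp only [PiLp.inner_apply, divM, Fin.sum_univ_two]
    simp
    ring
  simp only [e1, e2]
  rw [integral_finsetSum _ fun i _ => integrable_finsetSum _ fun j _ => hi1 i j,
    integral_finsetSum _ fun i _ => integrable_finsetSum _ fun j _ => hi2 i j,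
    ← Finset.sum_neg_distrib]
  refine Finset.sum_congr rfl fun i _ => ?_
  rw [integral_finsetSum _ fun j _ => hi1 i j, integral_finsetSum _ fun j _ => hi2 i j,
    ← Finset.sum_neg_distrib]
  exact Finset.sum_congr rfl fun j _ => h1 i j

theorem inner_toLp_eq_integral {α F : Type} [MeasurableSpace α] {μ : Measure α}
    [NormedAddCommGroup F] [InnerProductSpace ℝ F] (f : Lp F 2 μ) {g : α → F} (hg : MemLp g 2 μ) :
    ⟪f, hg.toLp g⟫ = ∫ x, ⟪f x, g x⟫ ∂μ := by
  rw [L2.inner_def]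
  refine integral_congr_ae ?_
  filter_upwards [hg.coeFn_toLp] with x hx
  rw [hx]

theorem setIntegral_congr_integral_of_tsupport {Ω : Set E} {φ : E → E} {F : E → ℝ}
    (hφ : tsupport φ ⊆ Ω) (hF : ∀ x ∉ tsupport φ, F x = 0) : ∫ x in Ω, F x = ∫ x, F x :=
  setIntegral_eq_integral_of_forall_compl_eq_zero fun x hx => hF x fun h => hx (hφ h)

/-- Both sides are continuous in `p`, being `L²` inner products with fixed fields, so the compactly
supported case suffices. The matrix field `K` need not vanish at the boundary, because `p` does. -/
theorem integral_inner_snd_eq_neg {Ω : Set E} {K : E → M} (hK : ContDiff ℝ 1 K)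
    (hK2 : MemLp K 2 (volume.restrict Ω)) (hd : MemLp (divM K) 2 (volume.restrict Ω)) {p : X Ω}
    (hp : p ∈ H10 Ω) : ∫ x in Ω, ⟪p.snd x, K x⟫ = -∫ x in Ω, ⟪p.fst x, divM K x⟫ := by
  have h1 := H10_subset_of_isClosed
    (s := {p : X Ω | ⟪p.snd, hK2.toLp K⟫ = -⟪p.fst, hd.toLp (divM K)⟫})
    (isClosed_eq (by fun_prop) (by fun_prop)) (fun q hq => ?_) hp
  · simpa only [mem_ofPred_eq, inner_toLp_eq_integral] using h1
  · obtain ⟨φ, h1, h2, h3, h4, h5⟩ := hq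
    simp only [mem_ofPred_eq, inner_toLp_eq_integral]
    have e1 : ∫ x in Ω, ⟪q.snd x, K x⟫ = ∫ x, ⟪grad φ x, K x⟫ := by
      rw [← setIntegral_congr_integral_of_tsupport h3
        (fun x hx => by rw [grad_eq_zero_of_notMem hx, inner_zero_left])]
      exact integral_congr_ae (h5.mono fun x hx => by simp only [hx])
    have e2 : ∫ x in Ω, ⟪q.fst x, divM K x⟫ = ∫ x, ⟪φ x, divM K x⟫ := by
      rw [← setIntegral_congr_integral_of_tsupport h3
        (fun x hx => by rw [image_eq_zero_of_notMem_tsupport hx, inner_zero_left])]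
      exact integral_congr_ae (h4.mono fun x hx => by simp only [hx])
    rw [e1, e2]
    exact integral_inner_grad_eq_neg (h1.of_le (by simp)) h2 hK

theorem contDiff_smul_const_M {ψ : E → ℝ} (hψ : ContDiff ℝ 1 ψ) (A : M) :
    ContDiff ℝ 1 fun x => ψ x • A := hψ.smul contDiff_const

/-- This is uniqueness of the weak gradient, tested with one matrix entry at a time. It makes the
map from `V` to `L²` injective, as required by the abstract evolution lemma. -/
theorem snd_eq_zero_of_fst_eq_zero {Ω : Set E} (hΩ : IsOpen Ω) {p : X Ω} (hp : p ∈ H10 Ω)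
    (h0 : p.fst = 0) : p.snd = 0 := by
  rw [Lp.eq_zero_iff_ae_eq_zero]
  have hc : ∀ q : Fin 2 × Fin 2, ∀ᵐ x ∂volume, x ∈ Ω → p.snd x q = 0 := by
    intro q
    have h1 : MemLp (fun x => p.snd x q) 2 (volume.restrict Ω) :=
      (EuclideanSpace.proj q : M →L[ℝ] ℝ).comp_memLp' (Lp.memLp p.snd)
    refine hΩ.ae_eq_zero_of_integral_contDiff_smul_eq_zero
      (locallyIntegrableOn_of_locallyIntegrable_restrict (h1.locallyIntegrable one_le_two))
      fun ψ hψ hψc hψs => ?_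
    have hψ1 : ContDiff ℝ 1 ψ := hψ.of_le (by simp)
    have hK := contDiff_smul_const_M hψ1 (EuclideanSpace.single q 1)
    have hKc : HasCompactSupport fun x => ψ x • (EuclideanSpace.single q 1 : M) :=
      hψc.smul_right (f' := fun _ => (EuclideanSpace.single q 1 : M))
    have hdc : HasCompactSupport (divM fun x => ψ x • (EuclideanSpace.single q 1 : M)) := by
      refine HasCompactSupport.intro hKc fun x hx => ?_
      ext j
      simp [divM, fderiv_of_notMem_tsupport ℝ hx]
    have h2 := integral_inner_snd_eq_neg hK
      ((hK.continuous.memLp_of_hasCompactSupport hKc).restrict Ω)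
      (((continuous_divM hK).memLp_of_hasCompactSupport hdc).restrict Ω) hp
    have h3 : ∫ x in Ω, ⟪p.fst x, divM (fun x => ψ x • (EuclideanSpace.single q 1 : M)) x⟫ = 0 := by
      refine integral_eq_zero_of_ae ?_
      rw [h0]
      filter_upwards [Lp.coeFn_zero E 2 (volume.restrict Ω)] with x hx
      rw [hx, Pi.zero_apply, inner_zero_left, Pi.zero_apply]
    rw [h3, neg_zero] at h2
    rw [← setIntegral_eq_integral_of_forall_compl_eq_zero (s := Ω), ← h2]
    · refine integral_congr_ae (Eventually.of_forall fun x => ?_)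
      simp [real_inner_smul_right, EuclideanSpace.inner_single_right]
    · intro x hx
      rw [image_eq_zero_of_notMem_tsupport fun h => hx (hψs h), zero_smul]
  have := ae_all_iff.2 hc
  rw [EventuallyEq, ae_restrict_iff' hΩ.measurableSet]
  filter_upwards [this] with x hx hxΩ
  ext q
  exact hx q hxΩ

theorem traceL_apply (A : M) : traceL A = A (0, 0) + A (1, 1) := rfl

theorem traceL_snd_eq_zero {Ω : Set E} {p : X Ω} (hp : p ∈ V Ω) :
    ∀ᵐ x ∂volume.restrict Ω, traceL (p.snd x) = 0 := by
  have h1 : traceL.compLpL 2 (volume.restrict Ω) p.snd = 0 := hp.2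
  have h2 := traceL.coeFn_compLpL (p := 2) p.snd
  rw [h1] at h2
  filter_upwards [h2, Lp.coeFn_zero ℝ 2 (volume.restrict Ω)] with x h h'
  rw [← h, h', Pi.zero_apply]

/-- The identity matrix. -/
def idM : M := WithLp.toLp 2 fun q => if q.1 = q.2 then 1 else 0

theorem divM_smul_idM {ψ : E → ℝ} {x : E} (hψ : DifferentiableAt ℝ ψ x) (j : Fin 2) :
    divM (fun x => ψ x • idM) x j = fderiv ℝ ψ x (EuclideanSpace.single j 1) := by
  have : fderiv ℝ (fun x => ψ x • idM) x = (fderiv ℝ ψ x).smulRight idM :=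
    (hψ.hasFDerivAt.smul_const idM).fderiv
  simp only [divM, this, ContinuousLinearMap.smulRight_apply]
  fin_cases j <;> simp [idM]

theorem inner_divM_smul_idM {ψ : E → ℝ} {x : E} (hψ : DifferentiableAt ℝ ψ x) (v : E) :
    ⟪v, divM (fun x => ψ x • idM) x⟫ = fderiv ℝ ψ x v := by
  conv_rhs => rw [eq_sum_single v]
  rw [PiLp.inner_apply, map_sum]
  refine Finset.sum_congr rfl fun j _ => ?_
  rw [divM_smul_idM hψ, map_smul]
  simp [mul_comm]

/-- Integrate by parts against `ψ` times the identity matrix, whose row-wise divergence is `∇ψ` and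
whose product with a trace-free gradient is zero. No support condition on `ψ` is imposed, so that
pressures are allowed. -/
theorem integral_fderiv_apply_eq_zero {Ω : Set E} {ψ : E → ℝ} (hψ : ContDiff ℝ 1 ψ)
    (hψ2 : MemLp ψ 2 (volume.restrict Ω)) (hd : MemLp (fderiv ℝ ψ) 2 (volume.restrict Ω))
    {p : X Ω} (hp : p ∈ V Ω) : ∫ x in Ω, fderiv ℝ ψ x (p.fst x) = 0 := by
  have hψd := hψ.differentiable one_ne_zero
  have hK := contDiff_smul_const_M hψ idM
  have hK2 : MemLp (fun x => ψ x • idM) 2 (volume.restrict Ω) := by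
    refine hψ2.of_le_mul (c := ‖idM‖) hK.continuous.aestronglyMeasurable
      (Eventually.of_forall fun x => ?_)
    rw [norm_smul, mul_comm]
  have hd2 : MemLp (divM fun x => ψ x • idM) 2 (volume.restrict Ω) := by
    refine hd.of_le_mul (c := 1) (continuous_divM hK).aestronglyMeasurable
      (Eventually.of_forall fun x => ?_)
    rw [one_mul]
    rcases eq_or_ne (divM (fun x => ψ x • idM) x) 0 with h | h
    · rw [h, norm_zero]
      exact norm_nonneg _
    · have h1 := inner_divM_smul_idM (hψd x) (divM (fun x => ψ x • idM) x)
      rw [real_inner_self_eq_norm_mul_norm] at h1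
      have h2 := (le_abs_self _).trans
        ((fderiv ℝ ψ x).le_opNorm (divM (fun x => ψ x • idM) x))
      rw [← h1] at h2
      exact le_of_mul_le_mul_right h2 (norm_pos_iff.2 h)
  have h := integral_inner_snd_eq_neg hK hK2 hd2 hp.1
  have h0 : ∫ x in Ω, ⟪p.snd x, ψ x • idM⟫ = 0 := by
    refine integral_eq_zero_of_ae ?_
    filter_upwards [traceL_snd_eq_zero hp] with x hx
    rw [traceL_apply] at hx
    rw [real_inner_smul_right, PiLp.inner_apply, Fintype.sum_prod_type, Pi.zero_apply]
    simp only [Fin.sum_univ_two, idM]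
    simp [hx]
  rw [h0] at h
  simp only [inner_divM_smul_idM (hψd _)] at h
  linarith

/-! ### Ladyzhenskaya's inequality and the convective term -/

open scoped ENNReal

/-- Ladyzhenskaya's argument: in the plane the `L²` norm is bounded by the `L¹` norm of the
gradient. Apply this to `‖φ‖²`, whose derivative is twice `⟪φ, ∇φ⟫`, and use the Cauchy-Schwarz
inequality. -/
theorem exists_eLpNorm_four_le_of_contDiff : ∃ C : ℝ≥0, ∀ φ : E → E, ContDiff ℝ 1 φ →
    HasCompactSupport φ → eLpNorm φ 4 volume ^ 2 ≤
      C * (eLpNorm φ 2 volume * eLpNorm (grad φ) 2 volume) := by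
  refine ⟨eLpNormLESNormFDerivOneConst (volume : Measure E) ((2 : ℝ≥0) : ℝ) * 2, fun φ hφ hc => ?_⟩
  have hu : ContDiff ℝ 1 fun x => ‖φ x‖ ^ 2 := hφ.norm_sq ℝ
  have huc : HasCompactSupport fun x => ‖φ x‖ ^ 2 := hc.comp_left (g := fun v => ‖v‖ ^ 2) (by simp)
  have hp : NNReal.HolderConjugate (Module.finrank ℝ E) 2 := by
    rw [finrank_euclideanSpace_fin]
    exact_mod_cast NNReal.HolderConjugate.two_two
  have h1 := eLpNorm_le_eLpNorm_fderiv_one volume hu huc hp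
  have h2 : eLpNorm (fun x => ‖φ x‖ ^ 2) 2 volume = eLpNorm φ 4 volume ^ 2 := by
    have := eLpNorm_norm_rpow (p := 2) (μ := volume) φ (q := 2) (by norm_num)
    have e : (2 : ℝ≥0∞) * ENNReal.ofReal 2 = 4 := by
      rw [ENNReal.ofReal_ofNat]; norm_num
    rw [e] at this
    exact_mod_cast this
  have h3 : eLpNorm (fderiv ℝ fun x => ‖φ x‖ ^ 2) 1 volume ≤
      2 * eLpNorm φ 2 volume * eLpNorm (grad φ) 2 volume := by
    refine le_trans ?_ (eLpNorm_le_eLpNorm_mul_eLpNorm_of_nnnorm (r := 1)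
      hφ.continuous.aestronglyMeasurable (continuous_grad hφ).aestronglyMeasurable
      (fun v A => 2 * (‖v‖ * ‖A‖)) 2 (Eventually.of_forall fun x => ?_))
    · refine eLpNorm_mono_real fun x => ?_
      rw [((hφ.differentiable one_ne_zero x).hasFDerivAt.norm_sq).fderiv]
      refine ContinuousLinearMap.opNorm_le_bound _ (by positivity) fun v => ?_
      have h4 : ‖⟪φ x, fderiv ℝ φ x v⟫‖ ≤ ‖φ x‖ * (‖grad φ x‖ * ‖v‖) :=
        (norm_inner_le_norm _ _).trans (by
          gcongr
          exact ((fderiv ℝ φ x).le_opNorm v).trans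
            (by gcongr; exact norm_fderiv_le_norm_grad φ x))
      simp only [smul_apply, ContinuousLinearMap.comp_apply,
        innerSL_apply_apply, nsmul_eq_mul, norm_mul]
      norm_num
      rw [Real.norm_eq_abs] at h4
      linarith
    · rw [← NNReal.coe_le_coe]
      simp [mul_assoc]
  rw [← h2]
  refine h1.trans ?_
  calc _ ≤ (eLpNormLESNormFDerivOneConst (volume : Measure E) ((2 : ℝ≥0) : ℝ) : ℝ≥0∞) *
        (2 * eLpNorm φ 2 volume * eLpNorm (grad φ) 2 volume) := by gcongr
    _ = _ := by push_cast; ring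

theorem norm_fst_le {Ω : Set E} (p : X Ω) : ‖p.fst‖ ≤ ‖p‖ := by
  have := WithLp.prod_norm_sq_eq_of_L2 p
  exact le_of_sq_le_sq (by nlinarith [sq_nonneg ‖p.snd‖]) (norm_nonneg _)

theorem norm_snd_le {Ω : Set E} (p : X Ω) : ‖p.snd‖ ≤ ‖p‖ := by
  have := WithLp.prod_norm_sq_eq_of_L2 p
  exact le_of_sq_le_sq (by nlinarith [sq_nonneg ‖p.fst‖]) (norm_nonneg _)

/-- The constant is independent of `Ω` because test fields extend by zero to the plane. The bound
passes to limits by Fatou's lemma along a subsequence converging almost everywhere. -/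
theorem exists_eLpNorm_four_le : ∃ C : ℝ≥0, ∀ (Ω : Set E), MeasurableSet Ω → ∀ p ∈ H10 Ω,
    eLpNorm p.fst 4 (volume.restrict Ω) ≤ C * ENNReal.ofReal ‖p‖ := by
  obtain ⟨C, hC⟩ := exists_eLpNorm_four_le_of_contDiff
  -- The inequality `C ≤ (C + 1)²` replaces a square root of `C`.
  refine ⟨C + 1, fun Ω hΩ => ?_⟩
  have htest : ∀ p ∈ testFields Ω,
      eLpNorm p.fst 4 (volume.restrict Ω) ≤ (C + 1 : ℝ≥0) * ENNReal.ofReal ‖p‖ := by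
    rintro p ⟨φ, h1, h2, h3, h4, h5⟩
    have e1 : eLpNorm φ 2 volume = ENNReal.ofReal ‖p.fst‖ := by
      rw [Lp.norm_def, ENNReal.ofReal_toReal (Lp.memLp p.fst).2.ne, eLpNorm_congr_ae h4,
        eLpNorm_restrict_eq_of_support_subset ((subset_tsupport _).trans h3)]
    have e2 : eLpNorm (grad φ) 2 volume = ENNReal.ofReal ‖p.snd‖ := by
      rw [Lp.norm_def, ENNReal.ofReal_toReal (Lp.memLp p.snd).2.ne, eLpNorm_congr_ae h5,
        eLpNorm_restrict_eq_of_support_subset]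
      intro x hx
      by_contra hxΩ
      exact hx (grad_eq_zero_of_notMem fun h => hxΩ (h3 h))
    have h6 := hC φ (h1.of_le (by simp)) h2
    rw [e1, e2] at h6
    rw [eLpNorm_congr_ae h4,
      eLpNorm_restrict_eq_of_support_subset ((subset_tsupport _).trans h3)]
    refine (ENNReal.pow_le_pow_left_iff two_ne_zero).1 (h6.trans ?_)
    have h7 : ENNReal.ofReal ‖p.fst‖ ≤ ENNReal.ofReal ‖p‖ :=
      ENNReal.ofReal_le_ofReal (norm_fst_le p)
    have h8 : ENNReal.ofReal ‖p.snd‖ ≤ ENNReal.ofReal ‖p‖ :=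
      ENNReal.ofReal_le_ofReal (norm_snd_le p)
    have h9 : (C : ℝ≥0∞) ≤ ((C + 1 : ℝ≥0) : ℝ≥0∞) ^ 2 := by
      norm_cast
      nlinarith [C.2]
    rw [mul_pow, sq (ENNReal.ofReal ‖p‖)]
    gcongr
  intro p hp
  obtain ⟨q, hq, hlim⟩ := exists_seq_testFields hp
  have hfst : Tendsto (fun n => (q n).fst) atTop (𝓝 p.fst) :=
    ((WithLp.continuous_fst 2 _ _).tendsto p).comp hlim
  obtain ⟨ns, hns, hae⟩ := (tendstoInMeasure_of_tendsto_Lp hfst).exists_seq_tendsto_ae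
  refine (Lp.eLpNorm_lim_le_liminf_eLpNorm (fun n => Lp.aestronglyMeasurable _) _ hae).trans ?_
  have hl : Tendsto (fun n => ((C + 1 : ℝ≥0) : ℝ≥0∞) * ENNReal.ofReal ‖q (ns n)‖) atTop
      (𝓝 ((C + 1 : ℝ≥0) * ENNReal.ofReal ‖p‖)) :=
    ENNReal.Tendsto.const_mul (ENNReal.tendsto_ofReal (hlim.comp hns.tendsto_atTop).norm)
      (Or.inr ENNReal.coe_ne_top)
  rw [← hl.liminf_eq]
  exact liminf_le_liminf (Eventually.of_forall fun n => htest _ (hq (ns n)))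

instance holderTriple_four_four_two : ENNReal.HolderTriple 4 4 2 where
  inv_add_inv_eq_inv := by
    rw [← ENNReal.toReal_eq_toReal_iff' (by simp) (by simp), ENNReal.toReal_add (by simp) (by simp)]
    simp
    norm_num

theorem aestronglyMeasurable_conv {μ : Measure E} {u : E → E} {G : E → M}
    (hu : AEStronglyMeasurable u μ) (hG : AEStronglyMeasurable G μ) :
    AEStronglyMeasurable (conv u G) μ := by
  have h : Continuous fun q : E × M =>
      (WithLp.toLp 2 fun j => ∑ i, q.1 i * q.2 (i, j) : E) := by
    refine (PiLp.continuous_toLp 2 _).comp (continuous_pi fun j => ?_)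
    fun_prop
  exact h.comp_aestronglyMeasurable (hu.prodMk hG)

/-- Hölder's inequality for the convective term. -/
theorem eLpNorm_inner_conv_le {μ : Measure E} {a b c s : ℝ≥0∞} [ENNReal.HolderTriple a c s]
    [ENNReal.HolderTriple s b 1] {u v : E → E} {G : E → M} (hu : AEStronglyMeasurable u μ)
    (hv : AEStronglyMeasurable v μ) (hG : AEStronglyMeasurable G μ) :
    eLpNorm (fun x => ⟪conv u G x, v x⟫) 1 μ ≤ eLpNorm u a μ * eLpNorm v c μ * eLpNorm G b μ := by
  have h1 : eLpNorm (fun x => ‖u x‖ * ‖v x‖) s μ ≤ 1 * eLpNorm u a μ * eLpNorm v c μ :=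
    eLpNorm_le_eLpNorm_mul_eLpNorm_of_nnnorm hu hv (fun y z => ‖y‖ * ‖z‖) 1
      (Eventually.of_forall fun x => by simp)
  have h2 : eLpNorm (fun x => (‖u x‖ * ‖v x‖) * ‖G x‖) 1 μ ≤
      1 * eLpNorm (fun x => ‖u x‖ * ‖v x‖) s μ * eLpNorm G b μ :=
    eLpNorm_le_eLpNorm_mul_eLpNorm_of_nnnorm (hu.norm.mul hv.norm) hG (fun y z => y * ‖z‖) 1
      (Eventually.of_forall fun x => by simp)
  refine (eLpNorm_mono_real fun x => ?_).trans (h2.trans ?_)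
  · refine (norm_inner_le_norm _ _).trans ?_
    have := norm_conv_le u G x
    calc ‖conv u G x‖ * ‖v x‖ ≤ (‖u x‖ * ‖G x‖) * ‖v x‖ := by gcongr
      _ = _ := by ring
  · rw [one_mul] at h1 ⊢
    gcongr

/-- The exponent `s` is that of the product `‖u‖ ‖v‖`. The triples `(a, c, b)` that occur are `(4,
4, 2)` for the cubic term, `(∞, 2, 2)` for transport by a bounded field, and `(2, 2, ∞)` for a
bounded gradient. -/
theorem integrable_inner_conv {μ : Measure E} {a b c : ℝ≥0∞} (s : ℝ≥0∞)
    [ENNReal.HolderTriple a c s] [ENNReal.HolderTriple s b 1] {u v : E → E} {G : E → M}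
    (hu : MemLp u a μ) (hv : MemLp v c μ) (hG : MemLp G b μ) :
    Integrable (fun x => ⟪conv u G x, v x⟫) μ := by
  rw [← memLp_one_iff_integrable]
  refine ⟨(aestronglyMeasurable_conv hu.1 hG.1).inner hv.1,
    (eLpNorm_inner_conv_le (a := a) (b := b) (c := c) (s := s) hu.1 hv.1 hG.1).trans_lt ?_⟩
  exact ENNReal.mul_lt_top (ENNReal.mul_lt_top hu.2 hv.2) hG.2

theorem abs_integral_inner_conv_le {μ : Measure E} {a b c : ℝ≥0∞} (s : ℝ≥0∞)
    [ENNReal.HolderTriple a c s] [ENNReal.HolderTriple s b 1] {u v : E → E} {G : E → M}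
    (hu : MemLp u a μ) (hv : MemLp v c μ) (hG : MemLp G b μ) :
    |∫ x, ⟪conv u G x, v x⟫ ∂μ| ≤
      (eLpNorm u a μ).toReal * (eLpNorm v c μ).toReal * (eLpNorm G b μ).toReal := by
  have h1 := enorm_integral_le_lintegral_enorm (μ := μ) fun x => ⟪conv u G x, v x⟫
  rw [← eLpNorm_one_eq_lintegral_enorm] at h1
  have h2 := h1.trans
    (eLpNorm_inner_conv_le (a := a) (b := b) (c := c) (s := s) hu.1 hv.1 hG.1)
  have h3 := ENNReal.toReal_mono
    (ENNReal.mul_lt_top (ENNReal.mul_lt_top hu.2 hv.2) hG.2).ne h2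
  rwa [toReal_enorm, ENNReal.toReal_mul, ENNReal.toReal_mul] at h3

theorem conv_add_left (u v : E → E) (G : E → M) (x : E) :
    conv (fun y => u y + v y) G x = conv u G x + conv v G x := by
  ext j
  simp [conv, add_mul, Finset.sum_add_distrib]

theorem conv_add_right (u : E → E) (G K : E → M) (x : E) :
    conv u (fun y => G y + K y) x = conv u G x + conv u K x := by
  ext j
  simp [conv, mul_add, Finset.sum_add_distrib]

theorem conv_congr {u v : E → E} {G K : E → M} {x : E} (hu : u x = v x) (hG : G x = K x) :
    conv u G x = conv v K x := by
  simp [conv, hu, hG]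

/-- A field `a` that transports elements of `H¹₀(Ω)` by a bounded form, and is weakly divergence
free, acts by a skew-symmetric operator. -/
theorem integral_inner_conv_self_eq_zero {Ω : Set E} {a : E → E} {A : ℝ}
    (hint : ∀ q : X Ω, ∀ r ∈ H10 Ω, IntegrableOn (fun x => ⟪conv a q.snd x, r.fst x⟫) Ω)
    (hA : ∀ q : X Ω, ∀ r ∈ H10 Ω, |∫ x in Ω, ⟪conv a q.snd x, r.fst x⟫| ≤ A * ‖q‖ * ‖r‖)
    (hdiv : ∀ ψ : E → ℝ, ContDiff ℝ ∞ ψ → HasCompactSupport ψ → tsupport ψ ⊆ Ω →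
      ∫ x in Ω, fderiv ℝ ψ x (a x) = 0)
    {q : X Ω} (hq : q ∈ H10 Ω) : ∫ x in Ω, ⟪conv a q.snd x, q.fst x⟫ = 0 := by
  have htest : ∀ p ∈ testFields Ω, ∫ x in Ω, ⟪conv a p.snd x, p.fst x⟫ = 0 := by
    rintro p ⟨φ, h1, h2, h3, h4, h5⟩
    -- For a test field, `2 ⟪a·∇φ, φ⟫` is the derivative of `‖φ‖²` along `a`, whose integral
    -- vanishes as `a` is weakly divergence free.
    have hψ := hdiv (fun x => ‖φ x‖ ^ 2) (h1.norm_sq ℝ)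
      (h2.comp_left (g := fun v => ‖v‖ ^ 2) (by simp))
      ((closure_mono fun x hx => by
        contrapose! hx
        simp only [Function.mem_support, not_not] at hx ⊢
        simp [hx]).trans h3)
    have e : ∫ x in Ω, fderiv ℝ (fun x => ‖φ x‖ ^ 2) x (a x) =
        2 * ∫ x in Ω, ⟪conv a p.snd x, p.fst x⟫ := by
      rw [← integral_const_mul]
      refine integral_congr_ae ?_
      filter_upwards [h4, h5] with x h h'
      rw [conv_congr rfl h', conv_grad, h,
        ((h1.differentiable (by simp) x).hasFDerivAt.norm_sq).fderiv, real_inner_comm]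
      simp
    rw [e] at hψ
    linarith
  obtain ⟨p, hp, hlim⟩ := exists_seq_testFields hq
  have hsub : ∀ q r : X Ω, ∀ᵐ x ∂volume.restrict Ω,
      conv a (q - r).snd x = conv a q.snd x - conv a r.snd x := by
    intro q r
    filter_upwards [Lp.coeFn_sub q.snd r.snd] with x hx
    rw [← WithLp.sub_snd] at hx
    ext j
    simp only [conv, hx, Pi.sub_apply, PiLp.sub_apply, mul_sub, Finset.sum_sub_distrib]
  -- The form is expanded around a test field `p n`, on which it vanishes. Each of the two remaining
  -- terms contains one factor `q - p n`.
  have hbound : ∀ n, |∫ x in Ω, ⟪conv a q.snd x, q.fst x⟫| ≤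
      A * ‖q - p n‖ * ‖q‖ + A * ‖p n‖ * ‖q - p n‖ := by
    intro n
    have hpn := testFields_subset_H10 Ω (hp n)
    have hi : IntegrableOn (fun x => ⟪conv a (q - p n).snd x, q.fst x⟫ +
        ⟪conv a (p n).snd x, (q - p n).fst x⟫) Ω :=
      (hint _ _ hq).add (hint _ _ ((H10 Ω).sub_mem hq hpn))
    have e : ∫ x in Ω, ⟪conv a q.snd x, q.fst x⟫ =
        (∫ x in Ω, ⟪conv a (q - p n).snd x, q.fst x⟫) +
          (∫ x in Ω, ⟪conv a (p n).snd x, (q - p n).fst x⟫) +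
          ∫ x in Ω, ⟪conv a (p n).snd x, (p n).fst x⟫ := by
      rw [← integral_add (hint _ _ hq) (hint _ _ ((H10 Ω).sub_mem hq hpn)),
        ← integral_add hi (hint _ _ hpn)]
      refine integral_congr_ae ?_
      filter_upwards [hsub q (p n), Lp.coeFn_sub q.fst (p n).fst] with x h h'
      rw [h, WithLp.sub_fst, h', Pi.sub_apply, inner_sub_left, inner_sub_right]
      ring
    rw [e, htest _ (hp n), add_zero]
    exact (abs_add_le _ _).trans (add_le_add (hA _ _ hq) (hA _ _ ((H10 Ω).sub_mem hq hpn)))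
  have h0 : Tendsto (fun n => ‖q - p n‖) atTop (𝓝 0) := by
    have := (hlim.const_sub q).norm
    simpa using this
  have hl : Tendsto (fun n => A * ‖q - p n‖ * ‖q‖ + A * ‖p n‖ * ‖q - p n‖) atTop (𝓝 0) := by
    have := ((h0.const_mul A).mul_const ‖q‖).add ((hlim.norm.const_mul A).mul h0)
    simpa using this
  exact abs_nonpos_iff.1 (ge_of_tendsto' hl hbound)

theorem memLp_four_of_mem_H10 {Ω : Set E} (hΩ : MeasurableSet Ω) {p : X Ω} (hp : p ∈ H10 Ω) :
    MemLp p.fst 4 (volume.restrict Ω) := by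
  obtain ⟨C, hC⟩ := exists_eLpNorm_four_le
  exact ⟨Lp.aestronglyMeasurable _, (hC Ω hΩ p hp).trans_lt
    (ENNReal.mul_lt_top ENNReal.coe_lt_top ENNReal.ofReal_lt_top)⟩

theorem toReal_eLpNorm_snd_le {Ω : Set E} (q : X Ω) :
    (eLpNorm q.snd 2 (volume.restrict Ω)).toReal ≤ ‖q‖ := by
  rw [← Lp.norm_def]
  exact norm_snd_le q

theorem toReal_eLpNorm_fst_le {Ω : Set E} (q : X Ω) :
    (eLpNorm q.fst 2 (volume.restrict Ω)).toReal ≤ ‖q‖ := by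
  rw [← Lp.norm_def]
  exact norm_fst_le q

/-- Ladyzhenskaya's inequality bounds the form by the `L⁴`, `L⁴` and `L²` norms of its arguments, so
skew-symmetry extends from test fields to `H¹₀`. The transporting field is weakly divergence free
because it lies in `V`. -/
theorem integral_conv_self_of_mem_V {Ω : Set E} (hΩ : MeasurableSet Ω) {p : X Ω} (hp : p ∈ V Ω) :
    ∫ x in Ω, ⟪conv p.fst p.snd x, p.fst x⟫ = 0 := by
  obtain ⟨C, hC⟩ := exists_eLpNorm_four_le
  have hC' : ∀ r ∈ H10 Ω, (eLpNorm r.fst 4 (volume.restrict Ω)).toReal ≤ C * ‖r‖ := by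
    intro r hr
    have := ENNReal.toReal_mono
      (ENNReal.mul_lt_top ENNReal.coe_lt_top ENNReal.ofReal_lt_top).ne (hC Ω hΩ r hr)
    rwa [ENNReal.toReal_mul, ENNReal.coe_toReal, ENNReal.toReal_ofReal (norm_nonneg _)] at this
  refine integral_inner_conv_self_eq_zero (A := C * ‖p‖ * C)
    (fun q r hr => integrable_inner_conv 2 (memLp_four_of_mem_H10 hΩ hp.1)
      (memLp_four_of_mem_H10 hΩ hr) (Lp.memLp q.snd)) (fun q r hr => ?_)
    (fun ψ hψ hc _ => ?_) hp.1
  · refine (abs_integral_inner_conv_le 2 (memLp_four_of_mem_H10 hΩ hp.1)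
      (memLp_four_of_mem_H10 hΩ hr) (Lp.memLp q.snd)).trans ?_
    have h1 := hC' p hp.1
    have h2 := hC' r hr
    have h3 := toReal_eLpNorm_snd_le q
    calc _ ≤ (C * ‖p‖) * (C * ‖r‖) * ‖q‖ := by gcongr
      _ = _ := by ring
  · have hψ1 : ContDiff ℝ 1 ψ := hψ.of_le (by simp)
    exact integral_fderiv_apply_eq_zero hψ1
      ((hψ.continuous.memLp_of_hasCompactSupport hc).restrict Ω)
      (((hψ1.continuous_fderiv one_ne_zero).memLp_of_hasCompactSupport (hc.fderiv ℝ)).restrict Ω)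
      hp

/-- The convective term of `b + w`, tested with `w ∈ V(Ω)`, for a bounded background field `b`
with gradient `D`. -/
theorem integral_conv_background {Ω : Set E} (hΩ : MeasurableSet Ω) {b : E → E} {D : E → M}
    (hb : MemLp b ⊤ (volume.restrict Ω)) (hD : MemLp D ⊤ (volume.restrict Ω))
    (hD2 : MemLp D 2 (volume.restrict Ω))
    (hdiv : ∀ ψ : E → ℝ, ContDiff ℝ ∞ ψ → HasCompactSupport ψ → tsupport ψ ⊆ Ω →
      ∫ x in Ω, fderiv ℝ ψ x (b x) = 0)
    (hbD : ∀ v ∈ V Ω, ∫ x in Ω, ⟪conv b D x, v.fst x⟫ = 0) {w : X Ω} (hw : w ∈ V Ω) :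
    ∫ x in Ω, ⟪conv (fun y => b y + w.fst y) (fun y => D y + w.snd y) x, w.fst x⟫ =
      ∫ x in Ω, ⟪conv w.fst D x, w.fst x⟫ := by
  have hw4 := memLp_four_of_mem_H10 hΩ hw.1
  have i1 : IntegrableOn (fun x => ⟪conv b D x, w.fst x⟫) Ω :=
    integrable_inner_conv (a := ⊤) 2 hb (Lp.memLp w.fst) hD2
  have i2 : IntegrableOn (fun x => ⟪conv b w.snd x, w.fst x⟫) Ω :=
    integrable_inner_conv (a := ⊤) 2 hb (Lp.memLp w.fst) (Lp.memLp w.snd)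
  have i3 : IntegrableOn (fun x => ⟪conv w.fst D x, w.fst x⟫) Ω :=
    integrable_inner_conv (b := ⊤) 1 (Lp.memLp w.fst) (Lp.memLp w.fst) hD
  have i4 : IntegrableOn (fun x => ⟪conv w.fst w.snd x, w.fst x⟫) Ω :=
    integrable_inner_conv 2 hw4 hw4 (Lp.memLp w.snd)
  have h2 : ∫ x in Ω, ⟪conv b w.snd x, w.fst x⟫ = 0 := by
    refine integral_inner_conv_self_eq_zero (A := (eLpNorm b ⊤ (volume.restrict Ω)).toReal)
      (fun q r hr => integrable_inner_conv (a := ⊤) 2 hb (Lp.memLp r.fst) (Lp.memLp q.snd))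
      (fun q r hr => ?_) hdiv hw.1
    refine (abs_integral_inner_conv_le (a := ⊤) 2 hb (Lp.memLp r.fst) (Lp.memLp q.snd)).trans ?_
    have h1 := toReal_eLpNorm_fst_le r
    have h3 := toReal_eLpNorm_snd_le q
    calc _ ≤ (eLpNorm b ⊤ (volume.restrict Ω)).toReal * ‖r‖ * ‖q‖ := by gcongr
      _ = _ := by ring
  have e : ∀ x, ⟪conv (fun y => b y + w.fst y) (fun y => D y + w.snd y) x, w.fst x⟫ =
      ⟪conv b D x, w.fst x⟫ + ⟪conv b w.snd x, w.fst x⟫ +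
        (⟪conv w.fst D x, w.fst x⟫ + ⟪conv w.fst w.snd x, w.fst x⟫) := by
    intro x
    rw [conv_add_left, conv_add_right, conv_add_right, inner_add_left, inner_add_left,
      inner_add_left]
  have i12 : IntegrableOn (fun x => ⟪conv b D x, w.fst x⟫ + ⟪conv b w.snd x, w.fst x⟫) Ω :=
    i1.add i2
  have i34 : IntegrableOn (fun x => ⟪conv w.fst D x, w.fst x⟫ + ⟪conv w.fst w.snd x, w.fst x⟫) Ω :=
    i3.add i4
  simp only [e]
  rw [integral_add i12 i34, integral_add i1 i2, integral_add i3 i4, hbD w hw, h2,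
    integral_conv_self_of_mem_V hΩ hw]
  ring

/-! ### Mollification -/

theorem eLpNorm_two_sq {α F : Type*} [MeasurableSpace α] {μ : Measure α} [NormedAddCommGroup F]
    (f : α → F) : eLpNorm f 2 μ ^ 2 = ∫⁻ x, ‖f x‖ₑ ^ 2 ∂μ := by
  have := eLpNorm_nnreal_pow_eq_lintegral (μ := μ) (f := f) (p := 2) two_ne_zero
  simpa using this

/-- This is the Cauchy-Schwarz inequality for the measure with density `k`, in the form needed for
Young's convolution inequality. -/
theorem sq_lintegral_mul_le {α : Type*} [MeasurableSpace α] {μ : Measure α} {k h : α → ℝ≥0∞}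
    (hk : AEMeasurable k μ) (hh : AEMeasurable h μ) :
    (∫⁻ x, k x * h x ∂μ) ^ 2 ≤ (∫⁻ x, k x ∂μ) * ∫⁻ x, k x * h x ^ 2 ∂μ := by
  have h1 := ENNReal.lintegral_mul_norm_pow_le (μ := μ) (f := k) (g := fun x => k x * h x ^ 2)
    hk (hk.mul (hh.pow_const 2)) (p := 1 / 2) (q := 1 / 2) (by norm_num) (by norm_num)
    (by norm_num)
  have h2 : ∀ x, k x ^ (1 / 2 : ℝ) * (k x * h x ^ 2) ^ (1 / 2 : ℝ) = k x * h x := by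
    intro x
    rw [ENNReal.mul_rpow_of_nonneg _ _ (by norm_num), ← mul_assoc,
      ← ENNReal.rpow_add_of_nonneg _ _ (by norm_num) (by norm_num), ← ENNReal.rpow_natCast,
      ← ENNReal.rpow_mul]
    norm_num
  simp only [h2] at h1
  refine (pow_le_pow_left' h1 2).trans (le_of_eq ?_)
  rw [← ENNReal.mul_rpow_of_nonneg _ _ (by norm_num), ← ENNReal.rpow_natCast, ← ENNReal.rpow_mul]
  norm_num

/-- Young's convolution inequality, `L¹ * L² ⊆ L²`. -/
theorem eLpNorm_two_le_of_le_convolution {F F' : Type*} [NormedAddCommGroup F]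
    [NormedAddCommGroup F'] {k : E → ℝ≥0∞} (hk : AEMeasurable k volume) {h : E → F}
    (hh : AEStronglyMeasurable h volume) {f : E → F'}
    (hf : ∀ x, ‖f x‖ₑ ≤ ∫⁻ t, k t * ‖h (x - t)‖ₑ) :
    eLpNorm f 2 volume ≤ (∫⁻ t, k t) * eLpNorm h 2 volume := by
  refine (ENNReal.pow_le_pow_left_iff two_ne_zero).1 ?_
  rw [mul_pow, eLpNorm_two_sq, eLpNorm_two_sq]
  have hprod : AEMeasurable (fun q : E × E => k q.2 * ‖h (q.1 - q.2)‖ₑ ^ 2)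
      ((volume : Measure E).prod volume) :=
    (hk.comp_quasiMeasurePreserving Measure.quasiMeasurePreserving_snd).mul
      ((hh.enorm.comp_quasiMeasurePreserving
        (quasiMeasurePreserving_sub_of_right_invariant volume volume)).pow_const 2)
  have hsub : ∀ x, AEMeasurable (fun t => ‖h (x - t)‖ₑ) volume := fun x =>
    hh.enorm.comp_quasiMeasurePreserving (Measure.measurePreserving_sub_left volume x).quasiMeasurePreserving
  calc ∫⁻ x, ‖f x‖ₑ ^ 2 ≤ ∫⁻ x, (∫⁻ t, k t) * ∫⁻ t, k t * ‖h (x - t)‖ₑ ^ 2 :=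
        lintegral_mono fun x => (pow_le_pow_left' (hf x) 2).trans (sq_lintegral_mul_le hk (hsub x))
    _ = (∫⁻ t, k t) * ∫⁻ x, ∫⁻ t, k t * ‖h (x - t)‖ₑ ^ 2 := by
        rw [lintegral_const_mul'' _ hprod.lintegral_prod_right']
    _ = (∫⁻ t, k t) * ∫⁻ t, ∫⁻ x, k t * ‖h (x - t)‖ₑ ^ 2 := by
        rw [lintegral_lintegral_swap hprod]
    _ = (∫⁻ t, k t) * ∫⁻ t, k t * ∫⁻ x, ‖h x‖ₑ ^ 2 := by
        congr 1
        refine lintegral_congr fun t => ?_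
        have h1 : AEMeasurable (fun x => ‖h (x - t)‖ₑ ^ 2) volume :=
          (hh.enorm.comp_quasiMeasurePreserving
            (measurePreserving_sub_right volume t).quasiMeasurePreserving).pow_const 2
        rw [lintegral_const_mul'' _ h1, lintegral_sub_right_eq_self (fun x => ‖h x‖ₑ ^ 2) t]
    _ = (∫⁻ t, k t) ^ 2 * ∫⁻ x, ‖h x‖ₑ ^ 2 := by
        rw [lintegral_mul_const'' _ hk, sq, mul_assoc]

section Mollify

variable {F : Type*} [NormedAddCommGroup F]

theorem aestronglyMeasurable_comp_smul {l : ℝ} (hl : 0 < l) {h : E → F}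
    (hh : AEStronglyMeasurable h volume) :
    AEStronglyMeasurable (fun x => h (l • x)) volume := by
  refine hh.comp_quasiMeasurePreserving ⟨measurable_const_smul l, ?_⟩
  rw [Measure.map_addHaar_smul volume hl.ne']
  exact Measure.smul_absolutelyContinuous

/-- The Jacobian factor of the dilation is at most one. Dilations with `l ≥ 1` contract supports
towards the origin, leaving room to mollify inside a disk. -/
theorem eLpNorm_comp_smul_le {l : ℝ} (hl : 1 ≤ l) {h : E → F}
    (hh : AEStronglyMeasurable h volume) :
    eLpNorm (fun x => h (l • x)) 2 volume ≤ eLpNorm h 2 volume := by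
  have hl0 : 0 < l := zero_lt_one.trans_le hl
  have hmap := Measure.map_addHaar_smul (volume : Measure E) hl0.ne'
  have h1 : AEStronglyMeasurable h (Measure.map (fun x : E => l • x) volume) := by
    rw [hmap]
    exact hh.mono_ac Measure.smul_absolutelyContinuous
  have h2 := eLpNorm_map_measure (p := 2) h1 (measurable_const_smul l).aemeasurable
  rw [show (fun x => h (l • x)) = h ∘ fun x => l • x from rfl, ← h2, hmap]
  refine eLpNorm_mono_measure h ?_
  refine Measure.le_iff.2 fun s _ => ?_
  rw [Measure.smul_apply, smul_eq_mul]
  refine mul_le_of_le_one_left zero_le ?_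
  rw [ENNReal.ofReal_le_one, abs_of_pos (by positivity)]
  exact inv_le_one_of_one_le₀ (one_le_pow₀ hl)

theorem memLp_comp_smul {l : ℝ} (hl : 1 ≤ l) {h : E → F} (hh : MemLp h 2 volume) :
    MemLp (fun x => h (l • x)) 2 volume :=
  ⟨aestronglyMeasurable_comp_smul (zero_lt_one.trans_le hl) hh.1,
    (eLpNorm_comp_smul_le hl hh.1).trans_lt hh.2⟩

variable [NormedSpace ℝ F]

/-- The mollification of `h (l • ·)` by the bump function `φ`. -/
def mollify (φ : ContDiffBump (0 : E)) (l : ℝ) (h : E → F) : E → F :=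
  φ.normed volume ⋆[ContinuousLinearMap.lsmul ℝ ℝ, volume] fun x => h (l • x)

theorem mollify_apply (φ : ContDiffBump (0 : E)) (l : ℝ) (h : E → F) (x : E) :
    mollify φ l h x = ∫ t, φ.normed volume t • h (l • (x - t)) := rfl

theorem lintegral_normed (φ : ContDiffBump (0 : E)) :
    ∫⁻ t, ‖φ.normed volume t‖ₑ = 1 := by
  have h1 : Integrable (φ.normed (volume : Measure E)) :=
    φ.continuous_normed.integrable_of_hasCompactSupport φ.hasCompactSupport_normed
  rw [← ofReal_integral_norm_eq_lintegral_enorm h1,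
    integral_congr_ae (g := φ.normed volume) (Eventually.of_forall fun x =>
      Real.norm_of_nonneg (φ.nonneg_normed x)), φ.integral_normed, ENNReal.ofReal_one]

theorem eLpNorm_mollify_le (φ : ContDiffBump (0 : E)) {l : ℝ} (hl : 1 ≤ l) {h : E → F}
    (hh : AEStronglyMeasurable h volume) :
    eLpNorm (mollify φ l h) 2 volume ≤ eLpNorm h 2 volume := by
  have h1 := eLpNorm_two_le_of_le_convolution (f := mollify φ l h)
    (k := fun t => ‖φ.normed volume t‖ₑ) φ.continuous_normed.enorm.measurable.aemeasurable
    (aestronglyMeasurable_comp_smul (zero_lt_one.trans_le hl) hh) (fun x => by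
      rw [mollify_apply]
      refine (enorm_integral_le_lintegral_enorm _).trans (lintegral_mono fun t => ?_)
      rw [enorm_smul])
  rw [lintegral_normed, one_mul] at h1
  exact h1.trans (eLpNorm_comp_smul_le hl hh)

theorem mollify_sub (φ : ContDiffBump (0 : E)) {l : ℝ} (hl : 1 ≤ l) {h g : E → F}
    (hh : MemLp h 2 volume) (hg : MemLp g 2 volume) :
    mollify φ l (h - g) = mollify φ l h - mollify φ l g := by
  ext x
  have h1 : ∀ {f : E → F}, MemLp f 2 volume →
      Integrable fun t => φ.normed volume t • f (l • (x - t)) := fun hf =>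
    φ.hasCompactSupport_normed.convolutionExists_left (ContinuousLinearMap.lsmul ℝ ℝ)
      φ.continuous_normed ((memLp_comp_smul hl hf).locallyIntegrable one_le_two) x
  rw [Pi.sub_apply, mollify_apply, mollify_apply, mollify_apply, ← integral_sub (h1 hh) (h1 hg)]
  simp only [Pi.sub_apply, smul_sub]

theorem contDiff_mollify (φ : ContDiffBump (0 : E)) {l : ℝ} (hl : 1 ≤ l) {h : E → F}
    (hh : MemLp h 2 volume) : ContDiff ℝ ∞ (mollify φ l h) :=
  φ.hasCompactSupport_normed.contDiff_convolution_left _ φ.contDiff_normed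
    ((memLp_comp_smul hl hh).locallyIntegrable one_le_two)

variable [CompleteSpace F]

/-- The convergence is uniform by uniform continuity, and for large `n` all differences vanish
outside one fixed ball of finite measure. -/
theorem tendsto_mollify_of_continuous {φ : ℕ → ContDiffBump (0 : E)} {l : ℕ → ℝ}
    (hφ : Tendsto (fun n => (φ n).rOut) atTop (𝓝 0)) (hl : Tendsto l atTop (𝓝 1))
    (hl1 : ∀ n, 1 ≤ l n) {g : E → F} (hg : Continuous g) (hc : HasCompactSupport g) :
    Tendsto (fun n => eLpNorm (mollify (φ n) (l n) g - g) 2 volume) atTop (𝓝 0) := by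
  obtain ⟨K, hK⟩ := hc.isCompact.isBounded.subset_ball (0 : E)
  have hg0 : ∀ x : E, K ≤ ‖x‖ → g x = 0 := fun x hx => by
    by_contra h
    have := hK (subset_tsupport g h)
    rw [mem_ball_zero_iff] at this
    linarith
  have huc := hc.uniformContinuous_of_continuous hg
  have hfin : volume (Metric.ball (0 : E) (|K| + 1)) ≠ ⊤ := measure_ball_lt_top.ne
  rw [ENNReal.tendsto_atTop_zero]
  intro ε hε
  obtain ⟨η, hη0, hη⟩ : ∃ η : ℝ, 0 < η ∧
      ENNReal.ofReal η * volume (Metric.ball (0 : E) (|K| + 1)) ^ (1 / (2 : ℝ)) ≤ ε := by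
    have ht : Tendsto (fun η : ℝ => ENNReal.ofReal η *
        volume (Metric.ball (0 : E) (|K| + 1)) ^ (1 / (2 : ℝ))) (𝓝[>] 0) (𝓝 0) := by
      have h1 : Tendsto (fun η : ℝ => ENNReal.ofReal η) (𝓝[>] 0) (𝓝 0) := by
        have := (ENNReal.continuous_ofReal.tendsto 0).mono_left
          (nhdsWithin_le_nhds (s := Ioi (0 : ℝ)))
        simpa using this
      have := ENNReal.Tendsto.mul_const
        (b := volume (Metric.ball (0 : E) (|K| + 1)) ^ (1 / (2 : ℝ))) h1
        (Or.inr (ENNReal.rpow_ne_top_of_nonneg (by norm_num) hfin))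
      simpa using this
    obtain ⟨η, h1, h2⟩ := ((ht.eventually_le_const hε).and self_mem_nhdsWithin).exists
    exact ⟨η, h2, h1⟩
  obtain ⟨δ, hδ0, hδ⟩ := Metric.uniformContinuous_iff.1 huc η hη0
  -- This quantity bounds `‖l y - x‖` through `l y - x = l (y - x) + (l - 1) x`, for `x` in the ball
  -- and `y` within the mollification radius of `x`.
  have hev : ∀ᶠ n in atTop, l n * (φ n).rOut + (l n - 1) * (|K| + 1) < δ := by
    have : Tendsto (fun n => l n * (φ n).rOut + (l n - 1) * (|K| + 1)) atTop (𝓝 0) := by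
      have := (hl.mul hφ).add ((hl.sub_const 1).mul_const (|K| + 1))
      simpa using this
    exact this.eventually_lt_const hδ0
  obtain ⟨N, hN⟩ := eventually_atTop.1 (hev.and (hφ.eventually_lt_const zero_lt_one))
  refine ⟨N, fun n hn => ?_⟩
  obtain ⟨h1, h2⟩ := hN n hn
  have hln := hl1 n
  have hclose : ∀ x, dist (mollify (φ n) (l n) g x) (g x) ≤ η := by
    intro x
    refine dist_convolution_le hη0.le (φ n).support_normed_eq.subset (φ n).nonneg_normed
      (φ n).integral_normed
      (hg.comp (continuous_const_smul (l n))).aestronglyMeasurable fun y hy => ?_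
    rw [mem_ball_iff_norm] at hy
    have hr := (φ n).rOut_pos
    rcases lt_or_ge ‖x‖ (|K| + 1) with hx | hx
    · refine (hδ ?_).le
      rw [dist_eq_norm]
      have e : l n • y - x = l n • (y - x) + (l n - 1) • x := by
        rw [smul_sub, sub_smul, one_smul]
        abel
      rw [e]
      refine (norm_add_le _ _).trans_lt (lt_of_le_of_lt ?_ h1)
      rw [norm_smul, norm_smul, Real.norm_of_nonneg (by linarith),
        Real.norm_of_nonneg (by linarith)]
      have : 0 ≤ l n - 1 := by linarith
      gcongr
    · have hy1 : |K| ≤ ‖y‖ := by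
        have := norm_sub_norm_le x y
        rw [norm_sub_rev] at this
        linarith
      rw [hg0 x ((le_abs_self K).trans (by linarith)), hg0 (l n • y), dist_self]
      · exact hη0.le
      · rw [norm_smul, Real.norm_of_nonneg (by linarith)]
        nlinarith [le_abs_self K, abs_nonneg K, norm_nonneg y]
  have hzero : ∀ x ∉ Metric.ball (0 : E) (|K| + 1), mollify (φ n) (l n) g x - g x = 0 := by
    intro x hx
    rw [mem_ball_zero_iff, not_lt] at hx
    rw [hg0 x ((le_abs_self K).trans (by linarith)), sub_zero, mollify_apply]
    refine integral_eq_zero_of_ae (Eventually.of_forall fun t => ?_)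
    beta_reduce
    by_cases ht : ‖t‖ < (φ n).rOut
    · have h3 : |K| ≤ ‖x - t‖ := by linarith [norm_sub_norm_le x t]
      rw [hg0 (l n • (x - t)), smul_zero, Pi.zero_apply]
      rw [norm_smul, Real.norm_of_nonneg (by linarith)]
      nlinarith [le_abs_self K, abs_nonneg K, norm_nonneg (x - t)]
    · have : t ∉ Function.support ((φ n).normed volume) := by
        rw [(φ n).support_normed_eq, mem_ball_zero_iff]
        exact ht
      rw [Function.notMem_support.1 this, zero_smul, Pi.zero_apply]
  refine le_trans ?_ hη
  have h4 : mollify (φ n) (l n) g - g =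
      indicator (Metric.ball (0 : E) (|K| + 1)) (mollify (φ n) (l n) g - g) := by
    symm
    rw [indicator_eq_self]
    intro x hx
    by_contra h
    exact hx (hzero x h)
  rw [h4, eLpNorm_indicator_eq_eLpNorm_restrict measurableSet_ball]
  have h5 := eLpNorm_le_of_ae_bound (p := 2)
    (μ := volume.restrict (Metric.ball (0 : E) (|K| + 1))) (C := η)
    (f := mollify (φ n) (l n) g - g) (Eventually.of_forall fun x => by
      rw [Pi.sub_apply, ← dist_eq_norm]
      exact hclose x)
  refine h5.trans (le_of_eq ?_)
  rw [Measure.restrict_apply_univ, mul_comm]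
  norm_num

theorem tendsto_mollify {φ : ℕ → ContDiffBump (0 : E)} {l : ℕ → ℝ}
    (hφ : Tendsto (fun n => (φ n).rOut) atTop (𝓝 0)) (hl : Tendsto l atTop (𝓝 1))
    (hl1 : ∀ n, 1 ≤ l n) {h : E → F} (hh : MemLp h 2 volume) :
    Tendsto (fun n => eLpNorm (mollify (φ n) (l n) h - h) 2 volume) atTop (𝓝 0) := by
  rw [ENNReal.tendsto_atTop_zero]
  intro ε hε
  have hε3 : ε / 3 ≠ 0 := (ENNReal.div_pos hε.ne' (by norm_num)).ne'
  obtain ⟨g, hgc, hgh, hg, hg2⟩ := hh.exists_hasCompactSupport_eLpNorm_sub_le (by norm_num) hε3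
  obtain ⟨N, hN⟩ := ENNReal.tendsto_atTop_zero.1 (tendsto_mollify_of_continuous hφ hl hl1 hg hgc)
    (ε / 3) (pos_iff_ne_zero.2 hε3)
  refine ⟨N, fun n hn => ?_⟩
  have e : mollify (φ n) (l n) h - h =
      (mollify (φ n) (l n) (h - g) + (mollify (φ n) (l n) g - g)) - (h - g) := by
    rw [mollify_sub _ (hl1 n) hh hg2]
    abel
  have hm : ∀ {f : E → F}, MemLp f 2 volume → AEStronglyMeasurable (mollify (φ n) (l n) f) volume :=
    fun hf => (φ n).hasCompactSupport_normed.continuous_convolution_left _ (φ n).continuous_normed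
      ((memLp_comp_smul (hl1 n) hf).locallyIntegrable one_le_two) |>.aestronglyMeasurable
  have hm1 := hm (hh.sub hg2)
  have hm2 := (hm hg2).sub hg2.1
  rw [e]
  calc _ ≤ eLpNorm (mollify (φ n) (l n) (h - g) + (mollify (φ n) (l n) g - g)) 2 volume +
        eLpNorm (h - g) 2 volume := eLpNorm_sub_le (hm1.add hm2) (hh.1.sub hg2.1) one_le_two
    _ ≤ (eLpNorm (mollify (φ n) (l n) (h - g)) 2 volume +
        eLpNorm (mollify (φ n) (l n) g - g) 2 volume) + eLpNorm (h - g) 2 volume := by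
        gcongr
        exact eLpNorm_add_le hm1 hm2 one_le_two
    _ ≤ (ε / 3 + ε / 3) + ε / 3 := by
        gcongr
        · exact (eLpNorm_mollify_le _ (hl1 n) (hh.1.sub hg2.1)).trans hgh
        · exact hN n hn
    _ = ε := ENNReal.add_thirds ε

end Mollify

/-! ### The gradient as a linear function of the derivative -/

/-- The matrix `(i, j) ↦ (A eᵢ)ʲ` of a linear map. -/
def gradL : (E →L[ℝ] E) →L[ℝ] M :=
  LinearMap.toContinuousLinearMap
    { toFun := fun A => WithLp.toLp 2 fun p => A (EuclideanSpace.single p.1 1) p.2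
      map_add' := fun A B => by ext p; simp
      map_smul' := fun c A => by ext p; simp }

theorem gradL_apply (A : E →L[ℝ] E) (i j : Fin 2) :
    gradL A (i, j) = A (EuclideanSpace.single i 1) j := rfl

theorem gradL_fderiv (u : E → E) (x : E) : gradL (fderiv ℝ u x) = grad u x := rfl

theorem norm_gradL_le (A : E →L[ℝ] E) : ‖gradL A‖ ≤ 2 * ‖A‖ := by
  refine le_of_sq_le_sq ?_ (by positivity)
  have h : ∀ i j, gradL A (i, j) ^ 2 ≤ ‖A‖ ^ 2 := fun i j => by
    rw [gradL_apply, ← sq_abs]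
    refine pow_le_pow_left₀ (abs_nonneg _) ?_ 2
    refine (PiLp.norm_apply_le (A (EuclideanSpace.single i 1)) j).trans ?_
    simpa using A.le_opNorm (EuclideanSpace.single i 1)
  rw [norm_sq_M]
  linarith [h 0 0, h 0 1, h 1 0, h 1 1]

theorem traceL_gradL_smulRight (c : E →L[ℝ] ℝ) (v : E) : traceL (gradL (c.smulRight v)) = c v := by
  rw [traceL_apply, gradL_apply, gradL_apply]
  conv_rhs => rw [eq_sum_single v]
  simp [Fin.sum_univ_two, mul_comm]

/-! ### Elements of `H¹(Ω)` given by classical fields -/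

/-- The element `(u, ∇u)` of `H¹(Ω)`. -/
def fieldX (Ω : Set E) (u : E → E) (hu : MemLp u 2 (volume.restrict Ω))
    (hg : MemLp (grad u) 2 (volume.restrict Ω)) : X Ω :=
  WithLp.toLp 2 (hu.toLp u, hg.toLp (grad u))

section

variable {Ω : Set E} {u : E → E} (hu : MemLp u 2 (volume.restrict Ω))
  (hg : MemLp (grad u) 2 (volume.restrict Ω))

theorem coeFn_fieldX_fst : (fieldX Ω u hu hg).fst =ᵐ[volume.restrict Ω] u := hu.coeFn_toLp

theorem coeFn_fieldX_snd : (fieldX Ω u hu hg).snd =ᵐ[volume.restrict Ω] grad u := hg.coeFn_toLp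

theorem fieldX_mem_testFields (h1 : ContDiff ℝ ∞ u) (h2 : HasCompactSupport u)
    (h3 : tsupport u ⊆ Ω) : fieldX Ω u hu hg ∈ testFields Ω :=
  ⟨u, h1, h2, h3, coeFn_fieldX_fst hu hg, coeFn_fieldX_snd hu hg⟩

theorem mem_V_of_traceL {p : X Ω} (hp : p ∈ H10 Ω)
    (h : ∀ᵐ x ∂volume.restrict Ω, traceL (p.snd x) = 0) : p ∈ V Ω := by
  refine ⟨hp, ?_⟩
  change traceL.compLpL 2 (volume.restrict Ω) p.snd = 0
  rw [Lp.eq_zero_iff_ae_eq_zero]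
  filter_upwards [traceL.coeFn_compLpL (p := 2) p.snd, h] with x h1 h2
  rw [h1, h2, Pi.zero_apply]

theorem fieldX_mem_V (h : fieldX Ω u hu hg ∈ H10 Ω) (ht : ∀ x ∈ Ω, traceL (grad u x) = 0)
    (hΩ : MeasurableSet Ω) : fieldX Ω u hu hg ∈ V Ω := by
  refine mem_V_of_traceL h ?_
  filter_upwards [coeFn_fieldX_snd hu hg, ae_restrict_mem hΩ] with x h1 h2
  rw [h1, ht x h2]

theorem tendsto_fieldX {v : ℕ → E → E} (hv : ∀ n, MemLp (v n) 2 (volume.restrict Ω))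
    (hvg : ∀ n, MemLp (grad (v n)) 2 (volume.restrict Ω))
    (h1 : Tendsto (fun n => eLpNorm (v n - u) 2 (volume.restrict Ω)) atTop (𝓝 0))
    (h2 : Tendsto (fun n => eLpNorm (grad (v n) - grad u) 2 (volume.restrict Ω)) atTop (𝓝 0)) :
    Tendsto (fun n => fieldX Ω (v n) (hv n) (hvg n)) atTop (𝓝 (fieldX Ω u hu hg)) :=
  ((WithLp.prod_continuous_toLp 2 _ _).tendsto _).comp
    (((Lp.tendsto_Lp_iff_tendsto_eLpNorm'' v hv u hu).2 h1).prodMk_nhds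
      ((Lp.tendsto_Lp_iff_tendsto_eLpNorm'' _ hvg _ hg).2 h2))

end

theorem tendsto_eLpNorm_two_of_dominated {α F : Type*} [MeasurableSpace α] {μ : Measure α}
    [NormedAddCommGroup F] {f : ℕ → α → F} (hf : ∀ n, AEStronglyMeasurable (f n) μ) {g : α → ℝ}
    (hg : MemLp g 2 μ) (hfg : ∀ n, ∀ᵐ x ∂μ, ‖f n x‖ ≤ g x)
    (hlim : ∀ᵐ x ∂μ, Tendsto (fun n => f n x) atTop (𝓝 0)) :
    Tendsto (fun n => eLpNorm (f n) 2 μ) atTop (𝓝 0) := by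
  have h1 : Tendsto (fun n => ∫⁻ x, ‖f n x‖ₑ ^ 2 ∂μ) atTop (𝓝 (∫⁻ _, 0 ∂μ)) := by
    refine tendsto_lintegral_of_dominated_convergence' (fun x => ‖g x‖ₑ ^ 2)
      (fun n => (hf n).enorm.pow_const 2) (fun n => ?_) ?_ ?_
    · filter_upwards [hfg n] with x hx
      have : ‖f n x‖ₑ ≤ ‖g x‖ₑ := enorm_le_iff_norm_le.2 (hx.trans (le_abs_self _))
      gcongr
    · rw [← eLpNorm_two_sq]
      exact (ENNReal.pow_lt_top hg.2).ne
    · filter_upwards [hlim] with x hx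
      have h2 := ((continuous_enorm.tendsto (0 : F)).comp hx)
      rw [enorm_zero] at h2
      have h3 := ((ENNReal.continuous_pow 2).tendsto 0).comp h2
      simpa [Function.comp_def] using h3
  simp only [lintegral_zero, ← eLpNorm_two_sq] at h1
  have h2 := ((ENNReal.continuous_rpow_const (y := (2⁻¹ : ℝ))).tendsto 0).comp h1
  have h3 : ∀ a : ℝ≥0∞, (a ^ 2) ^ (2⁻¹ : ℝ) = a := fun a => by
    rw [← ENNReal.rpow_natCast, ← ENNReal.rpow_mul]
    norm_num
  simpa [Function.comp_def, h3] using h2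

/-! ### Gradients of mollifications -/

theorem hasFDerivAt_mollify (φ : ContDiffBump (0 : E)) {l : ℝ} (hl : 1 ≤ l) {h : E → E}
    (hh : MemLp h 2 volume) (x : E) :
    Integrable (fun t => (fderiv ℝ (φ.normed volume) t).smulRight (h (l • (x - t)))) ∧
    HasFDerivAt (mollify φ l h)
      (∫ t, (fderiv ℝ (φ.normed volume) t).smulRight (h (l • (x - t)))) x := by
  have hloc := (memLp_comp_smul hl hh).locallyIntegrable one_le_two
  have hρ : ContDiff ℝ 1 (φ.normed (volume : Measure E)) := φ.contDiff_normed (n := 1)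
  have e : ∀ t, ((ContinuousLinearMap.lsmul ℝ ℝ : ℝ →L[ℝ] E →L[ℝ] E).precompL E)
      (fderiv ℝ (φ.normed volume) t) (h (l • (x - t))) =
      (fderiv ℝ (φ.normed volume) t).smulRight (h (l • (x - t))) := by
    intro t
    ext v : 1
    rw [ContinuousLinearMap.precompL_apply]
    rfl
  have h1 := (φ.hasCompactSupport_normed (μ := volume)).hasFDerivAt_convolution_left
    (ContinuousLinearMap.lsmul ℝ ℝ) hρ hloc x
  have h2 := ((φ.hasCompactSupport_normed (μ := volume)).fderiv ℝ).convolutionExists_left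
    ((ContinuousLinearMap.lsmul ℝ ℝ : ℝ →L[ℝ] E →L[ℝ] E).precompL E)
    (hρ.continuous_fderiv one_ne_zero) hloc x
  rw [convolution_def] at h1
  simp only [e] at h1
  exact ⟨h2.congr (Eventually.of_forall e), h1⟩

/-- The derivative falls on the smooth kernel, so `h` itself needs only to be square integrable. The
kernel's derivative is integrable, and Young's inequality applies. -/
theorem memLp_grad_mollify (φ : ContDiffBump (0 : E)) {l : ℝ} (hl : 1 ≤ l) {h : E → E}
    (hh : MemLp h 2 volume) : MemLp (grad (mollify φ l h)) 2 volume := by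
  have hρ : ContDiff ℝ 1 (φ.normed (volume : Measure E)) := φ.contDiff_normed (n := 1)
  have hint : Integrable (fderiv ℝ (φ.normed (volume : Measure E))) :=
    (hρ.continuous_fderiv one_ne_zero).integrable_of_hasCompactSupport
      (φ.hasCompactSupport_normed.fderiv ℝ)
  have h1 : eLpNorm (fderiv ℝ (mollify φ l h)) 2 volume ≤
      (∫⁻ t, ‖fderiv ℝ (φ.normed volume) t‖ₑ) * eLpNorm (fun x => h (l • x)) 2 volume := by
    refine eLpNorm_two_le_of_le_convolution hint.aestronglyMeasurable.enorm
      (memLp_comp_smul hl hh).1 fun x => ?_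
    rw [(hasFDerivAt_mollify φ hl hh x).2.fderiv]
    refine (enorm_integral_le_lintegral_enorm _).trans (lintegral_mono fun t => ?_)
    rw [← ofReal_norm, ← ofReal_norm, ← ofReal_norm,
      ← ENNReal.ofReal_mul (norm_nonneg _), ContinuousLinearMap.norm_smulRight_apply]
  have h2 : MemLp (fderiv ℝ (mollify φ l h)) 2 volume :=
    ⟨((contDiff_mollify φ hl hh).continuous_fderiv (by simp)).aestronglyMeasurable,
      h1.trans_lt (ENNReal.mul_lt_top hint.2 (memLp_comp_smul hl hh).2)⟩
  exact h2.of_le_mul (measurable_grad _).aestronglyMeasurable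
    (Eventually.of_forall fun x => norm_gradL_le _)

/-- At a fixed `x`, the divergence of the mollification is, up to a factor, the pairing of `h` with
the gradient of the test function `s ↦ ρ (x - s / l)`. -/
theorem traceL_grad_mollify (φ : ContDiffBump (0 : E)) {l : ℝ} (hl : 1 ≤ l) {h : E → E}
    (hh : MemLp h 2 volume)
    (hdiv : ∀ ψ : E → ℝ, ContDiff ℝ ∞ ψ → HasCompactSupport ψ → ∫ x, fderiv ℝ ψ x (h x) = 0)
    (x : E) : traceL (grad (mollify φ l h) x) = 0 := by
  have hl0 : 0 < l := zero_lt_one.trans_le hl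
  obtain ⟨h1, h2⟩ := hasFDerivAt_mollify φ hl hh x
  rw [← gradL_fderiv, h2.fderiv]
  have h3 := (traceL.comp gradL).integral_comp_comm h1
  simp only [ContinuousLinearMap.comp_apply, traceL_gradL_smulRight] at h3
  rw [← h3]
  set ρ := φ.normed (volume : Measure E) with hρ
  have hρd : Differentiable ℝ ρ := φ.contDiff_normed.differentiable (n := ∞) (by simp)
  set ψ : E → ℝ := fun s => ρ (x - l⁻¹ • s) with hψ
  have hψd : ∀ s v, fderiv ℝ ψ s v = -l⁻¹ * fderiv ℝ ρ (x - l⁻¹ • s) v := by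
    intro s v
    have h4 : HasFDerivAt (fun s : E => x - l⁻¹ • s) (-(l⁻¹ • ContinuousLinearMap.id ℝ E)) s :=
      ((hasFDerivAt_id s).const_smul l⁻¹).const_sub x
    have h5 := ((hρd (x - l⁻¹ • s)).hasFDerivAt.comp s h4).fderiv
    rw [show ψ = ρ ∘ fun s => x - l⁻¹ • s from rfl, h5]
    simp
  have hψ0 := hdiv ψ
    (φ.contDiff_normed.comp (contDiff_const.sub (contDiff_id.const_smul l⁻¹)))
    (by
      refine HasCompactSupport.comp_homeomorph (f := ρ) φ.hasCompactSupport_normed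
        ((Homeomorph.smulOfNeZero l⁻¹ (inv_ne_zero hl0.ne')).trans (Homeomorph.subLeft x)))
  simp only [hψd, integral_const_mul] at hψ0
  have h6 : ∫ s, fderiv ℝ ρ (x - l⁻¹ • s) (h s) = 0 := by
    rcases mul_eq_zero.1 hψ0 with h7 | h7
    · have := inv_pos.2 hl0
      linarith
    · exact h7
  have h8 := Measure.integral_comp_smul volume (fun s => fderiv ℝ ρ (x - l⁻¹ • s) (h s)) l
  rw [h6, smul_zero] at h8
  simp only [smul_smul, inv_mul_cancel₀ hl0.ne', one_smul] at h8
  rw [← integral_sub_left_eq_self (fun t => fderiv ℝ ρ t (h (l • (x - t)))) volume x]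
  simpa only [sub_sub_cancel] using h8

theorem mollify_eq_zero {F : Type*} [NormedAddCommGroup F] [NormedSpace ℝ F]
    (φ : ContDiffBump (0 : E)) (l : ℝ) {h : E → F} {x : E}
    (hx : ∀ t, ‖t‖ < φ.rOut → h (l • (x - t)) = 0) : mollify φ l h x = 0 := by
  rw [mollify_apply]
  refine integral_eq_zero_of_ae (Eventually.of_forall fun t => ?_)
  beta_reduce
  by_cases ht : ‖t‖ < φ.rOut
  · rw [hx t ht, smul_zero, Pi.zero_apply]
  · have : t ∉ Function.support (φ.normed volume) := by
      rwa [φ.support_normed_eq, mem_ball_zero_iff]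
    rw [Function.notMem_support.1 this, zero_smul, Pi.zero_apply]

theorem grad_mollify_one (φ : ContDiffBump (0 : E)) {u : E → E} (hu : ContDiff ℝ 1 u)
    (hc : HasCompactSupport u) : grad (mollify φ 1 u) = mollify φ 1 (grad u) := by
  ext1 x
  have hloc : LocallyIntegrable (φ.normed (volume : Measure E)) volume :=
    φ.continuous_normed.locallyIntegrable
  have h1 := hc.hasFDerivAt_convolution_right (ContinuousLinearMap.lsmul ℝ ℝ) hloc hu x
  have h2 := (hc.fderiv ℝ).convolutionExists_right
    ((ContinuousLinearMap.lsmul ℝ ℝ : ℝ →L[ℝ] E →L[ℝ] E).precompR E) hloc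
    (hu.continuous_fderiv one_ne_zero) x
  have e : ∀ t, ((ContinuousLinearMap.lsmul ℝ ℝ : ℝ →L[ℝ] E →L[ℝ] E).precompR E)
      (φ.normed volume t) (fderiv ℝ u (x - t)) = φ.normed volume t • fderiv ℝ u (x - t) :=
    fun t => rfl
  rw [convolution_def] at h1
  simp only [e] at h1
  have h3 : Integrable fun t => φ.normed volume t • fderiv ℝ u (x - t) := h2
  have h4 : mollify φ 1 u = φ.normed volume ⋆[ContinuousLinearMap.lsmul ℝ ℝ, volume] u := by
    simp [mollify]
  rw [h4, ← gradL_fderiv, h1.fderiv, ← gradL.integral_comp_comm h3, mollify_apply]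
  simp only [map_smul, gradL_fderiv, one_smul]

/-! ### Membership in `H¹₀` -/

/-- A bump function at the origin with support of radius `r`. -/
def bump {r : ℝ} (hr : 0 < r) : ContDiffBump (0 : E) := ⟨r / 2, r, by positivity, by linarith⟩

/-- Mollification with radii `δ / (n + 1)` keeps the supports in the closed `δ`-neighbourhood of the
original support, which still lies in `Ω`, and converges together with the gradients. -/
theorem fieldX_mem_H10_of_hasCompactSupport {Ω : Set E} (hΩ : IsOpen Ω) {u : E → E}
    (hu : ContDiff ℝ 1 u) (hc : HasCompactSupport u) (hs : tsupport u ⊆ Ω)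
    (h1 : MemLp u 2 (volume.restrict Ω)) (h2 : MemLp (grad u) 2 (volume.restrict Ω)) :
    fieldX Ω u h1 h2 ∈ H10 Ω := by
  obtain ⟨δ, hδ0, hδ⟩ := hc.isCompact.exists_cthickening_subset_open hΩ hs
  have hr : ∀ n : ℕ, 0 < δ / (n + 1) := fun n => by positivity
  set φ : ℕ → ContDiffBump (0 : E) := fun n => bump (hr n) with hφ
  have hlim : Tendsto (fun n => (φ n).rOut) atTop (𝓝 0) := by
    have := (tendsto_one_div_add_atTop_nhds_zero_nat (𝕜 := ℝ)).const_mul δ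
    simpa [hφ, bump, div_eq_mul_inv] using this
  have hu2 : MemLp u 2 volume := hu.continuous.memLp_of_hasCompactSupport hc
  have hg2 : MemLp (grad u) 2 volume :=
    (continuous_grad hu).memLp_of_hasCompactSupport (hasCompactSupport_grad hc)
  set v : ℕ → E → E := fun n => mollify (φ n) 1 u with hv
  have hvd : ∀ n, ContDiff ℝ ∞ (v n) := fun n => contDiff_mollify _ le_rfl hu2
  have hsupp : ∀ n, tsupport (v n) ⊆ Metric.cthickening δ (tsupport u) := by
    intro n
    refine closure_minimal (fun x hx => ?_) Metric.isClosed_cthickening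
    by_contra hxt
    refine hx (mollify_eq_zero _ _ fun t ht => ?_)
    rw [one_smul]
    by_contra hne
    refine hxt (Metric.mem_cthickening_of_dist_le x (x - t) δ _ (subset_tsupport u hne) ?_)
    rw [dist_eq_norm, sub_sub_cancel]
    refine ht.le.trans (div_le_self hδ0.le ?_)
    simp
  have hvc : ∀ n, HasCompactSupport (v n) := fun n =>
    HasCompactSupport.of_support_subset_isCompact hc.isCompact.cthickening
      ((subset_tsupport _).trans (hsupp n))
  have hm1 : ∀ n, MemLp (v n) 2 (volume.restrict Ω) := fun n =>
    ((hvd n).continuous.memLp_of_hasCompactSupport (hvc n)).restrict Ω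
  have hm2 : ∀ n, MemLp (grad (v n)) 2 (volume.restrict Ω) := fun n =>
    (memLp_grad_mollify _ le_rfl hu2).restrict Ω
  have ht1 : Tendsto (fun n => eLpNorm (v n - u) 2 (volume.restrict Ω)) atTop (𝓝 0) :=
    tendsto_of_tendsto_of_tendsto_of_le_of_le tendsto_const_nhds
      (tendsto_mollify hlim tendsto_const_nhds (fun _ => le_rfl) hu2) (fun _ => zero_le)
      fun n => eLpNorm_restrict_le _ _ _ _
  have ht2 : Tendsto (fun n => eLpNorm (grad (v n) - grad u) 2 (volume.restrict Ω)) atTop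
      (𝓝 0) := by
    refine tendsto_of_tendsto_of_tendsto_of_le_of_le tendsto_const_nhds
      (tendsto_mollify hlim tendsto_const_nhds (fun _ => le_rfl) hg2) (fun _ => zero_le)
      fun n => ?_
    simp only [hv]
    rw [grad_mollify_one _ hu hc]
    exact eLpNorm_restrict_le _ _ _ _
  have := tendsto_fieldX h1 h2 hm1 hm2 ht1 ht2
  refine (Submodule.isClosed_topologicalClosure _).mem_of_tendsto this
    (Eventually.of_forall fun n => testFields_subset_H10 Ω
      (fieldX_mem_testFields _ _ (hvd n) (hvc n) ((hsupp n).trans hδ)))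

/-- Apart from `χ ∇u`, the gradient of `χ u` contains the error `∇χ ⊗ u`. At each point the error is
eventually zero, and it is dominated by a fixed square integrable function, so dominated convergence
applies. Each `χ u` has compact support in `Ω`. -/
theorem fieldX_mem_H10_of_cutoff {Ω : Set E} (hΩ : IsOpen Ω) {u : E → E} (hu : ContDiff ℝ 1 u)
    (h1 : MemLp u 2 (volume.restrict Ω)) (h2 : MemLp (grad u) 2 (volume.restrict Ω))
    {χ : ℕ → E → ℝ} (hχ : ∀ n, ContDiff ℝ 1 (χ n)) (hχ1 : ∀ n x, |χ n x| ≤ 1)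
    (hc : ∀ n, HasCompactSupport (χ n)) (hs : ∀ n, tsupport (χ n) ⊆ Ω)
    (hev : ∀ x ∈ Ω, ∀ᶠ n in atTop, χ n =ᶠ[𝓝 x] fun _ => 1) {B : E → ℝ}
    (hB : MemLp B 2 (volume.restrict Ω))
    (hb : ∀ n, ∀ x ∈ Ω, ‖fderiv ℝ (χ n) x‖ * ‖u x‖ ≤ B x) : fieldX Ω u h1 h2 ∈ H10 Ω := by
  set v : ℕ → E → E := fun n x => χ n x • u x with hv
  have hvd : ∀ n, ContDiff ℝ 1 (v n) := fun n => (hχ n).smul hu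
  have hvc : ∀ n, HasCompactSupport (v n) := fun n => (hc n).smul_right
  have hvs : ∀ n, tsupport (v n) ⊆ Ω := fun n => (tsupport_smul_subset_left (χ n) u).trans (hs n)
  have hm1 : ∀ n, MemLp (v n) 2 (volume.restrict Ω) := fun n =>
    ((hvd n).continuous.memLp_of_hasCompactSupport (hvc n)).restrict Ω
  have hm2 : ∀ n, MemLp (grad (v n)) 2 (volume.restrict Ω) := fun n =>
    ((continuous_grad (hvd n)).memLp_of_hasCompactSupport (hasCompactSupport_grad (hvc n))).restrict Ω
  have hgrad : ∀ n x, grad (v n) x = χ n x • grad u x +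
      gradL ((fderiv ℝ (χ n) x).smulRight (u x)) := by
    intro n x
    rw [← gradL_fderiv, show v n = χ n • u from rfl, ((((hχ n).differentiable one_ne_zero x).hasFDerivAt).smul
      ((hu.differentiable one_ne_zero x).hasFDerivAt)).fderiv, map_add, map_smul, gradL_fderiv]
  have hevv : ∀ x ∈ Ω, ∀ᶠ n in atTop, v n =ᶠ[𝓝 x] u := fun x hx => by
    filter_upwards [hev x hx] with n hn
    filter_upwards [hn] with y hy
    simp [hv, hy]
  have ht1 : Tendsto (fun n => eLpNorm (v n - u) 2 (volume.restrict Ω)) atTop (𝓝 0) := by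
    refine tendsto_eLpNorm_two_of_dominated (fun n => (hm1 n).1.sub h1.1)
      (h1.norm.const_mul 2) (fun n => Eventually.of_forall fun x => ?_) ?_
    · refine (norm_sub_le _ _).trans ?_
      have : ‖v n x‖ ≤ 1 * ‖u x‖ := by
        rw [hv, norm_smul]
        exact mul_le_mul_of_nonneg_right (hχ1 n x) (norm_nonneg _)
      linarith
    · filter_upwards [ae_restrict_mem hΩ.measurableSet] with x hx
      refine tendsto_const_nhds.congr' ?_
      filter_upwards [hevv x hx] with n hn
      rw [Pi.sub_apply, hn.eq_of_nhds, sub_self]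
  have ht2 : Tendsto (fun n => eLpNorm (grad (v n) - grad u) 2 (volume.restrict Ω)) atTop
      (𝓝 0) := by
    refine tendsto_eLpNorm_two_of_dominated (fun n => (hm2 n).1.sub h2.1)
      ((h2.norm.const_mul 2).add (hB.const_mul 2)) (fun n => ?_) ?_
    · filter_upwards [ae_restrict_mem hΩ.measurableSet] with x hx
      rw [Pi.sub_apply, hgrad]
      have h3 : ‖χ n x • grad u x‖ ≤ 1 * ‖grad u x‖ := by
        rw [norm_smul]
        exact mul_le_mul_of_nonneg_right (hχ1 n x) (norm_nonneg _)
      have h4 := norm_gradL_le ((fderiv ℝ (χ n) x).smulRight (u x))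
      rw [ContinuousLinearMap.norm_smulRight_apply] at h4
      have h5 := hb n x hx
      have h6 := norm_sub_le (χ n x • grad u x + gradL ((fderiv ℝ (χ n) x).smulRight (u x)))
        (grad u x)
      have h7 := norm_add_le (χ n x • grad u x) (gradL ((fderiv ℝ (χ n) x).smulRight (u x)))
      simp only [Pi.add_apply]
      linarith
    · filter_upwards [ae_restrict_mem hΩ.measurableSet] with x hx
      refine tendsto_const_nhds.congr' ?_
      filter_upwards [hevv x hx] with n hn
      rw [Pi.sub_apply, ← gradL_fderiv, ← gradL_fderiv, hn.fderiv_eq, sub_self]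
  exact (Submodule.isClosed_topologicalClosure _).mem_of_tendsto
    (tendsto_fieldX h1 h2 hm1 hm2 ht1 ht2) (Eventually.of_forall fun n =>
      fieldX_mem_H10_of_hasCompactSupport hΩ (hvd n) (hvc n) (hvs n) _ _)

/-! ### Radial cutoff functions -/

theorem deriv_smoothTransition_eq_zero {x : ℝ} (hx : x ∉ Icc (0 : ℝ) 1) :
    deriv Real.smoothTransition x = 0 := by
  rw [mem_Icc, not_and_or, not_le, not_le] at hx
  rcases hx with hx | hx
  · have : Real.smoothTransition =ᶠ[𝓝 x] fun _ => 0 := by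
      filter_upwards [Iio_mem_nhds hx] with y hy
      exact Real.smoothTransition.zero_of_nonpos (le_of_lt hy)
    rw [this.deriv_eq, deriv_const]
  · have : Real.smoothTransition =ᶠ[𝓝 x] fun _ => 1 := by
      filter_upwards [Ioi_mem_nhds hx] with y hy
      exact Real.smoothTransition.one_of_one_le (le_of_lt hy)
    rw [this.deriv_eq, deriv_const]

theorem exists_abs_deriv_smoothTransition_le :
    ∃ D : ℝ, 0 ≤ D ∧ ∀ x, |deriv Real.smoothTransition x| ≤ D := by
  obtain ⟨D, hD⟩ := (HasCompactSupport.intro (isCompact_Icc (a := (0 : ℝ)) (b := 1))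
    fun x hx => deriv_smoothTransition_eq_zero hx).exists_bound_of_continuous
      ((Real.smoothTransition.contDiff (n := 1)).continuous_deriv le_rfl)
  exact ⟨D, (norm_nonneg _).trans (hD 0), hD⟩

/-- A radial cutoff function, equal to one where `b|x|² ≤ a - 1` and to zero where `b|x|² ≥ a`. -/
def cutoff (a b : ℝ) (x : E) : ℝ := Real.smoothTransition (a - b * ‖x‖ ^ 2)

theorem contDiff_cutoff (a b : ℝ) : ContDiff ℝ 1 (cutoff a b) :=
  (Real.smoothTransition.contDiff (n := 1)).comp
    (contDiff_const.sub (contDiff_const.mul (contDiff_norm_sq ℝ)))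

theorem abs_cutoff_le (a b : ℝ) (x : E) : |cutoff a b x| ≤ 1 := by
  rw [cutoff, abs_of_nonneg (Real.smoothTransition.nonneg _)]
  exact Real.smoothTransition.le_one _

theorem tsupport_cutoff_subset {a b : ℝ} (r : ℝ) (hr : ∀ x : E, r < ‖x‖ → a ≤ b * ‖x‖ ^ 2) :
    tsupport (cutoff a b) ⊆ Metric.closedBall 0 r := by
  refine closure_minimal (fun x hx => ?_) Metric.isClosed_closedBall
  rw [mem_closedBall_zero_iff]
  by_contra! h
  exact hx (Real.smoothTransition.zero_of_nonpos (by linarith [hr x h]))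

theorem norm_fderiv_cutoff (a : ℝ) {b : ℝ} (hb : 0 ≤ b) (x : E) :
    ‖fderiv ℝ (cutoff a b) x‖ =
      |deriv Real.smoothTransition (a - b * ‖x‖ ^ 2)| * (2 * b * ‖x‖) := by
  have h1 : HasFDerivAt (fun y : E => a - b * ‖y‖ ^ 2) (-(b • (2 • innerSL ℝ x))) x :=
    ((hasStrictFDerivAt_norm_sq x).hasFDerivAt.const_mul b).const_sub a
  have h2 := ((Real.smoothTransition.contDiff (n := 1)).differentiable one_ne_zero
    (a - b * ‖x‖ ^ 2)).hasDerivAt.comp_hasFDerivAt x h1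
  rw [show cutoff a b = Real.smoothTransition ∘ fun y : E => a - b * ‖y‖ ^ 2 from rfl, h2.fderiv,
    norm_smul, norm_neg, norm_smul, ← Nat.cast_smul_eq_nsmul ℝ, norm_smul, innerSL_apply_norm,
    Real.norm_eq_abs, Real.norm_eq_abs, abs_of_nonneg hb]
  simp
  ring_nf
  simp

/-- The cutoffs equal one on balls of radius `n + 1` and their gradients are uniformly bounded, so
the error is dominated by a multiple of `‖u‖`. -/
theorem fieldX_mem_H10_univ {u : E → E} (hu : ContDiff ℝ 1 u)
    (h1 : MemLp u 2 (volume.restrict univ)) (h2 : MemLp (grad u) 2 (volume.restrict univ)) :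
    fieldX univ u h1 h2 ∈ H10 univ := by
  obtain ⟨D, hD0, hD⟩ := exists_abs_deriv_smoothTransition_le
  have hsub : ∀ n : ℕ, tsupport (cutoff 2 (1 / ((n : ℝ) + 1) ^ 2)) ⊆
      Metric.closedBall (0 : E) (2 * (n + 1)) := fun n => by
    refine tsupport_cutoff_subset _ fun x hx => ?_
    have hn : (0 : ℝ) < n + 1 := by positivity
    rw [one_div, inv_mul_eq_div, le_div_iff₀ (by positivity)]
    nlinarith
  refine fieldX_mem_H10_of_cutoff isOpen_univ hu h1 h2
    (χ := fun n => cutoff 2 (1 / ((n : ℝ) + 1) ^ 2)) (B := fun x => 4 * D * ‖u x‖)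
    (fun n => contDiff_cutoff _ _) (fun n => abs_cutoff_le _ _)
    (fun n => (isCompact_closedBall (0 : E) _).of_isClosed_subset (isClosed_tsupport _) (hsub n))
    (fun n => subset_univ _) (fun x _ => ?_) (h1.norm.const_mul _) (fun n x _ => ?_)
  · obtain ⟨N, hN⟩ := exists_nat_gt ‖x‖
    filter_upwards [eventually_ge_atTop N] with n hn
    have hn' : ‖x‖ < n := hN.trans_le (by exact_mod_cast hn)
    filter_upwards [(isOpen_lt continuous_norm continuous_const).mem_nhds hn'] with y hy
    refine Real.smoothTransition.one_of_one_le ?_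
    have hy' : ‖y‖ < n := hy
    have : 1 / ((n : ℝ) + 1) ^ 2 * ‖y‖ ^ 2 ≤ 1 := by
      rw [one_div, inv_mul_eq_div, div_le_one (by positivity)]
      exact pow_le_pow_left₀ (norm_nonneg _) (by linarith) 2
    linarith
  · refine mul_le_mul_of_nonneg_right ?_ (norm_nonneg _)
    have hn : (0 : ℝ) < n + 1 := by positivity
    rw [norm_fderiv_cutoff _ (by positivity)]
    by_cases hx : (2 : ℝ) - 1 / ((n : ℝ) + 1) ^ 2 * ‖x‖ ^ 2 ∈ Icc (0 : ℝ) 1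
    · have h3 : ‖x‖ ≤ 2 * (n + 1) := by
        have h4 : 1 / ((n : ℝ) + 1) ^ 2 * ‖x‖ ^ 2 ≤ 2 := by linarith [hx.1]
        rw [one_div, inv_mul_eq_div, div_le_iff₀ (by positivity)] at h4
        refine le_of_sq_le_sq ?_ (by positivity)
        nlinarith
      have h5 : 2 * (1 / ((n : ℝ) + 1) ^ 2) * ‖x‖ ≤ 4 := by
        rw [mul_one_div, div_mul_eq_mul_div, div_le_iff₀ (by positivity)]
        have : (0 : ℝ) ≤ n := n.cast_nonneg
        nlinarith
      calc _ ≤ D * 4 := mul_le_mul (hD _) h5 (by positivity) hD0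
        _ = 4 * D := mul_comm _ _
    · rw [deriv_smoothTransition_eq_zero hx, abs_zero, zero_mul]
      positivity

/-- The cutoff argument is `(n + 1)(R² - |x|²) - 1`, so the transition takes place where `R² - |x|²`
lies between `1 / (n + 1)` and `2 / (n + 1)`. There `∇χ` is of order `n + 1`, and the assumed linear
vanishing of `u` at the boundary compensates it. This gives zero boundary values without a trace
operator. -/
theorem fieldX_mem_H10_ball {R L : ℝ} (hR : 0 < R) {u : E → E} (hu : ContDiff ℝ 1 u)
    (h1 : MemLp u 2 (volume.restrict (Metric.ball 0 R)))
    (h2 : MemLp (grad u) 2 (volume.restrict (Metric.ball 0 R)))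
    (hL : ∀ x ∈ Metric.ball (0 : E) R, ‖u x‖ ≤ L * (R ^ 2 - ‖x‖ ^ 2)) :
    fieldX (Metric.ball 0 R) u h1 h2 ∈ H10 (Metric.ball 0 R) := by
  obtain ⟨D, hD0, hD⟩ := exists_abs_deriv_smoothTransition_le
  have : IsFiniteMeasure (volume.restrict (Metric.ball (0 : E) R)) :=
    isFiniteMeasure_restrict.2 measure_ball_lt_top.ne
  have hL0 : 0 ≤ L := by
    have := (norm_nonneg _).trans (hL 0 (Metric.mem_ball_self hR))
    rw [norm_zero] at this
    exact nonneg_of_mul_nonneg_left this (by have := pow_pos hR 2; linarith)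
  have hsub : ∀ n : ℕ, tsupport (cutoff (((n : ℝ) + 1) * R ^ 2 - 1) (n + 1)) ⊆
      Metric.closedBall (0 : E) (√(R ^ 2 - 1 / (n + 1))) := fun n => by
    refine tsupport_cutoff_subset _ fun x hx => ?_
    have hn : (0 : ℝ) < n + 1 := by positivity
    have h3 := Real.lt_sq_of_sqrt_lt hx
    have h4 := mul_lt_mul_of_pos_left h3 hn
    rw [mul_sub, mul_one_div_cancel hn.ne'] at h4
    exact h4.le
  have hlt : ∀ n : ℕ, √(R ^ 2 - 1 / ((n : ℝ) + 1)) < R := fun n => by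
    rw [Real.sqrt_lt' hR]
    have : (0 : ℝ) < 1 / ((n : ℝ) + 1) := by positivity
    linarith
  refine fieldX_mem_H10_of_cutoff Metric.isOpen_ball hu h1 h2
    (χ := fun n => cutoff (((n : ℝ) + 1) * R ^ 2 - 1) (n + 1)) (B := fun x => 4 * D * R * L)
    (fun n => contDiff_cutoff _ _) (fun n => abs_cutoff_le _ _)
    (fun n => (isCompact_closedBall (0 : E) _).of_isClosed_subset (isClosed_tsupport _) (hsub n))
    (fun n => (hsub n).trans (Metric.closedBall_subset_ball (hlt n)))
    (fun x hx => ?_) (memLp_const _) (fun n x hx => ?_)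
  · rw [mem_ball_zero_iff] at hx
    have hx2 : 0 < R ^ 2 - ‖x‖ ^ 2 := by nlinarith [norm_nonneg x]
    obtain ⟨N, hN⟩ := exists_nat_gt (2 / (R ^ 2 - ‖x‖ ^ 2))
    rw [div_lt_iff₀ hx2] at hN
    filter_upwards [eventually_ge_atTop N] with n hn
    have hn' : 2 < (n + 1 : ℝ) * (R ^ 2 - ‖x‖ ^ 2) := by
      have : (N : ℝ) ≤ n := by exact_mod_cast hn
      nlinarith
    have hcont : Continuous fun y : E => (n + 1 : ℝ) * (R ^ 2 - ‖y‖ ^ 2) := by fun_prop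
    filter_upwards [(isOpen_lt continuous_const hcont).mem_nhds hn'] with y hy
    refine Real.smoothTransition.one_of_one_le ?_
    have hy' : 2 < (n + 1 : ℝ) * (R ^ 2 - ‖y‖ ^ 2) := hy
    linarith
  · have hxL := hL x hx
    rw [mem_ball_zero_iff] at hx
    have hx2 : 0 < R ^ 2 - ‖x‖ ^ 2 := by nlinarith [norm_nonneg x]
    rw [norm_fderiv_cutoff _ (by positivity)]
    by_cases hm : ((n : ℝ) + 1) * R ^ 2 - 1 - (n + 1) * ‖x‖ ^ 2 ∈ Icc (0 : ℝ) 1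
    · have h3 : ((n : ℝ) + 1) * (R ^ 2 - ‖x‖ ^ 2) ≤ 2 := by linarith [hm.2]
      calc _ ≤ D * (2 * ((n : ℝ) + 1) * R) * (L * (R ^ 2 - ‖x‖ ^ 2)) := by
            gcongr
            exact hD _
        _ = 2 * D * R * L * (((n : ℝ) + 1) * (R ^ 2 - ‖x‖ ^ 2)) := by ring
        _ ≤ 2 * D * R * L * 2 := by gcongr
        _ = 4 * D * R * L := by ring
    · rw [deriv_smoothTransition_eq_zero hm, abs_zero, zero_mul, zero_mul]
      positivity

/-! ### Density of `V(Ω)` in `H(Ω)` -/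

theorem memLp_mollify (φ : ContDiffBump (0 : E)) {l : ℝ} (hl : 1 ≤ l) {h : E → E}
    (hh : MemLp h 2 volume) : MemLp (mollify φ l h) 2 volume :=
  ⟨(contDiff_mollify φ hl hh).continuous.aestronglyMeasurable,
    (eLpNorm_mollify_le φ hl hh.1).trans_lt hh.2⟩

/-- Mollifications of a weakly divergence-free field are divergence free in the classical sense and
converge in `L²`. Only their boundary behaviour depends on the domain, which is why it is left as a
hypothesis. -/
theorem mem_closure_of_mollify_mem_H10 {Ω : Set E} (hΩ : MeasurableSet Ω) {w₀ : L2 Ω E}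
    {h : E → E} (hh : MemLp h 2 volume) (hw : h =ᵐ[volume.restrict Ω] w₀)
    (hdiv : ∀ ψ : E → ℝ, ContDiff ℝ ∞ ψ → HasCompactSupport ψ → ∫ x, fderiv ℝ ψ x (h x) = 0)
    {φ : ℕ → ContDiffBump (0 : E)} {l : ℕ → ℝ}
    (hφ : Tendsto (fun n => (φ n).rOut) atTop (𝓝 0)) (hl : Tendsto l atTop (𝓝 1))
    (hl1 : ∀ n, 1 ≤ l n)
    (h1 : ∀ n, MemLp (mollify (φ n) (l n) h) 2 (volume.restrict Ω))
    (h2 : ∀ n, MemLp (grad (mollify (φ n) (l n) h)) 2 (volume.restrict Ω))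
    (hmem : ∀ n, fieldX Ω _ (h1 n) (h2 n) ∈ H10 Ω) :
    w₀ ∈ closure (range fun p : V Ω => (p : X Ω).fst) := by
  have ht : Tendsto (fun n => eLpNorm (mollify (φ n) (l n) h - ⇑w₀) 2 (volume.restrict Ω)) atTop
      (𝓝 0) := by
    refine tendsto_of_tendsto_of_tendsto_of_le_of_le tendsto_const_nhds
      (tendsto_mollify hφ hl hl1 hh) (fun _ => zero_le) fun n => ?_
    refine le_trans (le_of_eq (eLpNorm_congr_ae ?_)) (eLpNorm_restrict_le _ _ _ _)
    filter_upwards [hw] with x hx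
    rw [Pi.sub_apply, Pi.sub_apply, hx]
  have ht' := (Lp.tendsto_Lp_iff_tendsto_eLpNorm'' _ h1 _ (Lp.memLp w₀)).2 ht
  rw [Lp.toLp_coeFn] at ht'
  refine mem_closure_of_tendsto ht' (Eventually.of_forall fun n => ?_)
  exact ⟨⟨_, fieldX_mem_V _ _ (hmem n)
    (fun x _ => traceL_grad_mollify (φ n) (hl1 n) hh hdiv x) hΩ⟩, rfl⟩

theorem InH.mem_closure_univ {w₀ : L2 univ E} (h₀ : InH univ w₀) :
    w₀ ∈ closure (range fun p : V univ => (p : X univ).fst) := by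
  have hh : MemLp w₀ 2 (volume : Measure E) := by
    simpa only [Measure.restrict_univ] using Lp.memLp w₀
  have hdiv : ∀ ψ : E → ℝ, ContDiff ℝ ∞ ψ → HasCompactSupport ψ →
      ∫ x, fderiv ℝ ψ x (w₀ x) = 0 := fun ψ h1 h2 => by
    simpa only [Measure.restrict_univ] using h₀ ψ h1 h2
  have hr : ∀ n : ℕ, (0 : ℝ) < 1 / ((n : ℝ) + 1) := fun n => by positivity
  refine mem_closure_of_mollify_mem_H10 MeasurableSet.univ hh (Eventually.of_forall fun _ => rfl)
    hdiv (φ := fun n => bump (hr n)) (l := fun _ => 1) tendsto_one_div_add_atTop_nhds_zero_nat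
    tendsto_const_nhds (fun _ => le_rfl)
    (fun n => (memLp_mollify _ le_rfl hh).restrict _)
    (fun n => (memLp_grad_mollify _ le_rfl hh).restrict _) fun n => ?_
  exact fieldX_mem_H10_univ ((contDiff_mollify _ le_rfl hh).of_le (by simp)) _ _

/-- The extension by zero is divergence free in the whole plane, since `InH` tests with functions
that need not vanish on the boundary; this encodes the vanishing normal component. The dilation
pulls the support strictly inside the disk, and the mollification then has compact support there. -/
theorem InH.mem_closure_ball {R : ℝ} (hR : 0 < R) {w₀ : L2 (Metric.ball 0 R) E}
    (h₀ : InH (Metric.ball 0 R) w₀) :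
    w₀ ∈ closure (range fun p : V (Metric.ball 0 R) => (p : X (Metric.ball 0 R)).fst) := by
  set h : E → E := (Metric.ball (0 : E) R).indicator w₀ with hdef
  have hh : MemLp h 2 (volume : Measure E) :=
    (memLp_indicator_iff_restrict measurableSet_ball).2 (Lp.memLp w₀)
  have hdiv : ∀ ψ : E → ℝ, ContDiff ℝ ∞ ψ → HasCompactSupport ψ →
      ∫ x, fderiv ℝ ψ x (h x) = 0 := fun ψ h1 h2 => by
    rw [← h₀ ψ h1 h2, ← integral_indicator measurableSet_ball]
    refine integral_congr_ae (Eventually.of_forall fun x => ?_)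
    by_cases hx : x ∈ Metric.ball (0 : E) R <;> simp [hdef, hx]
  -- With `l n = (n + 2) / (n + 1)` the dilated support has radius `R - R / (n + 2)`. The
  -- mollification radius is half of the gap `R / (n + 2)`.
  have hr : ∀ n : ℕ, 0 < R / 2 * (1 / ((n : ℝ) + 1 + 1)) := fun n => by positivity
  set l : ℕ → ℝ := fun n => 1 + 1 / ((n : ℝ) + 1) with hl
  have hl1 : ∀ n, 1 ≤ l n := fun n => by
    have : (0 : ℝ) < 1 / ((n : ℝ) + 1) := by positivity
    simp only [hl]
    linarith
  set v : ℕ → E → E := fun n => mollify (bump (hr n)) (l n) h with hv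
  have hvs : ∀ n, tsupport (v n) ⊆ Metric.closedBall 0 (R - R / 2 * (1 / ((n : ℝ) + 1 + 1))) := by
    intro n
    refine closure_minimal (fun x hx => ?_) Metric.isClosed_closedBall
    rw [mem_closedBall_zero_iff]
    by_contra! hlt
    refine hx (mollify_eq_zero _ _ fun t ht => ?_)
    refine indicator_of_notMem (fun hm => ?_) _
    rw [mem_ball_zero_iff, norm_smul, Real.norm_of_nonneg (zero_le_one.trans (hl1 n))] at hm
    change ‖t‖ < R / 2 * (1 / ((n : ℝ) + 1 + 1)) at ht
    have h1 := norm_sub_norm_le x t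
    have h2 : R - R * (1 / ((n : ℝ) + 1 + 1)) < ‖x - t‖ := by linarith
    have h3 : l n * (R - R * (1 / ((n : ℝ) + 1 + 1))) < R :=
      (mul_lt_mul_of_pos_left h2 (zero_lt_one.trans_le (hl1 n))).trans hm
    refine h3.ne ?_
    simp only [hl]
    field_simp
    ring
  have hvb : ∀ n, tsupport (v n) ⊆ Metric.ball 0 R := fun n =>
    (hvs n).trans (Metric.closedBall_subset_ball (by linarith [hr n]))
  have hvd : ∀ n, ContDiff ℝ ∞ (v n) := fun n => contDiff_mollify _ (hl1 n) hh
  have hvc : ∀ n, HasCompactSupport (v n) := fun n =>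
    (isCompact_closedBall (0 : E) _).of_isClosed_subset (isClosed_tsupport _) (hvs n)
  have hlim : Tendsto (fun n : ℕ => R / 2 * (1 / ((n : ℝ) + 1 + 1))) atTop (𝓝 0) := by
    have h1 := ((tendsto_one_div_add_atTop_nhds_zero_nat (𝕜 := ℝ)).comp
      (tendsto_add_atTop_nat 1)).const_mul (R / 2)
    simpa [Function.comp_def] using h1
  refine mem_closure_of_mollify_mem_H10 measurableSet_ball hh
    ((ae_restrict_mem measurableSet_ball).mono fun x hx => indicator_of_mem hx _)
    hdiv (φ := fun n => bump (hr n)) (l := l) hlim ?_ hl1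
    (fun n => (memLp_mollify _ (hl1 n) hh).restrict _)
    (fun n => (memLp_grad_mollify _ (hl1 n) hh).restrict _) fun n => ?_
  · simpa [hl] using (tendsto_one_div_add_atTop_nhds_zero_nat (𝕜 := ℝ)).const_add 1
  · exact testFields_subset_H10 _ (fieldX_mem_testFields _ _ (hvd n) (hvc n) (hvb n))

/-! ### The integrals in the energy identity as inner products -/

theorem conv_sub_left (u v : E → E) (G : E → M) (x : E) :
    conv (fun y => u y - v y) G x = conv u G x - conv v G x := by
  ext j
  simp [conv_apply, Fin.sum_univ_two]
  ring

/-- As a continuous map on `L²`, multiplication by a bounded gradient turns the quadratic term of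
the energy identity into an inner product. Measurability and integrability in time are then
immediate. -/
theorem exists_convOp {Ω : Set E} {D : E → M} {C : ℝ} (hC : 0 ≤ C)
    (hD : AEStronglyMeasurable D (volume.restrict Ω))
    (hDC : ∀ᵐ x ∂volume.restrict Ω, ‖D x‖ ≤ C) :
    ∃ A : L2 Ω E → L2 Ω E, Continuous A ∧ (∀ u, A u =ᵐ[volume.restrict Ω] conv u D) ∧
      ∀ u, ‖A u‖ ≤ C * ‖u‖ := by
  have hm : ∀ u : L2 Ω E, MemLp (conv u D) 2 (volume.restrict Ω) := fun u => by
    refine (Lp.memLp u).of_le_mul (c := C) (aestronglyMeasurable_conv (Lp.memLp u).1 hD) ?_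
    filter_upwards [hDC] with x hx
    rw [mul_comm]
    exact (norm_conv_le _ _ _).trans (mul_le_mul_of_nonneg_left hx (norm_nonneg _))
  refine ⟨fun u => (hm u).toLp _, ?_, fun u => (hm u).coeFn_toLp, fun u => ?_⟩
  · refine (LipschitzWith.of_dist_le_mul (K := C.toNNReal) fun u v => ?_).continuous
    rw [dist_eq_norm, dist_eq_norm, Real.coe_toNNReal _ hC]
    refine Lp.norm_le_mul_norm_of_ae_le_mul ?_
    filter_upwards [Lp.coeFn_sub ((hm u).toLp _) ((hm v).toLp _), (hm u).coeFn_toLp,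
      (hm v).coeFn_toLp, Lp.coeFn_sub u v, hDC] with x h1 h2 h3 h4 h5
    rw [h1, Pi.sub_apply, h2, h3, h4, ← conv_sub_left, mul_comm]
    exact (norm_conv_le _ _ _).trans (mul_le_mul_of_nonneg_left h5 (norm_nonneg _))
  · refine Lp.norm_le_mul_norm_of_ae_le_mul ?_
    filter_upwards [(hm u).coeFn_toLp, hDC] with x h1 h2
    rw [h1, mul_comm]
    exact (norm_conv_le _ _ _).trans (mul_le_mul_of_nonneg_left h2 (norm_nonneg _))

theorem integrable_and_integral_inner_eq {α F : Type} [MeasurableSpace α] {μ : Measure α}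
    [NormedAddCommGroup F] [InnerProductSpace ℝ F] {a : α → F} {A u : Lp F 2 μ}
    (h : A =ᵐ[μ] a) :
    Integrable (fun x => ⟪a x, u x⟫) μ ∧ ∫ x, ⟪a x, u x⟫ ∂μ = ⟪A, u⟫ := by
  have e : (fun x => ⟪A x, u x⟫) =ᵐ[μ] fun x => ⟪a x, u x⟫ := h.mono fun x hx => by
    beta_reduce
    rw [hx]
  exact ⟨(L2.integrable_inner A u).congr e, by rw [L2.inner_def, integral_congr_ae e]⟩

/-! ### The energy identity -/

theorem integral_eq_combination {T ν : ℝ} {a p q r s : ℝ → ℝ} (hp : Integrable p (timeMeas T))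
    (hq : Integrable q (timeMeas T)) (hr : Integrable r (timeMeas T))
    (hs : Integrable s (timeMeas T))
    (h : ∀ᵐ t ∂timeMeas T, a t = p t - q t - ν * r t - ν * s t) {t : ℝ} (ht : t ∈ Icc 0 T) :
    ∫ τ in (0 : ℝ)..t, a τ = (∫ τ in (0 : ℝ)..t, p τ) - (∫ τ in (0 : ℝ)..t, q τ) -
      ν * (∫ τ in (0 : ℝ)..t, r τ) - ν * ∫ τ in (0 : ℝ)..t, s τ := by
  have hsub : uIoc 0 t ⊆ Ioc 0 T := by
    rw [uIoc_of_le ht.1]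
    exact Ioc_subset_Ioc_right ht.2
  have hI : ∀ {F : ℝ → ℝ}, Integrable F (timeMeas T) → IntervalIntegrable F volume 0 t :=
    fun hF => intervalIntegrable_iff.2 (IntegrableOn.mono_set hF hsub)
  rw [← intervalIntegral.integral_const_mul, ← intervalIntegral.integral_const_mul,
    ← intervalIntegral.integral_sub (hI hp) (hI hq),
    ← intervalIntegral.integral_sub ((hI hp).sub (hI hq)) ((hI hr).const_mul ν),
    ← intervalIntegral.integral_sub (((hI hp).sub (hI hq)).sub ((hI hr).const_mul ν))
      ((hI hs).const_mul ν)]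
  refine intervalIntegral.integral_congr_ae ?_
  rw [← ae_restrict_iff' measurableSet_uIoc]
  exact ae_restrict_of_ae_restrict_of_subset hsub h

theorem injective_fst_V {Ω : Set E} (hΩ : IsOpen Ω) :
    Function.Injective ((WithLp.fstL 2 ℝ (L2 Ω E) (L2 Ω M)) ∘L (V Ω).subtypeL) := by
  refine (injective_iff_map_eq_zero _).2 fun p hp => ?_
  have h1 : (p : X Ω).fst = 0 := hp
  have h2 := snd_eq_zero_of_fst_eq_zero hΩ p.2.1 h1
  exact Subtype.ext (WithLp.ofLp_injective 2 (Prod.ext h1 h2))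

/-- This is `lions_magenes` for the map from `V` to `L²`, with the functional `g t` replaced by its
Riesz representative in the `H¹` inner product. The function `F` is the value of `g t` on the curve.
-/
theorem norm_sq_eq_of_weak_deriv {Ω : Set E} (hΩ : IsOpen Ω) {T : ℝ} (hT : 0 < T)
    {w₀ : L2 Ω E} {w : ℝ → X Ω} (hw₀ : w₀ ∈ closure (range fun p : V Ω => (p : X Ω).fst))
    (hw : MemLp w 2 (timeMeas T)) (hwV : ∀ᵐ t ∂timeMeas T, w t ∈ V Ω)
    {g : ℝ → StrongDual ℝ (V Ω)} (hg : MemLp g 2 (timeMeas T))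
    (hwg : ∀ᵐ t ∂timeMeas T, ∀ v : V Ω,
      ⟪(w t).fst - w₀, (v : X Ω).fst⟫ = ∫ s in (0 : ℝ)..t, g s v) {F : ℝ → ℝ}
    (hF : ∀ᵐ t ∂timeMeas T, ∀ v : V Ω, (v : X Ω) = w t → g t v = F t) :
    ∃ z : ℝ → L2 Ω E, ContinuousOn z (Icc 0 T) ∧ (∀ᵐ t ∂timeMeas T, z t = (w t).fst) ∧
      z 0 = w₀ ∧ ∀ t ∈ Icc 0 T, ‖z t‖ ^ 2 = ‖w₀‖ ^ 2 + 2 * ∫ s in (0 : ℝ)..t, F s := by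
  -- The curve lies in `V` only for almost every time; orthogonal projection gives a measurable
  -- curve in `V` that agrees with it almost everywhere.
  obtain ⟨W, hWm, hWw⟩ : ∃ W : ℝ → V Ω, MemLp W 2 (timeMeas T) ∧
      ∀ᵐ t ∂timeMeas T, (W t : X Ω) = w t :=
    ⟨fun t => (V Ω).orthogonalProjectionOnto (w t),
      ((V Ω).orthogonalProjectionOnto).comp_memLp' hw,
      hwV.mono fun t ht => Submodule.starProjection_eq_self_iff.2 ht⟩
  obtain ⟨h, hhm, hhg⟩ : ∃ h : ℝ → V Ω, MemLp h 2 (timeMeas T) ∧ ∀ t v, ⟪h t, v⟫ = g t v :=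
    ⟨fun t => (InnerProductSpace.toDual ℝ (V Ω)).symm (g t),
      (memLp_congr_norm (E := V Ω) (F := StrongDual ℝ (V Ω)) (g := g)
        ((InnerProductSpace.toDual ℝ (V Ω)).symm.continuous.comp_aestronglyMeasurable hg.1) hg.1
        (Eventually.of_forall fun t =>
          (InnerProductSpace.toDual ℝ (V Ω)).symm.norm_map (g t))).2 hg,
      fun t v => InnerProductSpace.toDual_symm_apply⟩
  obtain ⟨z, hzc, hzw, hz0, hz⟩ := lions_magenes hT _ (injective_fst_V hΩ) hw₀ hWm hhm (by
    filter_upwards [hwg, hWw] with t h1 h2 v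
    simp only [hhg]
    rw [← h1 v]
    change ⟪(W t : X Ω).fst - w₀, (v : X Ω).fst⟫ = _
    rw [h2])
  refine ⟨z, hzc, ?_, hz0, fun t ht => ?_⟩
  · filter_upwards [hzw, hWw] with t h1 h2
    rw [h1]
    change (W t : X Ω).fst = _
    rw [h2]
  · rw [hz t ht]
    congr 2
    refine intervalIntegral.integral_congr_ae ?_
    have hsub : uIoc 0 t ⊆ Ioc 0 T := by
      rw [uIoc_of_le ht.1]
      exact Ioc_subset_Ioc_right ht.2
    rw [← ae_restrict_iff' measurableSet_uIoc]
    refine ae_restrict_of_ae_restrict_of_subset hsub ?_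
    filter_upwards [hF, hWw] with s h1 h2
    rw [hhg, h1 _ h2]

theorem energyIdentity_of_weak {Ω : Set E} (hΩ : IsOpen Ω) {b : E → E} {D : E → M} {C ν T : ℝ}
    (hT : 0 < T) (hC : 0 ≤ C) (hb : MemLp b ⊤ (volume.restrict Ω))
    (hDC : ∀ᵐ x ∂volume.restrict Ω, ‖D x‖ ≤ C) (hD2 : MemLp D 2 (volume.restrict Ω))
    (hdiv : ∀ ψ : E → ℝ, ContDiff ℝ ∞ ψ → HasCompactSupport ψ → tsupport ψ ⊆ Ω →
      ∫ x in Ω, fderiv ℝ ψ x (b x) = 0)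
    (hbD : ∀ v ∈ V Ω, ∫ x in Ω, ⟪conv b D x, v.fst x⟫ = 0)
    {f : ℝ → L2 Ω E} {w₀ : L2 Ω E} {w : ℝ → X Ω}
    (hf : MemLp f 2 (timeMeas T))
    (hw₀ : w₀ ∈ closure (range fun p : V Ω => (p : X Ω).fst))
    (hw : MemLp w 2 (timeMeas T)) (hwV : ∀ᵐ t ∂timeMeas T, w t ∈ V Ω)
    {g : ℝ → StrongDual ℝ (V Ω)} (hg : MemLp g 2 (timeMeas T))
    (hwg : ∀ᵐ t ∂timeMeas T, ∀ v : V Ω,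
      ⟪(w t).fst - w₀, (v : X Ω).fst⟫ = ∫ s in (0 : ℝ)..t, g s v)
    (heq : ∀ᵐ t ∂timeMeas T, ∀ v : V Ω,
      g t v
        + (∫ x in Ω, ⟪conv (fun y => b y + (w t).fst y) (fun y => D y + (w t).snd y) x,
            (v : X Ω).fst x⟫)
        + ν * (∫ x in Ω, ⟪D x + (w t).snd x, (v : X Ω).snd x⟫)
      = ⟪f t, (v : X Ω).fst⟫) :
    EnergyIntegrable Ω T D f w ∧
      ∃ wbar : ℝ → L2 Ω E, ContinuousOn wbar (Icc 0 T) ∧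
        (∀ᵐ t ∂timeMeas T, wbar t = (w t).fst) ∧ wbar 0 = w₀ ∧
        ∀ t ∈ Icc 0 T, EnergyIdentity Ω ν t D f w₀ w (wbar t) := by
  obtain ⟨A, hAc, hA, hAn⟩ := exists_convOp hC hD2.1 hDC
  have hQ := fun t => integrable_and_integral_inner_eq (u := (w t).fst) (hA (w t).fst)
  have hDD := fun t => integrable_and_integral_inner_eq (u := (w t).snd) hD2.coeFn_toLp
  set D2 : L2 Ω M := hD2.toLp D with hD2def
  have hfst : MemLp (fun t => (w t).fst) 2 (timeMeas T) :=
    (WithLp.fstL 2 ℝ (L2 Ω E) (L2 Ω M)).comp_memLp' hw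
  have hsnd : MemLp (fun t => (w t).snd) 2 (timeMeas T) :=
    (WithLp.sndL 2 ℝ (L2 Ω E) (L2 Ω M)).comp_memLp' hw
  have hAw : MemLp (fun t => A (w t).fst) 2 (timeMeas T) :=
    hfst.of_le_mul (hAc.comp_aestronglyMeasurable hfst.1) (Eventually.of_forall fun t => hAn _)
  have hiQ : Integrable (fun t => ⟪A (w t).fst, (w t).fst⟫) (timeMeas T) :=
    integrable_inner_of_memLp hAw hfst
  have hiD : Integrable (fun t => ⟪D2, (w t).snd⟫) (timeMeas T) :=
    integrable_inner_of_memLp (memLp_const D2) hsnd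
  have hif : Integrable (fun t => ⟪f t, (w t).fst⟫) (timeMeas T) :=
    integrable_inner_of_memLp hf hfst
  have hin : Integrable (fun t => ‖(w t).snd‖ ^ 2) (timeMeas T) := hsnd.integrable_norm_pow two_ne_zero
  have hInt : EnergyIntegrable Ω T D f w := by
    refine ⟨Eventually.of_forall fun t => ⟨(hQ t).1, (hDD t).1⟩, ?_⟩
    simp only [intervalIntegrable_iff_integrableOn_Ioc_of_le hT.le, (hQ _).2, (hDD _).2]
    exact ⟨hin, hiQ, hiD, hif⟩
  refine ⟨hInt, ?_⟩
  -- The exceptional null set of times does not depend on the test field, so at almost every time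
  -- the equation may be tested with `w s` itself.
  have key : ∀ᵐ s ∂timeMeas T, ∀ v : V Ω, (v : X Ω) = w s → g s v = ⟪f s, (w s).fst⟫ -
      (∫ x in Ω, ⟪conv (w s).fst D x, (w s).fst x⟫) -
      ν * (∫ x in Ω, ⟪D x, (w s).snd x⟫) - ν * ‖(w s).snd‖ ^ 2 := by
    filter_upwards [heq, hwV] with s h1 h3 v h2
    have h4 := h1 v
    rw [h2, integral_conv_background hΩ.measurableSet hb
      (memLp_top_of_bound hD2.1 C hDC) hD2 hdiv hbD h3] at h4
    have h5 : ∫ x in Ω, ⟪D x + (w s).snd x, (w s).snd x⟫ =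
        (∫ x in Ω, ⟪D x, (w s).snd x⟫) + ‖(w s).snd‖ ^ 2 := by
      rw [← real_inner_self_eq_norm_sq, L2.inner_def,
        ← integral_add (hDD s).1 (L2.integrable_inner _ _)]
      simp only [inner_add_left]
    rw [h5] at h4
    linarith
  obtain ⟨z, hzc, hzw, hz0, hz⟩ := norm_sq_eq_of_weak_deriv hΩ hT hw₀ hw hwV hg hwg key
  refine ⟨z, hzc, hzw, hz0, fun t ht => ?_⟩
  have h6 := integral_eq_combination (ν := ν) hif
    (hiQ.congr (Eventually.of_forall fun s => (hQ s).2.symm))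
    (hiD.congr (Eventually.of_forall fun s => (hDD s).2.symm)) hin
    (Eventually.of_forall fun s => rfl) ht
  rw [EnergyIdentity, hz t ht, h6]
  ring

/-! ### The energy bound -/

/-- Gronwall's lemma bounds the right-hand side of the integral inequality, not only `y`, because
the dissipation integral has to be estimated along with `y`. The right-hand side times `exp (-k t)`
is nonincreasing. -/
theorem le_mul_exp_of_le_add_integral {y : ℝ → ℝ} {A k T : ℝ} (hk : 0 ≤ k)
    (hy : ContinuousOn y (Icc 0 T)) (hA : ∀ s ∈ Icc 0 T, y s ≤ A + k * ∫ r in (0 : ℝ)..s, y r)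
    {t : ℝ} (ht : t ∈ Icc 0 T) : A + k * ∫ r in (0 : ℝ)..t, y r ≤ A * Real.exp (k * t) := by
  have hT : 0 ≤ T := ht.1.trans ht.2
  have hint : IntervalIntegrable y volume 0 T :=
    ContinuousOn.intervalIntegrable (by rwa [uIcc_of_le hT])
  have hd : ∀ s ∈ Ioo 0 T, HasDerivAt (fun s => (A + k * ∫ r in (0 : ℝ)..s, y r) * Real.exp (-k * s))
      (k * y s * Real.exp (-k * s) +
        (A + k * ∫ r in (0 : ℝ)..s, y r) * (Real.exp (-k * s) * (-k))) s := by
    intro s hs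
    have h1 : HasDerivAt (fun s => ∫ r in (0 : ℝ)..s, y r) (y s) s := by
      refine intervalIntegral.integral_hasDerivAt_right
        (hint.mono_set (by rw [uIcc_of_le hs.1.le, uIcc_of_le hT]; exact Icc_subset_Icc_right hs.2.le))
        ?_ (hy.continuousAt (Icc_mem_nhds hs.1 hs.2))
      exact (hy.mono Ioo_subset_Icc_self).stronglyMeasurableAtFilter isOpen_Ioo s hs
    have h2 : HasDerivAt (fun s => Real.exp (-k * s)) (Real.exp (-k * s) * (-k)) s := by
      simpa using ((hasDerivAt_id s).const_mul (-k)).exp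
    exact ((h1.const_mul k).const_add A).mul h2
  have hcont : ContinuousOn (fun s => (A + k * ∫ r in (0 : ℝ)..s, y r) * Real.exp (-k * s))
      (Icc 0 T) := by
    refine ContinuousOn.mul (continuousOn_const.add (continuousOn_const.mul ?_)) (by fun_prop)
    have := intervalIntegral.continuousOn_primitive_interval (μ := volume) (f := y) (a := 0) (b := T)
      (by rw [uIcc_of_le hT]; exact hy.integrableOn_Icc)
    rwa [uIcc_of_le hT] at this
  have hanti := antitoneOn_of_deriv_nonpos (convex_Icc 0 T) hcont
    (by
      rw [interior_Icc]
      exact fun s hs => (hd s hs).differentiableAt.differentiableWithinAt)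
    (by
      rw [interior_Icc]
      intro s hs
      rw [(hd s hs).deriv]
      have h1 := hA s (Ioo_subset_Icc_self hs)
      have h2 := mul_le_mul_of_nonneg_left h1 (mul_nonneg hk (Real.exp_pos (-k * s)).le)
      linarith)
  have h3 := hanti (left_mem_Icc.2 hT) ht ht.1
  simp only [intervalIntegral.integral_same, mul_zero, add_zero, Real.exp_zero, mul_one] at h3
  have h4 : Real.exp (-k * t) * Real.exp (k * t) = 1 := by
    rw [← Real.exp_add]
    simp
  calc A + k * ∫ r in (0 : ℝ)..t, y r
      = (A + k * ∫ r in (0 : ℝ)..t, y r) * Real.exp (-k * t) * Real.exp (k * t) := by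
        rw [mul_assoc, h4, mul_one]
    _ ≤ A * Real.exp (k * t) := by gcongr

/-- The convective term is at most `2 C ‖w‖²`. Young's inequality splits the viscous term into `ν d²
+ ν ‖∇w‖²`, the latter absorbed by half of the dissipation, and the force term into `‖f‖² + ‖w‖²`.
Gronwall's lemma then applies with rate `2 C + 1`. -/
theorem energyBound_of_energyIdentity {Ω : Set E} {D : E → M} {B C m ν T : ℝ} (hT : 0 < T)
    (hν : 0 < ν) (hC : 0 ≤ C) (hDC : ∀ᵐ x ∂volume.restrict Ω, ‖D x‖ ≤ C)
    (hD2 : MemLp D 2 (volume.restrict Ω)) (hB1 : 2 * C ≤ B * |m|)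
    (hB2 : ‖hD2.toLp D‖ ^ 2 ≤ B * m ^ 2)
    {f : ℝ → L2 Ω E} {w₀ : L2 Ω E} {w : ℝ → X Ω} (hf : MemLp f 2 (timeMeas T))
    (hint : EnergyIntegrable Ω T D f w) {wbar : ℝ → L2 Ω E} (hc : ContinuousOn wbar (Icc 0 T))
    (hwbar : ∀ᵐ t ∂timeMeas T, wbar t = (w t).fst)
    (hid : ∀ t ∈ Icc 0 T, EnergyIdentity Ω ν t D f w₀ w (wbar t)) {t : ℝ} (ht : t ∈ Icc 0 T) :
    EnergyBound Ω B m ν t f w₀ w (wbar t) := by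
  obtain ⟨A, -, hA, hAn⟩ := exists_convOp hC hD2.1 hDC
  obtain ⟨-, hin, hiQ, hiD, hif⟩ := hint
  have hff : IntervalIntegrable (fun s => ‖f s‖ ^ 2) volume 0 T :=
    (intervalIntegrable_iff_integrableOn_Ioc_of_le hT.le).2 (hf.integrable_norm_pow two_ne_zero)
  have hyc : ContinuousOn (fun s => ‖wbar s‖ ^ 2) (Icc 0 T) := hc.norm.pow 2
  have hy : IntervalIntegrable (fun s => ‖wbar s‖ ^ 2) volume 0 T :=
    ContinuousOn.intervalIntegrable (by rwa [uIcc_of_le hT.le])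
  set d := ‖hD2.toLp D‖ with hd
  have hmono : ∀ {F : ℝ → ℝ}, IntervalIntegrable F volume 0 T → ∀ {s : ℝ}, s ∈ Icc 0 T →
      IntervalIntegrable F volume 0 s := fun hF s hs =>
    hF.mono_set (by rw [uIcc_of_le hs.1, uIcc_of_le hT.le]; exact Icc_subset_Icc_right hs.2)
  have step : ∀ s ∈ Icc 0 T, ‖wbar s‖ ^ 2 + ν * (∫ r in (0 : ℝ)..s, ‖(w r).snd‖ ^ 2) ≤
      ‖w₀‖ ^ 2 + d ^ 2 * ν * s + (∫ r in (0 : ℝ)..s, ‖f r‖ ^ 2) +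
        (2 * C + 1) * ∫ r in (0 : ℝ)..s, ‖wbar r‖ ^ 2 := by
    intro s hs
    have h1 := hid s hs
    rw [EnergyIdentity] at h1
    have hle : (∫ r in (0 : ℝ)..s, ((-2) * (∫ x in Ω, ⟪conv (w r).fst D x, (w r).fst x⟫)
        + (-(2 * ν)) * (∫ x in Ω, ⟪D x, (w r).snd x⟫) + 2 * ⟪f r, (w r).fst⟫)) ≤
        ∫ r in (0 : ℝ)..s, ((2 * C + 1) * ‖wbar r‖ ^ 2 + (ν * d ^ 2 + ν * ‖(w r).snd‖ ^ 2)
          + ‖f r‖ ^ 2) := by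
      refine intervalIntegral.integral_mono_ae_restrict hs.1 ?_ ?_ ?_
      · exact (((hmono hiQ hs).const_mul (-2)).add ((hmono hiD hs).const_mul (-(2 * ν)))).add
          ((hmono hif hs).const_mul 2)
      · exact (((hmono hy hs).const_mul _).add
          (intervalIntegrable_const.add ((hmono hin hs).const_mul ν))).add (hmono hff hs)
      · have h2 : ∀ᵐ r ∂volume.restrict (Icc 0 s), wbar r = (w r).fst := by
          rw [← restrict_Ioc_eq_restrict_Icc]
          exact ae_restrict_of_ae_restrict_of_subset (Ioc_subset_Ioc_right hs.2) hwbar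
        filter_upwards [h2] with r hr
        have e1 := (integrable_and_integral_inner_eq (u := (w r).fst) (hA (w r).fst)).2
        have e2 := (integrable_and_integral_inner_eq (u := (w r).snd) hD2.coeFn_toLp).2
        rw [e1, e2, hr]
        have i1 := (abs_le.1 (abs_real_inner_le_norm (A (w r).fst) (w r).fst)).1
        have i2 := (abs_le.1 (abs_real_inner_le_norm (hD2.toLp D) (w r).snd)).1
        have i3 := real_inner_le_norm (f r) (w r).fst
        have i4 := mul_le_mul_of_nonneg_right (hAn (w r).fst) (norm_nonneg (w r).fst)
        have i5 := mul_le_mul_of_nonneg_left (two_mul_le_add_sq d ‖(w r).snd‖) hν.le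
        have i6 := two_mul_le_add_sq ‖f r‖ ‖(w r).fst‖
        have i7 := mul_le_mul_of_nonneg_left i2 hν.le
        rw [← hd] at i7
        linarith
    rw [intervalIntegral.integral_add (((hmono hiQ hs).const_mul (-2)).add
        ((hmono hiD hs).const_mul (-(2 * ν)))) ((hmono hif hs).const_mul 2),
      intervalIntegral.integral_add ((hmono hiQ hs).const_mul (-2))
        ((hmono hiD hs).const_mul (-(2 * ν))),
      intervalIntegral.integral_add (((hmono hy hs).const_mul _).add
          (intervalIntegrable_const.add ((hmono hin hs).const_mul ν))) (hmono hff hs),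
      intervalIntegral.integral_add ((hmono hy hs).const_mul _)
          (intervalIntegrable_const.add ((hmono hin hs).const_mul ν)),
      intervalIntegral.integral_add intervalIntegrable_const ((hmono hin hs).const_mul ν)] at hle
    simp only [intervalIntegral.integral_const_mul, intervalIntegral.integral_const,
      smul_eq_mul] at hle
    linarith
  have hF0 : ∀ s, 0 ≤ s → 0 ≤ ∫ r in (0 : ℝ)..s, ‖f r‖ ^ 2 := fun s hs =>
    intervalIntegral.integral_nonneg hs fun r _ => by positivity
  -- The data are frozen at the final time `t`; they increase with time, so on the interval from 0
  -- to `t` the inequality has a constant forcing term.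
  set A₀ := ‖w₀‖ ^ 2 + d ^ 2 * ν * t + ∫ r in (0 : ℝ)..t, ‖f r‖ ^ 2 with hA₀
  have hgr := le_mul_exp_of_le_add_integral (A := A₀) (k := 2 * C + 1) (T := t)
    (y := fun s => ‖wbar s‖ ^ 2) (by positivity) (hyc.mono (Icc_subset_Icc_right ht.2))
    (fun s hs => by
      have hsT : s ∈ Icc 0 T := ⟨hs.1, hs.2.trans ht.2⟩
      have h1 := step s hsT
      have h2 : 0 ≤ ν * ∫ r in (0 : ℝ)..s, ‖(w r).snd‖ ^ 2 :=
        mul_nonneg hν.le (intervalIntegral.integral_nonneg hs.1 fun r _ => by positivity)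
      have h3 : ∫ r in (0 : ℝ)..s, ‖f r‖ ^ 2 ≤ ∫ r in (0 : ℝ)..t, ‖f r‖ ^ 2 :=
        intervalIntegral.integral_mono_interval le_rfl hs.1 hs.2
          (Eventually.of_forall fun r => by positivity) (hmono hff ht)
      have h4 : d ^ 2 * ν * s ≤ d ^ 2 * ν * t :=
        mul_le_mul_of_nonneg_left hs.2 (by positivity)
      simp only [hA₀]
      linarith) (right_mem_Icc.2 ht.1)
  have hst := step t ht
  rw [EnergyBound]
  have hA0 : A₀ ≤ ‖w₀‖ ^ 2 + B * m ^ 2 * ν * t + ∫ r in (0 : ℝ)..t, ‖f r‖ ^ 2 := by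
    have : d ^ 2 * ν * t ≤ B * m ^ 2 * ν * t := by
      have := ht.1
      gcongr
    linarith
  have hA00 : 0 ≤ A₀ := by
    have h1 := hF0 t ht.1
    have h2 := ht.1
    positivity
  calc _ ≤ A₀ * Real.exp ((2 * C + 1) * t) := hst.trans hgr
    _ ≤ _ := by
      have := ht.1
      have := hA00.trans hA0
      gcongr

/-! ### Square integrability in time of the velocity in the plane -/

theorem integrable_norm_of_memLp_two {F : Type*} [NormedAddCommGroup F] {T : ℝ} {g : ℝ → F}
    (hg : MemLp g 2 (timeMeas T)) : Integrable (fun s => ‖g s‖) (timeMeas T) :=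
  (hg.integrable one_le_two).norm

/-- In the plane only the gradient is assumed square integrable in time. Pairing the integrated
equation with `w t` bounds `‖w‖²` in `L²` by `‖w₀‖ ‖w‖` plus `K` times the `H¹` norm, where `K` is
the time integral of `‖g‖`. Young's inequality then controls the full norm by a constant and the
gradient. -/
theorem memLp_of_weak_deriv {Ω : Set E} {T : ℝ} {w₀ : L2 Ω E} {w : ℝ → X Ω}
    (hw : AEStronglyMeasurable w (timeMeas T)) (hsnd : MemLp (fun t => (w t).snd) 2 (timeMeas T))
    (hwV : ∀ᵐ t ∂timeMeas T, w t ∈ V Ω) {g : ℝ → StrongDual ℝ (V Ω)}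
    (hg : MemLp g 2 (timeMeas T))
    (hwg : ∀ᵐ t ∂timeMeas T, ∀ v : V Ω,
      ⟪(w t).fst - w₀, (v : X Ω).fst⟫ = ∫ s in (0 : ℝ)..t, g s v) :
    MemLp w 2 (timeMeas T) := by
  have hgi : Integrable (fun s => ‖g s‖) (timeMeas T) :=
    integrable_norm_of_memLp_two (F := StrongDual ℝ (V Ω)) (g := g) hg
  set K := ∫ s in Ioc 0 T, ‖g s‖ with hK
  have hK0 : 0 ≤ K := integral_nonneg fun s => norm_nonneg (g s)
  have hbound : ∀ t ∈ Ioc 0 T, ∀ v : V Ω, ∫ s in (0 : ℝ)..t, g s v ≤ K * ‖v‖ := by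
    intro t ht v
    refine (le_abs_self _).trans ?_
    rw [← Real.norm_eq_abs]
    refine (intervalIntegral.norm_integral_le_integral_norm_uIoc).trans ?_
    rw [uIoc_of_le ht.1.le]
    calc ∫ s in Ioc 0 t, ‖g s v‖ ≤ ∫ s in Ioc 0 t, ‖g s‖ * ‖v‖ :=
          integral_mono_of_nonneg (Eventually.of_forall fun s => norm_nonneg _)
            ((IntegrableOn.mono_set hgi (Ioc_subset_Ioc_right ht.2)).mul_const _)
            (Eventually.of_forall fun s => (g s).le_opNorm v)
      _ ≤ ∫ s in Ioc 0 T, ‖g s‖ * ‖v‖ :=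
          setIntegral_mono_set (hgi.mul_const _) (Eventually.of_forall fun s => by
            change 0 ≤ ‖g s‖ * ‖v‖
            positivity) (Ioc_subset_Ioc_right ht.2).eventuallyLE
      _ = K * ‖v‖ := by rw [integral_mul_const]
  refine ((memLp_const (‖w₀‖ + 2 * K)).add (hsnd.norm.const_mul 2)).of_le hw ?_
  filter_upwards [hwV, hwg, ae_restrict_mem measurableSet_Ioc] with t h1 h2 h3
  have h4 := h2 ⟨w t, h1⟩
  have h5 := hbound t h3 ⟨w t, h1⟩
  rw [← h4, inner_sub_left, real_inner_self_eq_norm_sq] at h5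
  have h6 := real_inner_le_norm w₀ (w t).fst
  have h7 := WithLp.prod_norm_sq_eq_of_L2 (w t)
  change ‖w t‖ ^ 2 = ‖(w t).fst‖ ^ 2 + ‖(w t).snd‖ ^ 2 at h7
  change ‖(w t).fst‖ ^ 2 - ⟪w₀, (w t).fst⟫ ≤ K * ‖w t‖ at h5
  have h8 : ‖w t‖ ≤ ‖(w t).fst‖ + ‖(w t).snd‖ := by
    refine le_of_sq_le_sq ?_ (by positivity)
    nlinarith [mul_nonneg (norm_nonneg (w t).fst) (norm_nonneg (w t).snd)]
  have h9 := mul_le_mul_of_nonneg_left h8 hK0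
  change ‖w t‖ ≤ |‖w₀‖ + 2 * K + 2 * ‖(w t).snd‖|
  refine (le_of_sq_le_sq ?_ (by positivity)).trans (le_abs_self _)
  rw [h7]
  have h10 := norm_nonneg (w t).snd
  have h11 := norm_nonneg w₀
  nlinarith [sq_nonneg (‖(w t).fst‖ - (‖w₀‖ + K)), sq_nonneg (‖(w t).snd‖ - K),
    mul_nonneg h11 h10, mul_nonneg hK0 h10, mul_nonneg h11 hK0]

/-! ### The two settings -/

theorem inner_idM (A : M) : ⟪A, idM⟫ = traceL A := by
  rw [PiLp.inner_apply, Fintype.sum_prod_type, traceL_apply]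
  simp [Fin.sum_univ_two, idM]

/-- The divergence of `ψ b` is `∇ψ·b`, and it integrates to zero. A direct argument is needed in the
plane because `σₘ` decays only like `1 / r` and so need not be square integrable. -/
theorem integral_fderiv_apply_eq_zero_of_traceL {b : E → E} (hb : ContDiff ℝ 1 b)
    (ht : ∀ x, traceL (grad b x) = 0) {ψ : E → ℝ} (hψ : ContDiff ℝ ∞ ψ)
    (hc : HasCompactSupport ψ) : ∫ x, fderiv ℝ ψ x (b x) = 0 := by
  have hψ1 : ContDiff ℝ 1 ψ := hψ.of_le (by simp)
  have h := integral_inner_grad_eq_neg (hψ1.smul hb) (hc.smul_right (f' := b))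
    (K := fun _ => idM) contDiff_const
  have h0 : ∀ x, divM (fun _ : E => idM) x = 0 := fun x => by
    ext j
    simp [divM]
  simp only [h0, inner_zero_right, integral_zero, neg_zero] at h
  rw [← h]
  refine integral_congr_ae (Eventually.of_forall fun x => ?_)
  beta_reduce
  rw [inner_idM, ← gradL_fderiv, ((hψ1.differentiable one_ne_zero x).hasFDerivAt.smul
      (hb.differentiable one_ne_zero x).hasFDerivAt).fderiv, map_add, map_add, map_smul, map_smul,
    gradL_fderiv, ht, smul_zero, zero_add, traceL_gradL_smulRight]

theorem energy_plane {b : E → E} (hb : ContDiff ℝ 1 b) (ht : ∀ x, traceL (grad b x) = 0)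
    (hb' : MemLp b ⊤ volume) {C B m ν T : ℝ} (hT : 0 < T) (hν : 0 < ν) (hC : 0 ≤ C)
    (hDC : ∀ x, ‖grad b x‖ ≤ C) (hD2 : MemLp (grad b) 2 volume)
    (hbD : ∀ v ∈ V univ, ∫ x in univ, ⟪conv b (grad b) x, v.fst x⟫ = 0)
    (hB1 : 2 * C ≤ B * |m|) (hB2 : (eLpNorm (grad b) 2 volume).toReal ^ 2 ≤ B * m ^ 2)
    {f : ℝ → L2 univ E} {w₀ : L2 univ E} {w : ℝ → X univ}
    (h : IsWeakNS univ b (grad b) ν T f w₀ w)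
    (hsnd : MemLp (fun t => (w t).snd) 2 (timeMeas T)) :
    EnergyIntegrable univ T (grad b) f w ∧
      ∃ wbar : ℝ → L2 univ E, ContinuousOn wbar (Icc 0 T) ∧
        (∀ᵐ t ∂timeMeas T, wbar t = (w t).fst) ∧ wbar 0 = w₀ ∧
        ∀ t ∈ Icc 0 T, EnergyIdentity univ ν t (grad b) f w₀ w (wbar t) ∧
          EnergyBound univ B m ν t f w₀ w (wbar t) := by
  obtain ⟨g, hg, hwg, heq⟩ := h.eqn
  have hw := memLp_of_weak_deriv h.meas hsnd h.mem_V hg hwg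
  have hD2' : MemLp (grad b) 2 (volume.restrict univ) := hD2.restrict univ
  have hDC' : ∀ᵐ x ∂volume.restrict univ, ‖grad b x‖ ≤ C := Eventually.of_forall hDC
  obtain ⟨hint, wbar, hc, hwbar, h0, hid⟩ := energyIdentity_of_weak isOpen_univ hT hC
    (hb'.restrict univ) hDC' hD2'
    (fun ψ hψ hψc _ => by
      rw [Measure.restrict_univ]
      exact integral_fderiv_apply_eq_zero_of_traceL hb ht hψ hψc)
    hbD h.force_memLp h.init_mem.mem_closure_univ hw h.mem_V hg hwg heq
  refine ⟨hint, wbar, hc, hwbar, h0, fun t ht => ⟨hid t ht, ?_⟩⟩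
  refine energyBound_of_energyIdentity hT hν hC hDC' hD2' hB1 ?_ h.force_memLp hint hc hwbar hid ht
  rwa [Lp.norm_toLp, Measure.restrict_univ]

/-- Here the background lies in `V` and does not depend on time, so `u - q` is again a curve in `V`
with the same time derivative, and its initial value is still in the closure of `V`. -/
theorem energy_disk {Ω : Set E} (hΩ : IsOpen Ω) {q : X Ω} (hq : q ∈ V Ω)
    (hb : MemLp q.fst ⊤ (volume.restrict Ω)) {C B m ν T : ℝ} (hT : 0 < T) (hν : 0 < ν)
    (hC : 0 ≤ C) (hDC : ∀ᵐ x ∂volume.restrict Ω, ‖q.snd x‖ ≤ C)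
    (hbD : ∀ v ∈ V Ω, ∫ x in Ω, ⟪conv q.fst q.snd x, v.fst x⟫ = 0)
    (hB1 : 2 * C ≤ B * |m|) (hB2 : ‖q.snd‖ ^ 2 ≤ B * m ^ 2)
    {f : ℝ → L2 Ω E} {u₀ : L2 Ω E} {u : ℝ → X Ω}
    (hu₀ : u₀ ∈ closure (range fun p : V Ω => (p : X Ω).fst))
    (h : IsWeakNS Ω (fun _ => 0) (fun _ => 0) ν T f u₀ u) (hu : MemLp u 2 (timeMeas T)) :
    EnergyIntegrable Ω T q.snd f (fun s => u s - q) ∧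
      ∃ ubar : ℝ → L2 Ω E, ContinuousOn ubar (Icc 0 T) ∧
        (∀ᵐ t ∂timeMeas T, ubar t = (u t).fst) ∧ ubar 0 = u₀ ∧
        ∀ t ∈ Icc 0 T,
          EnergyIdentity Ω ν t q.snd f (u₀ - q.fst) (fun s => u s - q) (ubar t - q.fst) ∧
          EnergyBound Ω B m ν t f (u₀ - q.fst) (fun s => u s - q) (ubar t - q.fst) := by
  obtain ⟨g, hg, hwg, heq⟩ := h.eqn
  have hcl : u₀ - q.fst ∈ closure (range fun p : V Ω => (p : X Ω).fst) := by
    refine map_mem_closure (f := fun x => x - q.fst) (continuous_sub_right q.fst) hu₀ ?_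
    rintro _ ⟨p, rfl⟩
    exact ⟨p - ⟨q, hq⟩, rfl⟩
  obtain ⟨hint, wbar, hc, hwbar, h0, hid⟩ := energyIdentity_of_weak hΩ hT hC hb hDC
    (Lp.memLp q.snd) (ν := ν) (g := g) (w := fun s => u s - q)
    (fun ψ hψ hψc _ => integral_fderiv_apply_eq_zero (hψ.of_le (by simp))
      ((hψ.continuous.memLp_of_hasCompactSupport hψc).restrict Ω)
      (((hψ.continuous_fderiv (by simp)).memLp_of_hasCompactSupport (hψc.fderiv ℝ)).restrict Ω) hq)
    hbD h.force_memLp hcl (hu.sub (memLp_const q))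
    (h.mem_V.mono fun t ht => (V Ω).sub_mem ht hq) hg
    (hwg.mono fun t ht v => by
      rw [← ht v, WithLp.sub_fst, sub_sub_sub_cancel_right])
    (heq.mono fun t ht v => by
      rw [← ht v]
      have e1 : (fun x => q.fst x + (u t - q).fst x) =ᵐ[volume.restrict Ω] fun x =>
          0 + (u t).fst x := by
        filter_upwards [Lp.coeFn_sub (u t).fst q.fst] with x hx
        rw [WithLp.sub_fst, hx, Pi.sub_apply]
        abel
      have e2 : (fun x => q.snd x + (u t - q).snd x) =ᵐ[volume.restrict Ω] fun x =>
          0 + (u t).snd x := by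
        filter_upwards [Lp.coeFn_sub (u t).snd q.snd] with x hx
        rw [WithLp.sub_snd, hx, Pi.sub_apply]
        abel
      refine congrArg₂ (· + ·) (congrArg₂ (· + ·) rfl (integral_congr_ae ?_))
        (congrArg (ν * ·) (integral_congr_ae ?_))
      · filter_upwards [e1, e2] with x h1 h2
        exact congrArg (⟪·, (v : X Ω).fst x⟫) (conv_congr h1 h2)
      · filter_upwards [e2] with x h2
        rw [h2])
  refine ⟨hint, fun t => wbar t + q.fst, hc.add continuousOn_const, ?_, ?_, fun t ht => ?_⟩
  · filter_upwards [hwbar] with t ht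
    rw [ht, WithLp.sub_fst, sub_add_cancel]
  · simp only [h0, sub_add_cancel]
  · rw [add_sub_cancel_right]
    refine ⟨hid t ht, energyBound_of_energyIdentity hT hν hC hDC (Lp.memLp q.snd) hB1 ?_
      h.force_memLp hint hc hwbar hid ht⟩
    rwa [Lp.toLp_coeFn]

/-! ### Rotationally symmetric fields -/

/-- The rotation by a right angle. -/
def rotL : E →L[ℝ] E :=
  LinearMap.toContinuousLinearMap
    { toFun := fun x => WithLp.toLp 2 ![-(x 1), x 0]
      map_add' := fun x y => by
        ext i
        fin_cases i <;> simp
        ring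
      map_smul' := fun c x => by
        ext i
        fin_cases i <;> simp }

theorem rotL_apply (x : E) : rotL x = WithLp.toLp 2 ![-(x 1), x 0] := rfl

theorem rotL_zero_apply (x : E) : rotL x 0 = -(x 1) := rfl

theorem rotL_one_apply (x : E) : rotL x 1 = x 0 := rfl

theorem norm_rotL (x : E) : ‖rotL x‖ = ‖x‖ := norm_rot x

theorem inner_rotL (x : E) : ⟪x, rotL x⟫ = 0 := by
  rw [PiLp.inner_apply, Fin.sum_univ_two, rotL_zero_apply, rotL_one_apply]
  simp
  ring

theorem rotL_rotL (x : E) : rotL (rotL x) = -x := by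
  ext i
  fin_cases i <;> simp [rotL_apply]

/-- The field `β(|x|) x^⊥`. -/
def swirl (β : ℝ → ℝ) (x : E) : E := β ‖x‖ • rotL x

/-- The derivative of `swirl β`, where `β'` is the derivative of `β`. -/
def swirlDeriv (β β' : ℝ → ℝ) (x : E) : E →L[ℝ] E :=
  (β' ‖x‖ * ‖x‖⁻¹) • (innerSL ℝ x).smulRight (rotL x) + β ‖x‖ • rotL

theorem hasFDerivAt_norm_of_ne_zero {x : E} (hx : x ≠ 0) :
    HasFDerivAt (fun y : E => ‖y‖) (‖x‖⁻¹ • innerSL ℝ x) x := by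
  have h1 := (hasStrictFDerivAt_norm_sq x).hasFDerivAt.sqrt (pow_ne_zero 2 (norm_ne_zero_iff.2 hx))
  simp only [Real.sqrt_sq (norm_nonneg _)] at h1
  refine h1.congr_fderiv ?_
  have := norm_ne_zero_iff.2 hx
  ext v
  simp
  field_simp

theorem hasFDerivAt_swirl {β β' : ℝ → ℝ} (hβ : ∀ r, HasDerivAt β (β' r) r)
    (x : E) : HasFDerivAt (swirl β) (swirlDeriv β β' x) x := by
  -- At the origin the norm is not differentiable, but `(β ‖h‖ - β 0) h^⊥` is of smaller order than
  -- `h` by continuity of `β`. The first summand of `swirlDeriv` vanishes there.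
  rcases eq_or_ne x 0 with rfl | hx
  · have h1 : swirlDeriv β β' 0 = β 0 • rotL := by simp [swirlDeriv]
    rw [h1, hasFDerivAt_iff_isLittleO_nhds_zero]
    have h2 : Tendsto (fun h : E => β ‖h‖ - β 0) (𝓝 0) (𝓝 0) := by
      have h3 : Continuous fun h : E => β ‖h‖ - β 0 :=
        ((continuous_iff_continuousAt.2 fun r => (hβ r).continuousAt).comp continuous_norm).sub
          continuous_const
      simpa using h3.tendsto 0
    have h4 : (fun h : E => (β ‖h‖ - β 0) • rotL h) =o[𝓝 0] fun h => h := by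
      have h5 := ((Asymptotics.isLittleO_one_iff ℝ).2 h2).smul_isBigO (rotL.isBigO_id (𝓝 0))
      simpa using h5
    refine h4.congr_left fun h => ?_
    simp [swirl, sub_smul]
  · have h1 := ((hβ ‖x‖).comp_hasFDerivAt x (hasFDerivAt_norm_of_ne_zero hx)).smul
      (rotL.hasFDerivAt (x := x))
    refine h1.congr_fderiv ?_
    ext v : 1
    simp [swirlDeriv, mul_smul]
    rw [add_comm]

theorem contDiff_swirl {β β' : ℝ → ℝ} (hβ : ∀ r, HasDerivAt β (β' r) r)
    (hβ' : Continuous β') : ContDiff ℝ 1 (swirl β) := by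
  refine contDiff_one_iff_hasFDerivAt.2 ⟨swirlDeriv β β', ?_, hasFDerivAt_swirl hβ⟩
  have hβc : Continuous β := continuous_iff_continuousAt.2 fun r => (hβ r).continuousAt
  refine Continuous.add ?_ ((hβc.comp continuous_norm).smul continuous_const)
  have hsm : Continuous fun x : E => (innerSL ℝ x).smulRight (rotL x) :=
    ((ContinuousLinearMap.smulRightL ℝ E E).continuous.comp (innerSL ℝ).continuous).clm_apply
      rotL.continuous
  refine continuous_iff_continuousAt.2 fun x => ?_
  rcases eq_or_ne x 0 with rfl | hx
  · rw [ContinuousAt]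
    have h1 : Tendsto (fun x : E => |β' ‖x‖| * ‖x‖) (𝓝 0) (𝓝 0) := by
      have : Continuous fun x : E => |β' ‖x‖| * ‖x‖ :=
        (hβ'.comp continuous_norm).abs.mul continuous_norm
      simpa using this.tendsto 0
    have h2 : (β' ‖(0 : E)‖ * ‖(0 : E)‖⁻¹) • (innerSL ℝ (0 : E)).smulRight (rotL 0) = 0 := by simp
    rw [h2]
    refine squeeze_zero_norm (fun x => ?_) h1
    rw [norm_smul, ContinuousLinearMap.norm_smulRight_apply, innerSL_apply_norm, norm_rotL,
      norm_mul, norm_inv, norm_norm, Real.norm_eq_abs]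
    rcases eq_or_ne x 0 with rfl | hx
    · simp
    · have := norm_ne_zero_iff.2 hx
      refine le_of_eq ?_
      field_simp
  · exact ((hβ'.comp continuous_norm).continuousAt.mul
      (continuous_norm.continuousAt.inv₀ (norm_ne_zero_iff.2 hx))).smul hsm.continuousAt

theorem grad_swirl_apply {β β' : ℝ → ℝ} (hβ : ∀ r, HasDerivAt β (β' r) r)
    (x : E) (i j : Fin 2) : grad (swirl β) x (i, j) =
    β' ‖x‖ * ‖x‖⁻¹ * x i * rotL x j + β ‖x‖ * rotL (EuclideanSpace.single i 1) j := by
  rw [← gradL_fderiv, (hasFDerivAt_swirl hβ x).fderiv, gradL_apply]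
  simp [swirlDeriv, EuclideanSpace.inner_single_right]
  ring

theorem traceL_grad_swirl {β β' : ℝ → ℝ} (hβ : ∀ r, HasDerivAt β (β' r) r)
    (x : E) : traceL (grad (swirl β) x) = 0 := by
  rw [traceL_apply, grad_swirl_apply hβ, grad_swirl_apply hβ]
  simp [rotL_zero_apply, rotL_one_apply]
  ring

theorem vort_swirl {β β' : ℝ → ℝ} (hβ : ∀ r, HasDerivAt β (β' r) r)
    {x : E} (hx : x ≠ 0) : vort (swirl β) x = ‖x‖ * β' ‖x‖ + 2 * β ‖x‖ := by
  rw [vort, grad_swirl_apply hβ, grad_swirl_apply hβ]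
  have h := norm_sq_E x
  have h0 := norm_ne_zero_iff.2 hx
  simp [rotL_zero_apply, rotL_one_apply]
  field_simp
  linear_combination (-β' ‖x‖) * h

theorem norm_grad_swirl_le {β β' : ℝ → ℝ} (hβ : ∀ r, HasDerivAt β (β' r) r)
    (x : E) :
    ‖grad (swirl β) x‖ ≤ ‖x‖ * |β' ‖x‖| + 2 * |β ‖x‖| := by
  have h1 : grad (swirl β) x = (β' ‖x‖ * ‖x‖⁻¹) • gradL ((innerSL ℝ x).smulRight (rotL x)) +
      β ‖x‖ • gradL rotL := by
    rw [← gradL_fderiv, (hasFDerivAt_swirl hβ x).fderiv, swirlDeriv, map_add, map_smul, map_smul]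
  have h2 : ‖gradL ((innerSL ℝ x).smulRight (rotL x))‖ ≤ ‖x‖ ^ 2 := by
    refine le_of_sq_le_sq ?_ (by positivity)
    rw [norm_sq_M]
    simp only [gradL_apply, ContinuousLinearMap.smulRight_apply, innerSL_apply_apply,
      PiLp.smul_apply, rotL_zero_apply, rotL_one_apply, EuclideanSpace.inner_single_right]
    rw [norm_sq_E]
    simp
    nlinarith
  have h3 : ‖gradL rotL‖ ≤ 2 := by
    refine le_of_sq_le_sq ?_ (by positivity)
    rw [norm_sq_M]
    simp only [gradL_apply, rotL_zero_apply, rotL_one_apply]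
    simp
    norm_num
  rw [h1]
  refine (norm_add_le _ _).trans ?_
  rw [norm_smul, norm_smul, norm_mul, norm_inv, norm_norm, Real.norm_eq_abs, Real.norm_eq_abs]
  refine add_le_add ?_ ?_
  · rcases eq_or_ne x 0 with rfl | hx
    · simp
    · have h0 := norm_ne_zero_iff.2 hx
      calc _ ≤ |β' ‖x‖| * ‖x‖⁻¹ * ‖x‖ ^ 2 := by gcongr
        _ = _ := by field_simp
  · rw [mul_comm 2]
    gcongr

/-- For motion on circles the acceleration is centripetal: `x^⊥` is orthogonal to `∇β(|x|)`, and two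
right-angle rotations give `-x`. -/
theorem conv_swirl {β β' : ℝ → ℝ} (hβ : ∀ r, HasDerivAt β (β' r) r)
    (x : E) : conv (swirl β) (grad (swirl β)) x = -(β ‖x‖ ^ 2) • x := by
  rw [conv_grad, (hasFDerivAt_swirl hβ x).fderiv]
  simp [swirlDeriv, swirl, inner_rotL, rotL_rotL, smul_smul, pow_two]

/-- At the point `(r, 0)` the entry `∂₂ u¹` is exactly `-β r`, because the term with `β'` carries
the factor `x₂ = 0`. In this way the gradient norm controls the angular velocity. -/
theorem abs_le_norm_grad_swirl {β β' : ℝ → ℝ} (hβ : ∀ r, HasDerivAt β (β' r) r) {r : ℝ}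
    (hr : 0 ≤ r) : ∃ x : E, ‖x‖ = r ∧ |β r| ≤ ‖grad (swirl β) x‖ := by
  refine ⟨EuclideanSpace.single 0 r, by simp [abs_of_nonneg hr], ?_⟩
  refine le_trans (le_of_eq ?_) (PiLp.norm_apply_le _ ((1, 0) : Fin 2 × Fin 2))
  rw [grad_swirl_apply hβ]
  simp [rotL_zero_apply, abs_of_nonneg hr]

/-! ### The pressure of a rotationally symmetric field -/

/-- The factor `r` in the derivative cancels the singularity of the gradient of `‖x‖` at the origin.
-/
theorem hasFDerivAt_comp_norm {q k : ℝ → ℝ} (hq : ∀ r, HasDerivAt q (r * k r) r) (x : E) :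
    HasFDerivAt (fun y : E => q ‖y‖) (k ‖x‖ • innerSL ℝ x) x := by
  rcases eq_or_ne x 0 with rfl | hx
  · have h1 := (hq 0).isLittleO
    rw [map_zero, smul_zero]
    have h2 : Tendsto (fun y : E => ‖y‖) (𝓝 0) (𝓝 0) := by
      simpa using (continuous_norm (E := E)).tendsto 0
    refine .of_isLittleO ?_
    have h3 := h1.comp_tendsto h2
    have h4 : (fun y : E => q ‖y‖ - q 0) =o[𝓝 0] fun y : E => ‖y‖ := by
      simpa [Function.comp_def] using h3
    simpa using Asymptotics.isLittleO_norm_right.1 h4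
  · refine ((hq ‖x‖).comp_hasFDerivAt x (hasFDerivAt_norm_of_ne_zero hx)).congr_fderiv ?_
    have := norm_ne_zero_iff.2 hx
    ext v
    simp
    field_simp

/-- The centripetal acceleration is the gradient of the radial pressure `q`, and fields in `V` are
orthogonal to gradients. Hence a swirl is a stationary Euler flow. -/
theorem integral_conv_swirl_eq_zero {β β' q : ℝ → ℝ} (hβ : ∀ r, HasDerivAt β (β' r) r)
    (hq : ∀ r, HasDerivAt q (r * -(β r) ^ 2) r) {Ω : Set E}
    (hq2 : MemLp (fun x : E => q ‖x‖) 2 (volume.restrict Ω))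
    (hβ2 : MemLp (fun x : E => β ‖x‖ ^ 2 * ‖x‖) 2 (volume.restrict Ω)) {v : X Ω} (hv : v ∈ V Ω) :
    ∫ x in Ω, ⟪conv (swirl β) (grad (swirl β)) x, v.fst x⟫ = 0 := by
  have hβc : Continuous β := continuous_iff_continuousAt.2 fun r => (hβ r).continuousAt
  have hd := hasFDerivAt_comp_norm (k := fun r => -(β r) ^ 2) hq
  have hcont : Continuous fun x : E => (-(β ‖x‖) ^ 2) • innerSL ℝ x :=
    ((hβc.comp continuous_norm).pow 2).neg.smul (innerSL ℝ).continuous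
  have hfd : fderiv ℝ (fun x : E => q ‖x‖) = fun x => (-(β ‖x‖) ^ 2) • innerSL ℝ x :=
    funext fun x => (hd x).fderiv
  rw [← integral_fderiv_apply_eq_zero (contDiff_one_iff_hasFDerivAt.2 ⟨_, hcont, hd⟩) hq2
    (by
      rw [hfd]
      refine hβ2.of_le hcont.aestronglyMeasurable (Eventually.of_forall fun x => ?_)
      rw [norm_smul, innerSL_apply_norm, norm_neg, norm_mul, norm_norm]) hv]
  refine integral_congr_ae (Eventually.of_forall fun x => ?_)
  beta_reduce
  rw [conv_swirl hβ, (hd x).fderiv]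
  simp [inner_smul_left]

theorem exists_pressure {β : ℝ → ℝ} (hβ : Continuous β) (κ : ℝ) :
    ∀ r, HasDerivAt (fun r => κ + ∫ ρ in (0 : ℝ)..r, ρ * -(β ρ) ^ 2) (r * -(β r) ^ 2) r := fun r => by
  have hc : Continuous fun ρ => ρ * -(β ρ) ^ 2 := by fun_prop
  exact (intervalIntegral.integral_hasDerivAt_right (hc.intervalIntegrable _ _)
    (hc.stronglyMeasurableAtFilter _ _) hc.continuousAt).const_add κ

/-! ### The field `σ₁` -/

/-- The angular velocity of `σ₁`: `σ₁(x) = S(|x|) x^⊥`. -/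
def Profile.S (P : Profile) (r : ℝ) : ℝ := ∫ s in (0 : ℝ)..1, s * P.g (r * s)

/-- The derivative of the angular velocity. -/
def Profile.dS (P : Profile) (r : ℝ) : ℝ := ∫ s in (0 : ℝ)..1, s * (s * deriv P.g (r * s))

theorem sigma_eq_swirl (P : Profile) : sigma P.g = swirl P.S := funext fun x => sigma_eq P.g x

theorem sig_eq_swirl (P : Profile) (m : ℝ) : P.sig m = swirl fun r => m * P.S r := by
  ext1 x
  rw [Profile.sig, sigma_eq_swirl, swirl, swirl, smul_smul]

theorem continuous_dS (P : Profile) : Continuous P.dS := by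
  have h : Continuous (deriv P.g) := P.smooth.continuous_deriv (by simp)
  exact intervalIntegral.continuous_parametric_intervalIntegral_of_continuous'
    (f := fun r s : ℝ => s * (s * deriv P.g (r * s))) (by fun_prop) 0 1

theorem hasDerivAt_S (P : Profile) (r : ℝ) : HasDerivAt P.S (P.dS r) r := by
  have hg : Continuous P.g := P.smooth.continuous
  have hg' : Continuous (deriv P.g) := P.smooth.continuous_deriv (by simp)
  obtain ⟨C, hC⟩ := P.compact.deriv.exists_bound_of_continuous hg'
  refine (intervalIntegral.hasDerivAt_integral_of_dominated_loc_of_deriv_le (a := 0) (b := 1)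
    (F := fun r s : ℝ => s * P.g (r * s)) (F' := fun r s => s * (s * deriv P.g (r * s)))
    (bound := fun _ => C) univ_mem
    (Eventually.of_forall fun r => ?_) ?_ ?_ ?_ intervalIntegrable_const ?_).2
  · exact (by fun_prop : Continuous fun s : ℝ => s * P.g (r * s)).aestronglyMeasurable
  · exact (by fun_prop : Continuous fun s : ℝ => s * P.g (r * s)).intervalIntegrable _ _
  · exact (by fun_prop : Continuous fun s : ℝ =>
      s * (s * deriv P.g (r * s))).aestronglyMeasurable
  · refine Eventually.of_forall fun s hs r _ => ?_
    rw [uIoc_of_le zero_le_one] at hs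
    have h1 := hC (r * s)
    rw [norm_mul, norm_mul, Real.norm_of_nonneg hs.1.le]
    have h2 := norm_nonneg (deriv P.g (r * s))
    have h3 : s * ‖deriv P.g (r * s)‖ ≤ C := by nlinarith [hs.1, hs.2]
    nlinarith [hs.1, hs.2, mul_nonneg hs.1.le h2]
  · refine Eventually.of_forall fun s _ r _ => ?_
    have h1 := (P.smooth.differentiable (by simp) (r * s)).hasDerivAt.comp r
      ((hasDerivAt_id r).mul_const s)
    have h2 := h1.const_mul s
    simp only [one_mul] at h2
    refine h2.congr_deriv ?_
    ring

theorem continuous_S (P : Profile) : Continuous P.S :=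
  continuous_iff_continuousAt.2 fun r => (hasDerivAt_S P r).continuousAt

theorem sq_mul_S (P : Profile) (r : ℝ) : r ^ 2 * P.S r = ∫ ρ in (0 : ℝ)..r, ρ * P.g ρ := by
  have h1 := intervalIntegral.mul_integral_comp_mul_left (a := 0) (b := 1)
    (f := fun ρ : ℝ => ρ * P.g ρ) r
  simp only [mul_zero, mul_one] at h1
  rw [← h1, pow_two, mul_assoc, Profile.S]
  simp only [mul_assoc, intervalIntegral.integral_const_mul]

theorem mul_dS_add (P : Profile) {r : ℝ} (hr : r ≠ 0) : r * P.dS r + 2 * P.S r = P.g r := by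
  have hc : Continuous fun ρ => ρ * P.g ρ := continuous_id.mul P.smooth.continuous
  have h1 : HasDerivAt (fun r => r ^ 2 * P.S r) (r * P.g r) r := by
    simp only [sq_mul_S]
    exact intervalIntegral.integral_hasDerivAt_right (hc.intervalIntegrable _ _)
      (hc.stronglyMeasurableAtFilter _ _) hc.continuousAt
  have h2 := (hasDerivAt_pow 2 r).mul (hasDerivAt_S P r)
  have h3 := h2.unique h1
  refine mul_left_cancel₀ hr ?_
  rw [← h3]
  simp
  ring

/-- The vorticity of `σ₁` at distance `r` from the origin is `g r`, so its support condition becomes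
a condition on `g`. -/
theorem g_eq_zero (P : Profile) {r : ℝ} (hr : 1 < r) : P.g r = 0 := by
  have hr0 : 0 < r := zero_lt_one.trans hr
  set x : E := EuclideanSpace.single 0 r with hx
  have hn : ‖x‖ = r := by simp [hx, abs_of_pos hr0]
  have hx0 : x ≠ 0 := norm_ne_zero_iff.1 (by rw [hn]; exact hr0.ne')
  have h1 := vort_swirl (hasDerivAt_S P) hx0
  rw [← sigma_eq_swirl, hn, mul_dS_add P hr0.ne'] at h1
  rw [← h1]
  refine image_eq_zero_of_notMem_tsupport fun h => ?_
  have := P.supp h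
  rw [mem_closedBall_zero_iff, hn] at this
  linarith

/-- The circulation `r² S(r)` is constant outside the support of the vorticity. -/
theorem S_eq (P : Profile) {r : ℝ} (hr : 1 ≤ r) : P.S r = P.S 1 / r ^ 2 := by
  have hc : Continuous fun ρ => ρ * P.g ρ := continuous_id.mul P.smooth.continuous
  have h1 : ∫ ρ in (1 : ℝ)..r, ρ * P.g ρ = 0 := by
    refine intervalIntegral.integral_zero_ae (Eventually.of_forall fun ρ hρ => ?_)
    rw [uIoc_of_le hr] at hρ
    rw [g_eq_zero P hρ.1, mul_zero]
  have h2 := intervalIntegral.integral_add_adjacent_intervals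
    (hc.intervalIntegrable (μ := volume) 0 1) (hc.intervalIntegrable 1 r)
  rw [h1, add_zero, ← sq_mul_S, ← sq_mul_S] at h2
  have : (0 : ℝ) < r ^ 2 := by positivity
  rw [eq_div_iff this.ne', mul_comm, ← h2]
  ring

/-- Outside the unit disk `S` is a multiple of `r⁻²`, and `r S' = g - 2 S` transfers the decay to
the derivative. This decay makes `∇σ₁` square integrable in the plane and `σ₁` bounded. -/
theorem exists_abs_S_le (P : Profile) :
    ∃ K : ℝ, 0 ≤ K ∧ (∀ r, 0 ≤ r → |P.S r| ≤ K / (1 + r ^ 2)) ∧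
      ∀ r, 0 ≤ r → r * |P.dS r| ≤ K / (1 + r ^ 2) := by
  obtain ⟨K₁, hK₁⟩ := isCompact_Icc.exists_bound_of_continuousOn (s := Icc (0 : ℝ) 1)
    (continuous_S P).continuousOn
  obtain ⟨K₂, hK₂⟩ := P.compact.exists_bound_of_continuous P.smooth.continuous
  simp only [Real.norm_eq_abs] at hK₁ hK₂
  have h1 := (abs_nonneg _).trans (hK₁ 1 (right_mem_Icc.2 zero_le_one))
  have h2 := (abs_nonneg _).trans (hK₂ 0)
  have hS : ∀ r, 0 ≤ r → |P.S r| ≤ 2 * K₁ / (1 + r ^ 2) := by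
    intro r hr
    rw [le_div_iff₀ (by positivity)]
    rcases le_total r 1 with h | h
    · have h3 := hK₁ r ⟨hr, h⟩
      have h4 : r ^ 2 ≤ 1 := pow_le_one₀ hr h
      linarith [mul_le_mul h3 (by linarith : 1 + r ^ 2 ≤ 2) (by positivity) h1]
    · have h3 := hK₁ 1 (right_mem_Icc.2 zero_le_one)
      have h4 : (0 : ℝ) < r ^ 2 := by positivity
      have h5 : |P.S r| * r ^ 2 = |P.S 1| := by
        rw [S_eq P h, abs_div, abs_of_pos h4, div_mul_cancel₀ _ h4.ne']
      have h6 : |P.S r| ≤ |P.S r| * r ^ 2 :=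
        le_mul_of_one_le_right (abs_nonneg _) (by nlinarith)
      linarith
  have hg : ∀ r, 0 ≤ r → |P.g r| ≤ 2 * K₂ / (1 + r ^ 2) := by
    intro r hr
    rw [le_div_iff₀ (by positivity)]
    rcases le_or_gt r 1 with h | h
    · have h3 := hK₂ r
      have h4 : r ^ 2 ≤ 1 := pow_le_one₀ hr h
      linarith [mul_le_mul h3 (by linarith : 1 + r ^ 2 ≤ 2) (by positivity) h2]
    · rw [g_eq_zero P h, abs_zero, zero_mul]
      positivity
  refine ⟨2 * K₂ + 2 * (2 * K₁), by positivity, fun r hr => (hS r hr).trans ?_, fun r hr => ?_⟩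
  · gcongr
    linarith
  · rcases hr.eq_or_lt with rfl | hr0
    · rw [zero_mul]
      positivity
    · have h3 : r * |P.dS r| = |P.g r - 2 * P.S r| := by
        rw [← mul_dS_add P hr0.ne', add_sub_cancel_right, abs_mul, abs_of_pos hr0]
      rw [h3]
      refine (abs_sub _ _).trans ?_
      rw [abs_mul, abs_two, add_div, mul_div_assoc 2 (2 * K₁)]
      exact add_le_add (hg r hr) (mul_le_mul_of_nonneg_left (hS r hr) zero_le_two)

theorem memLp_two_of_decay {F : Type*} [NormedAddCommGroup F] {u : E → F}
    (hu : AEStronglyMeasurable u volume) {K : ℝ} (hK : ∀ x, ‖u x‖ ≤ K / (1 + ‖x‖ ^ 2)) :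
    MemLp u 2 volume := by
  have h1 : Integrable fun x : E => ((1 : ℝ) + ‖x‖ ^ 2) ^ (-(4 : ℝ) / 2) :=
    integrable_rpow_neg_one_add_norm_sq (by rw [finrank_euclideanSpace_fin]; norm_num)
  have hc : Continuous fun x : E => (1 + ‖x‖ ^ 2)⁻¹ :=
    (by fun_prop : Continuous fun x : E => 1 + ‖x‖ ^ 2).inv₀ fun x => by positivity
  have h2 : MemLp (fun x : E => (1 + ‖x‖ ^ 2)⁻¹) 2 volume := by
    rw [memLp_two_iff_integrable_sq hc.aestronglyMeasurable]
    refine h1.congr (Eventually.of_forall fun x => ?_)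
    beta_reduce
    rw [show -(4 : ℝ) / 2 = -((2 : ℕ) : ℝ) by norm_num, Real.rpow_neg (by positivity),
      Real.rpow_natCast, inv_pow]
  refine h2.of_le_mul (c := K) hu (Eventually.of_forall fun x => ?_)
  rw [Real.norm_of_nonneg (by positivity)]
  exact hK x

theorem contDiff_sigma (P : Profile) : ContDiff ℝ 1 (sigma P.g) := by
  rw [sigma_eq_swirl]
  exact contDiff_swirl (hasDerivAt_S P) (continuous_dS P)

theorem exists_norm_grad_sigma_le (P : Profile) :
    ∃ K : ℝ, 0 ≤ K ∧ ∀ x, ‖grad (sigma P.g) x‖ ≤ K / (1 + ‖x‖ ^ 2) := by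
  obtain ⟨K, hK, h1, h2⟩ := exists_abs_S_le P
  refine ⟨3 * K, by positivity, fun x => ?_⟩
  rw [sigma_eq_swirl, mul_div_assoc]
  have h3 := h1 _ (norm_nonneg x)
  have h4 := h2 _ (norm_nonneg x)
  have h5 := norm_grad_swirl_le (hasDerivAt_S P) x
  linarith

theorem memLp_grad_sigma (P : Profile) : MemLp (grad (sigma P.g)) 2 volume := by
  obtain ⟨K, -, h⟩ := exists_norm_grad_sigma_le P
  exact memLp_two_of_decay (measurable_grad _).aestronglyMeasurable h

theorem memLp_top_grad_sigma (P : Profile) : MemLp (grad (sigma P.g)) ⊤ volume := by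
  obtain ⟨K, hK, h⟩ := exists_norm_grad_sigma_le P
  refine memLp_top_of_bound (measurable_grad _).aestronglyMeasurable K
    (Eventually.of_forall fun x => (h x).trans (div_le_self hK ?_))
  have := sq_nonneg ‖x‖
  linarith

theorem gradNorm_nonneg (P : Profile) : 0 ≤ P.gradNorm :=
  add_nonneg ENNReal.toReal_nonneg ENNReal.toReal_nonneg

theorem toReal_eLpNorm_grad_sigma_le (P : Profile) :
    (eLpNorm (grad (sigma P.g)) 2 volume).toReal ≤ P.gradNorm :=
  le_add_of_nonneg_right ENNReal.toReal_nonneg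

/-- The essential supremum bounds the gradient at every point by continuity: the set where the bound
fails is open and null. -/
theorem norm_grad_sigma_le (P : Profile) (x : E) : ‖grad (sigma P.g) x‖ ≤ P.gradNorm := by
  have h1 : ∀ᵐ x, ‖grad (sigma P.g) x‖ ≤ P.gradNorm := by
    filter_upwards [enorm_ae_le_eLpNormEssSup (grad (sigma P.g)) volume] with x hx
    rw [← eLpNorm_exponent_top] at hx
    have h2 := ENNReal.toReal_mono (memLp_top_grad_sigma P).2.ne hx
    rw [toReal_enorm] at h2
    exact h2.trans (le_add_of_nonneg_left ENNReal.toReal_nonneg)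
  by_contra! hlt
  have hopen : IsOpen {x | P.gradNorm < ‖grad (sigma P.g) x‖} :=
    isOpen_lt continuous_const (continuous_grad (contDiff_sigma P)).norm
  refine (hopen.measure_pos volume ⟨x, hlt⟩).ne' ?_
  rw [ae_iff] at h1
  simpa only [not_le] using h1

theorem abs_S_le (P : Profile) {r : ℝ} (hr : 0 ≤ r) : |P.S r| ≤ P.gradNorm := by
  obtain ⟨x, -, hx⟩ := abs_le_norm_grad_swirl (hasDerivAt_S P) hr
  rw [← sigma_eq_swirl] at hx
  exact hx.trans (norm_grad_sigma_le P x)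

/-- By constancy of the circulation the left side is `|S 1|`, a value of the angular velocity
controlled by the gradient. The factor `r²` is what later compensates the growth of the boundary
correction. -/
theorem abs_S_mul_sq_le (P : Profile) {r : ℝ} (hr : 1 ≤ r) : |P.S r| * r ^ 2 ≤ P.gradNorm := by
  have h : (0 : ℝ) < r ^ 2 := by positivity
  rw [S_eq P hr, abs_div, abs_of_pos h, div_mul_cancel₀ _ h.ne']
  exact abs_S_le P zero_le_one

/-! ### The field `σₘ` in the plane -/

theorem hasDerivAt_mul_S (P : Profile) (m r : ℝ) :
    HasDerivAt (fun r => m * P.S r) (m * P.dS r) r := (hasDerivAt_S P r).const_mul m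

theorem contDiff_sig (P : Profile) (m : ℝ) : ContDiff ℝ 1 (P.sig m) := by
  rw [sig_eq_swirl]
  exact contDiff_swirl (hasDerivAt_mul_S P m) (continuous_const.mul (continuous_dS P))

theorem grad_sig (P : Profile) (m : ℝ) : grad (P.sig m) = fun x => m • grad (sigma P.g) x :=
  funext fun x => grad_const_smul m ((contDiff_sigma P).differentiable one_ne_zero x)

theorem memLp_top_sig (P : Profile) (m : ℝ) : MemLp (P.sig m) ⊤ volume := by
  obtain ⟨K, hK, h1, -⟩ := exists_abs_S_le P
  refine memLp_top_of_bound (contDiff_sig P m).continuous.aestronglyMeasurable (|m| * K)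
    (Eventually.of_forall fun x => ?_)
  rw [sig_eq_swirl, swirl, norm_smul, norm_rotL, Real.norm_eq_abs, abs_mul, mul_assoc]
  refine mul_le_mul_of_nonneg_left ?_ (abs_nonneg m)
  refine (mul_le_mul_of_nonneg_right (h1 _ (norm_nonneg x)) (norm_nonneg x)).trans ?_
  rw [div_mul_eq_mul_div, div_le_iff₀ (by positivity)]
  refine mul_le_mul_of_nonneg_left ?_ hK
  nlinarith [sq_nonneg (‖x‖ - 1)]

/-- The pressure of the stationary Euler flow `σₘ`. -/
theorem exists_pressure_sig (P : Profile) (m : ℝ) : ∃ q : ℝ → ℝ,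
    (∀ r, HasDerivAt q (r * -(m * P.S r) ^ 2) r) ∧ MemLp (fun x : E => q ‖x‖) 2 volume := by
  have hc : Continuous fun r => m * P.S r := continuous_const.mul (continuous_S P)
  have hcc : Continuous fun ρ => ρ * -(m * P.S ρ) ^ 2 := by fun_prop
  set A := (m * P.S 1) ^ 2 / 2 with hA
  have hA0 : 0 ≤ A := by positivity
  -- The constant of integration is chosen so that the pressure is exactly `A / r²` for `r ≥ 1`; it
  -- then decays fast enough to be square integrable.
  set κ := A - ∫ ρ in (0 : ℝ)..1, ρ * -(m * P.S ρ) ^ 2 with hκ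
  set q : ℝ → ℝ := fun r => κ + ∫ ρ in (0 : ℝ)..r, ρ * -(m * P.S ρ) ^ 2 with hq
  have hqd := exists_pressure hc κ
  have hqc : Continuous q := continuous_iff_continuousAt.2 fun r => (hqd r).continuousAt
  have hq1 : ∀ r, 1 ≤ r → q r = A / r ^ 2 := by
    intro r hr
    have h1 := intervalIntegral.integral_add_adjacent_intervals
      (hcc.intervalIntegrable (μ := volume) 0 1) (hcc.intervalIntegrable 1 r)
    have h2 : ∫ ρ in (1 : ℝ)..r, ρ * -(m * P.S ρ) ^ 2 = A / r ^ 2 - A / 1 ^ 2 := by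
      refine intervalIntegral.integral_eq_sub_of_hasDerivAt (f := fun ρ => A / ρ ^ 2)
        (fun ρ hρ => ?_) (hcc.intervalIntegrable _ _)
      rw [uIcc_of_le hr] at hρ
      have h0 : ρ ≠ 0 := (zero_lt_one.trans_le hρ.1).ne'
      refine ((hasDerivAt_const ρ A).fun_div (hasDerivAt_pow 2 ρ) (pow_ne_zero 2 h0)).congr_deriv ?_
      rw [S_eq P hρ.1, hA]
      field_simp
      simp
      ring
    simp only [hq, hκ]
    rw [← h1, h2]
    ring
  obtain ⟨K, hK⟩ := isCompact_Icc.exists_bound_of_continuousOn (s := Icc (0 : ℝ) 1)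
    hqc.continuousOn
  refine ⟨q, hqd, memLp_two_of_decay (hqc.comp continuous_norm).aestronglyMeasurable
    (K := 2 * K + 2 * A) fun x => ?_⟩
  have hK0 := (norm_nonneg _).trans (hK 1 (right_mem_Icc.2 zero_le_one))
  rw [le_div_iff₀ (by positivity)]
  rcases le_total ‖x‖ 1 with h | h
  · have h3 := hK _ ⟨norm_nonneg x, h⟩
    have h4 : ‖x‖ ^ 2 ≤ 1 := pow_le_one₀ (norm_nonneg x) h
    linarith [mul_le_mul h3 (by linarith : 1 + ‖x‖ ^ 2 ≤ 2) (by positivity) hK0]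
  · have h4 : (0 : ℝ) < ‖x‖ ^ 2 := by positivity
    have h5 : A / ‖x‖ ^ 2 ≤ A := div_le_self hA0 (by nlinarith)
    rw [hq1 _ h, Real.norm_of_nonneg (by positivity), mul_add, mul_one, div_mul_cancel₀ _ h4.ne']
    linarith

theorem integral_conv_sig_eq_zero (P : Profile) (m : ℝ) {v : X univ} (hv : v ∈ V univ) :
    ∫ x in univ, ⟪conv (P.sig m) (grad (P.sig m)) x, v.fst x⟫ = 0 := by
  obtain ⟨q, hq, hq2⟩ := exists_pressure_sig P m
  have hc : Continuous fun x : E => (m * P.S ‖x‖) ^ 2 * ‖x‖ :=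
    ((continuous_const.mul ((continuous_S P).comp continuous_norm)).pow 2).mul continuous_norm
  rw [sig_eq_swirl]
  refine integral_conv_swirl_eq_zero (hasDerivAt_mul_S P m) hq (hq2.restrict univ)
    (MemLp.restrict univ ?_) hv
  obtain ⟨K, hK, h1, -⟩ := exists_abs_S_le P
  refine memLp_two_of_decay hc.aestronglyMeasurable (K := m ^ 2 * K ^ 2) fun x => ?_
  have h2 := pow_le_pow_left₀ (abs_nonneg _) (h1 _ (norm_nonneg x)) 2
  rw [sq_abs, div_pow] at h2
  rw [Real.norm_of_nonneg (by positivity), mul_pow, mul_assoc, mul_div_assoc]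
  refine mul_le_mul_of_nonneg_left ?_ (sq_nonneg m)
  refine (mul_le_mul_of_nonneg_right h2 (norm_nonneg x)).trans ?_
  rw [div_mul_eq_mul_div, div_le_div_iff₀ (by positivity) (by positivity), mul_assoc]
  refine mul_le_mul_of_nonneg_left ?_ (sq_nonneg K)
  nlinarith [sq_nonneg (‖x‖ - 1), norm_nonneg x, sq_nonneg ‖x‖]

/-! ### Power series -/

/-- The sum of the power series with coefficients `a`. -/
def powSum (a : ℕ → ℝ) (s : ℝ) : ℝ := ∑' k, a k * s ^ k

/-- The coefficients of the derivative of a power series. -/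
def derivCoeff (a : ℕ → ℝ) (k : ℕ) : ℝ := (k + 1) * a (k + 1)

section

variable {a : ℕ → ℝ}

/-- The bound `1 / k!` is preserved by differentiation, so one set of lemmas serves the function and
all its derivatives. -/
theorem abs_derivCoeff_le (ha : ∀ k, |a k| ≤ 1 / (k.factorial : ℝ)) (k : ℕ) :
    |derivCoeff a k| ≤ 1 / (k.factorial : ℝ) := by
  have h := ha (k + 1)
  have hk : (0 : ℝ) < (k : ℝ) + 1 := by positivity
  have hf : (0 : ℝ) < k.factorial := by positivity
  rw [derivCoeff, abs_mul, abs_of_pos hk]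
  rw [Nat.factorial_succ, Nat.cast_mul, Nat.cast_succ, le_div_iff₀ (by positivity)] at h
  rw [le_div_iff₀ hf]
  linarith

theorem summable_powSum (ha : ∀ k, |a k| ≤ 1 / (k.factorial : ℝ)) (s : ℝ) :
    Summable fun k => a k * s ^ k := by
  refine Summable.of_norm_bounded (Real.summable_pow_div_factorial |s|) fun k => ?_
  rw [norm_mul, norm_pow, Real.norm_eq_abs, Real.norm_eq_abs, div_eq_mul_one_div, mul_comm]
  exact mul_le_mul_of_nonneg_left (ha k) (by positivity)

theorem hasDerivAt_powSum (ha : ∀ k, |a k| ≤ 1 / (k.factorial : ℝ)) (s : ℝ) :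
    HasDerivAt (powSum a) (powSum (derivCoeff a) s) s := by
  set ρ := |s| + 1 with hρ
  have hρ0 : 0 ≤ ρ := by positivity
  have hu : Summable fun k : ℕ => (k : ℝ) / (k.factorial : ℝ) * ρ ^ (k - 1) := by
    rw [← summable_nat_add_iff 1]
    refine (Real.summable_pow_div_factorial ρ).congr fun k => ?_
    have hf : (0 : ℝ) < k.factorial := by positivity
    have hk : (0 : ℝ) < (k : ℝ) + 1 := by positivity
    rw [Nat.factorial_succ, Nat.cast_mul, Nat.cast_succ, Nat.add_sub_cancel]
    field_simp
  have h := hasDerivAt_tsum_of_isPreconnected hu (Metric.isOpen_ball (x := (0 : ℝ)) (ε := ρ))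
    (convex_ball (0 : ℝ) ρ).isPreconnected (g := fun k y => a k * y ^ k)
    (g' := fun k y => a k * (k * y ^ (k - 1)))
    (fun k y _ => (hasDerivAt_pow k y).const_mul (a k))
    (fun k y hy => by
      rw [mem_ball_zero_iff, Real.norm_eq_abs] at hy
      rw [norm_mul, norm_mul, norm_pow, Real.norm_eq_abs, Real.norm_natCast, Real.norm_eq_abs]
      calc |a k| * (k * |y| ^ (k - 1)) ≤ 1 / (k.factorial : ℝ) * (k * ρ ^ (k - 1)) := by
            gcongr
            exact ha k
        _ = _ := by ring)
    (Metric.mem_ball_self (by positivity)) (summable_powSum ha 0)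
    (y := s) (by rw [mem_ball_zero_iff, Real.norm_eq_abs, hρ]; linarith)
  refine h.congr_deriv ?_
  have hs : Summable fun k : ℕ => a k * (k * s ^ (k - 1)) := by
    rw [← summable_nat_add_iff 1]
    refine (summable_powSum (abs_derivCoeff_le ha) s).congr fun k => ?_
    rw [derivCoeff, Nat.add_sub_cancel, Nat.cast_succ]
    ring
  rw [hs.tsum_eq_zero_add, powSum]
  simp only [Nat.cast_zero, zero_mul, mul_zero, zero_add]
  refine tsum_congr fun k => ?_
  rw [derivCoeff, Nat.add_sub_cancel, Nat.cast_succ]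
  ring

theorem continuous_powSum (ha : ∀ k, |a k| ≤ 1 / (k.factorial : ℝ)) : Continuous (powSum a) :=
  continuous_iff_continuousAt.2 fun s => (hasDerivAt_powSum ha s).continuousAt

theorem contDiff_powSum (ha : ∀ k, |a k| ≤ 1 / (k.factorial : ℝ)) : ContDiff ℝ 1 (powSum a) := by
  refine contDiff_one_iff_deriv.2 ⟨fun s => (hasDerivAt_powSum ha s).differentiableAt, ?_⟩
  rw [funext fun s => (hasDerivAt_powSum ha s).deriv]
  exact continuous_powSum (abs_derivCoeff_le ha)

theorem powSum_eq_add (ha : ∀ k, |a k| ≤ 1 / (k.factorial : ℝ)) (s : ℝ) :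
    powSum a s = a 0 + s * powSum (fun k => a (k + 1)) s := by
  rw [powSum, (summable_powSum ha s).tsum_eq_zero_add, powSum, ← tsum_mul_left]
  simp only [pow_zero, mul_one, pow_succ]
  congr 2
  ext k
  ring

theorem powSum_nonneg (ha : ∀ k, 0 ≤ a k) {s : ℝ} (hs : 0 ≤ s) : 0 ≤ powSum a s :=
  tsum_nonneg fun k => mul_nonneg (ha k) (pow_nonneg hs k)

end

/-! ### A modified Bessel function -/

/-- The coefficients of `s ↦ 2 I₁(√s) / √s`. -/
def besselCoeff (k : ℕ) : ℝ := 1 / (4 ^ k * k.factorial * (k + 1).factorial)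

/-- The function `s ↦ 2 I₁(√s) / √s`. -/
def bessel : ℝ → ℝ := powSum besselCoeff

/-- The first derivative of `bessel`. -/
def bessel' : ℝ → ℝ := powSum (derivCoeff besselCoeff)

/-- The second derivative of `bessel`. -/
def bessel'' : ℝ → ℝ := powSum (derivCoeff (derivCoeff besselCoeff))

theorem besselCoeff_nonneg (k : ℕ) : 0 ≤ besselCoeff k := by
  rw [besselCoeff]
  positivity

theorem derivCoeff_nonneg {a : ℕ → ℝ} (ha : ∀ k, 0 ≤ a k) (k : ℕ) : 0 ≤ derivCoeff a k :=
  mul_nonneg (by positivity) (ha _)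

theorem abs_besselCoeff_le (k : ℕ) : |besselCoeff k| ≤ 1 / (k.factorial : ℝ) := by
  rw [abs_of_nonneg (besselCoeff_nonneg k), besselCoeff]
  refine one_div_le_one_div_of_le (by positivity) ?_
  have h1 : (1 : ℝ) ≤ 4 ^ k := one_le_pow₀ (by norm_num)
  have h2 : (1 : ℝ) ≤ (k + 1).factorial := by exact_mod_cast Nat.one_le_iff_ne_zero.2 (Nat.factorial_ne_zero _)
  have h3 : (0 : ℝ) < k.factorial := by positivity
  calc (k.factorial : ℝ) = 1 * k.factorial * 1 := by ring
    _ ≤ _ := by gcongr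

theorem besselCoeff_succ (k : ℕ) :
    4 * ((k : ℝ) + 1) * (k + 2) * besselCoeff (k + 1) = besselCoeff k := by
  have h1 : (0 : ℝ) < k.factorial := by positivity
  have h2 : (0 : ℝ) < (k : ℝ) + 1 := by positivity
  have h3 : (0 : ℝ) < (k : ℝ) + 2 := by positivity
  rw [besselCoeff, besselCoeff]
  simp only [Nat.factorial_succ, Nat.cast_mul, Nat.cast_add, Nat.cast_one]
  have h4 : (k : ℝ) + 1 + 1 = k + 2 := by ring
  rw [h4]
  field_simp
  ring

theorem hasDerivAt_bessel (s : ℝ) : HasDerivAt bessel (bessel' s) s :=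
  hasDerivAt_powSum abs_besselCoeff_le s

theorem hasDerivAt_bessel' (s : ℝ) : HasDerivAt bessel' (bessel'' s) s :=
  hasDerivAt_powSum (abs_derivCoeff_le abs_besselCoeff_le) s

/-- With `β(r) = bessel (r²)` this is `β'' + 3 β' / r = β`, which says that `β(|x|) x^⊥` is an
eigenfield of the Laplacian with eigenvalue one. -/
theorem bessel_ode (s : ℝ) : 4 * s * bessel'' s + 8 * bessel' s = bessel s := by
  have h0 := abs_besselCoeff_le
  have h1 := abs_derivCoeff_le h0
  have h2 := abs_derivCoeff_le h1
  have e0 := powSum_eq_add h0 s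
  have e1 := powSum_eq_add h1 s
  have hs1 : Summable fun k => s * (derivCoeff besselCoeff (k + 1) * s ^ k) :=
    ((summable_nat_add_iff 1).2 (summable_powSum h1 s)).congr fun k => by ring
  have e2 : 4 * (s * powSum (derivCoeff (derivCoeff besselCoeff)) s) +
      8 * (s * powSum (fun k => derivCoeff besselCoeff (k + 1)) s) =
      s * powSum (fun k => besselCoeff (k + 1)) s := by
    simp only [powSum, ← tsum_mul_left]
    rw [← Summable.tsum_add (((summable_powSum h2 s).mul_left s).mul_left 4) (hs1.mul_left 8)]
    refine tsum_congr fun k => ?_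
    have h3 := besselCoeff_succ (k + 1)
    simp only [derivCoeff, Nat.cast_add, Nat.cast_one] at h3 ⊢
    rw [← h3]
    ring
  have e3 : 8 * derivCoeff besselCoeff 0 = besselCoeff 0 := by
    rw [← besselCoeff_succ 0, derivCoeff]
    push_cast
    ring
  simp only [bessel, bessel', bessel'']
  rw [e0, e1, ← e2, ← e3]
  ring

theorem bessel'_nonneg {s : ℝ} (hs : 0 ≤ s) : 0 ≤ bessel' s :=
  powSum_nonneg (derivCoeff_nonneg besselCoeff_nonneg) hs

theorem bessel_pos {s : ℝ} (hs : 0 ≤ s) : 0 < bessel s := by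
  have h1 : besselCoeff 0 = 1 := by simp [besselCoeff]
  rw [bessel, powSum_eq_add abs_besselCoeff_le, h1]
  have := mul_nonneg hs (powSum_nonneg (fun k => besselCoeff_nonneg (k + 1)) hs)
  linarith

theorem monotoneOn_bessel : MonotoneOn bessel (Ici 0) := by
  refine monotoneOn_of_deriv_nonneg (convex_Ici 0)
    (continuous_powSum abs_besselCoeff_le).continuousOn
    (fun s _ => (hasDerivAt_bessel s).differentiableAt.differentiableWithinAt) fun s hs => ?_
  rw [interior_Ici] at hs
  rw [(hasDerivAt_bessel s).deriv]
  exact bessel'_nonneg (le_of_lt hs)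

/-- The differential equation shows that `bessel² - s bessel'²` has derivative `3/2 bessel bessel' +
3 bessel'²`, which is nonnegative for `s ≥ 0`, while at `s = 0` the function is a square. This sharp
bound on the logarithmic derivative lets the eigenfield's gradient lose only one power of the
radius. -/
theorem mul_sq_bessel'_le {s : ℝ} (hs : 0 ≤ s) : s * bessel' s ^ 2 ≤ bessel s ^ 2 := by
  have hd : ∀ s, HasDerivAt (fun s => bessel s ^ 2 - s * bessel' s ^ 2)
      (3 / 2 * (bessel s * bessel' s) + 3 * bessel' s ^ 2) s := by
    intro s
    have h1 := ((hasDerivAt_bessel s).fun_pow 2).fun_sub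
      ((hasDerivAt_id s).fun_mul ((hasDerivAt_bessel' s).fun_pow 2))
    refine h1.congr_deriv ?_
    rw [← bessel_ode s]
    simp
    ring
  have hm : MonotoneOn (fun s => bessel s ^ 2 - s * bessel' s ^ 2) (Ici 0) := by
    refine monotoneOn_of_deriv_nonneg (convex_Ici 0)
      (fun s _ => (hd s).continuousAt.continuousWithinAt)
      (fun s _ => (hd s).differentiableAt.differentiableWithinAt) fun s hs => ?_
    rw [interior_Ici] at hs
    rw [(hd s).deriv]
    have h2 := bessel'_nonneg (le_of_lt hs)
    have h3 := bessel_pos (le_of_lt hs)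
    positivity
  have h4 := hm (mem_Ici.2 (le_refl (0 : ℝ))) hs hs
  simp only [zero_mul, sub_zero] at h4
  have := sq_nonneg (bessel 0)
  linarith

/-! ### A divergence-free eigenfield of the Laplacian -/

theorem hasDerivAt_bessel_sq (r : ℝ) :
    HasDerivAt (fun r => bessel (r ^ 2)) (2 * r * bessel' (r ^ 2)) r := by
  have h := (hasDerivAt_bessel (r ^ 2)).comp r (hasDerivAt_pow 2 r)
  refine h.congr_deriv ?_
  simp
  ring

theorem continuous_deriv_bessel_sq : Continuous fun r : ℝ => 2 * r * bessel' (r ^ 2) :=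
  (continuous_const.mul continuous_id).mul
    ((continuous_powSum (abs_derivCoeff_le abs_besselCoeff_le)).comp (continuous_pow 2))

/-- A divergence-free radially symmetric solution of `Δz = z`. -/
def eigenfield : E → E := swirl fun r => bessel (r ^ 2)

theorem contDiff_eigenfield : ContDiff ℝ 1 eigenfield :=
  contDiff_swirl hasDerivAt_bessel_sq continuous_deriv_bessel_sq

theorem grad_eigenfield_apply (x : E) (i j : Fin 2) : grad eigenfield x (i, j) =
    2 * bessel' (‖x‖ ^ 2) * x i * rotL x j +
      bessel (‖x‖ ^ 2) * rotL (EuclideanSpace.single i 1) j := by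
  rw [eigenfield, grad_swirl_apply hasDerivAt_bessel_sq]
  rcases eq_or_ne x 0 with rfl | hx
  · simp
  · have := norm_ne_zero_iff.2 hx
    field_simp

theorem contDiff_grad_eigenfield : ContDiff ℝ 1 (grad eigenfield) := by
  refine contDiff_euclidean.2 fun p => ?_
  obtain ⟨i, j⟩ := p
  simp only [grad_eigenfield_apply]
  have h1 : ContDiff ℝ 1 fun x : E => bessel (‖x‖ ^ 2) :=
    (contDiff_powSum abs_besselCoeff_le).comp (contDiff_norm_sq ℝ)
  have h2 : ContDiff ℝ 1 fun x : E => bessel' (‖x‖ ^ 2) :=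
    (contDiff_powSum (abs_derivCoeff_le abs_besselCoeff_le)).comp (contDiff_norm_sq ℝ)
  have h3 : ContDiff ℝ 1 fun x : E => x i :=
    (EuclideanSpace.proj i : E →L[ℝ] ℝ).contDiff
  have h4 : ContDiff ℝ 1 fun x : E => rotL x j :=
    ((EuclideanSpace.proj j : E →L[ℝ] ℝ).comp rotL).contDiff
  exact (((contDiff_const.mul h2).mul h3).mul h4).add (h1.mul contDiff_const)

theorem fderiv_grad_eigenfield_apply (x : E) (i j : Fin 2) :
    fderiv ℝ (grad eigenfield) x (EuclideanSpace.single i 1) (i, j) =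
      4 * bessel'' (‖x‖ ^ 2) * x i ^ 2 * rotL x j + 2 * bessel' (‖x‖ ^ 2) * rotL x j +
        4 * bessel' (‖x‖ ^ 2) * (x i * rotL (EuclideanSpace.single i 1) j) := by
  rw [← fderiv_comp_proj (contDiff_grad_eigenfield.differentiable one_ne_zero x)]
  simp only [grad_eigenfield_apply]
  have hn := (hasStrictFDerivAt_norm_sq x).hasFDerivAt
  have h1 := (hasDerivAt_bessel (‖x‖ ^ 2)).comp_hasFDerivAt x hn
  have h2 := (hasDerivAt_bessel' (‖x‖ ^ 2)).comp_hasFDerivAt x hn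
  have h3 := (EuclideanSpace.proj i : E →L[ℝ] ℝ).hasFDerivAt (x := x)
  have h4 := ((EuclideanSpace.proj j : E →L[ℝ] ℝ).comp rotL).hasFDerivAt (x := x)
  have h5 := (((h2.const_mul 2).mul h3).mul h4).add
    (h1.mul_const (rotL (EuclideanSpace.single i 1) j))
  have h6 := congrArg (fun L => L (EuclideanSpace.single i (1 : ℝ))) h5.fderiv
  refine Eq.trans h6 ?_
  simp [EuclideanSpace.inner_single_right]
  ring

theorem divM_grad_eigenfield : divM (grad eigenfield) = eigenfield := by
  ext x j
  have hn := norm_sq_E x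
  have ho := bessel_ode (‖x‖ ^ 2)
  simp only [divM, Fin.sum_univ_two, fderiv_grad_eigenfield_apply]
  simp only [eigenfield, swirl, PiLp.smul_apply, smul_eq_mul]
  rw [← ho]
  have hj : x 0 * rotL (EuclideanSpace.single 0 1) j + x 1 * rotL (EuclideanSpace.single 1 1) j =
      rotL x j := by
    fin_cases j <;> simp [rotL_apply]
  rw [← hj]
  generalize rotL (EuclideanSpace.single 0 1) j = a
  generalize rotL (EuclideanSpace.single 1 1) j = b
  rw [hn]
  ring

/-- The gradient is bounded by `2 r² bessel' + 2 bessel` at `r²`, and `r bessel' ≤ bessel` reduces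
the first term to `2 r bessel`. Monotonicity moves the evaluation to the boundary. -/
theorem norm_grad_eigenfield_le {R : ℝ} (hR : 1 ≤ R) {x : E} (hx : ‖x‖ ≤ R) :
    ‖grad eigenfield x‖ ≤ 4 * R * bessel (R ^ 2) := by
  have hx0 := norm_nonneg x
  have h1 := norm_grad_swirl_le hasDerivAt_bessel_sq x
  have hp := bessel_pos (sq_nonneg ‖x‖)
  have hd := bessel'_nonneg (sq_nonneg ‖x‖)
  have hm : bessel (‖x‖ ^ 2) ≤ bessel (R ^ 2) :=
    monotoneOn_bessel (sq_nonneg ‖x‖) (sq_nonneg R) (pow_le_pow_left₀ hx0 hx 2)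
  have h2 : ‖x‖ * bessel' (‖x‖ ^ 2) ≤ bessel (‖x‖ ^ 2) := by
    refine le_of_sq_le_sq ?_ hp.le
    rw [mul_pow]
    exact mul_sq_bessel'_le (sq_nonneg ‖x‖)
  rw [abs_of_nonneg (by positivity), abs_of_pos hp] at h1
  have h3 : ‖x‖ * (‖x‖ * bessel' (‖x‖ ^ 2)) ≤ R * bessel (R ^ 2) :=
    mul_le_mul hx (h2.trans hm) (by positivity) (by linarith)
  have h4 : bessel (R ^ 2) ≤ R * bessel (R ^ 2) := le_mul_of_one_le_left (hp.le.trans hm) hR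
  rw [eigenfield]
  linarith

/-! ### The field `σ̄ₘ` in a disk -/

theorem memLp_ball_of_continuous {F : Type*} [NormedAddCommGroup F] {u : E → F}
    (hu : Continuous u) (p : ℝ≥0∞) (R : ℝ) : MemLp u p (volume.restrict (Metric.ball 0 R)) := by
  have : IsFiniteMeasure (volume.restrict (Metric.ball (0 : E) R)) :=
    isFiniteMeasure_restrict.2 measure_ball_lt_top.ne
  obtain ⟨C, hC⟩ := (isCompact_closedBall (0 : E) R).exists_bound_of_continuousOn hu.continuousOn
  refine MemLp.of_bound hu.aestronglyMeasurable C ?_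
  filter_upwards [ae_restrict_mem measurableSet_ball] with x hx
  exact hC x (Metric.ball_subset_closedBall hx)

theorem fieldX_eq_add_smul {Ω : Set E} {u v z : E → E} (c : ℝ)
    (hu : MemLp u 2 (volume.restrict Ω)) (hu' : MemLp (grad u) 2 (volume.restrict Ω))
    (hv : MemLp v 2 (volume.restrict Ω)) (hv' : MemLp (grad v) 2 (volume.restrict Ω))
    (hz : MemLp z 2 (volume.restrict Ω)) (hz' : MemLp (grad z) 2 (volume.restrict Ω))
    (h : u = v + c • z) (h' : grad u = grad v + c • grad z) :
    fieldX Ω u hu hu' = fieldX Ω v hv hv' + c • fieldX Ω z hz hz' := by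
  refine WithLp.ofLp_injective 2 (Prod.ext ?_ ?_)
  · change hu.toLp u = hv.toLp v + c • hz.toLp z
    rw [← MemLp.toLp_const_smul, ← MemLp.toLp_add]
    exact MemLp.toLp_congr _ _ (by rw [h])
  · change hu'.toLp (grad u) = hv'.toLp (grad v) + c • hz'.toLp (grad z)
    rw [← MemLp.toLp_const_smul, ← MemLp.toLp_add]
    exact MemLp.toLp_congr _ _ (by rw [h'])

/-- `eigenfield` is orthogonal to `H¹₀` in `H¹`. -/
theorem inner_fieldX_eigenfield {R : ℝ}
    (h1 : MemLp eigenfield 2 (volume.restrict (Metric.ball 0 R)))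
    (h2 : MemLp (grad eigenfield) 2 (volume.restrict (Metric.ball 0 R)))
    {p : X (Metric.ball 0 R)} (hp : p ∈ H10 (Metric.ball 0 R)) :
    ⟪p, fieldX (Metric.ball 0 R) eigenfield h1 h2⟫ = 0 := by
  rw [WithLp.prod_inner_apply]
  change ⟪p.fst, h1.toLp eigenfield⟫ + ⟪p.snd, h2.toLp (grad eigenfield)⟫ = 0
  rw [inner_toLp_eq_integral, inner_toLp_eq_integral,
    integral_inner_snd_eq_neg contDiff_grad_eigenfield h2
      (by rw [divM_grad_eigenfield]; exact h1) hp, divM_grad_eigenfield, add_neg_cancel]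

/-- The angular velocity of `σ̄ₘ` in the disk of radius `R`. -/
def Profile.barS (P : Profile) (m R r : ℝ) : ℝ :=
  m * P.S r - m * (P.S R / bessel (R ^ 2)) * bessel (r ^ 2)

/-- The derivative of `Profile.barS`. -/
def Profile.dbarS (P : Profile) (m R r : ℝ) : ℝ :=
  m * P.dS r - m * (P.S R / bessel (R ^ 2)) * (2 * r * bessel' (r ^ 2))

theorem hasDerivAt_barS (P : Profile) (m R r : ℝ) :
    HasDerivAt (P.barS m R) (P.dbarS m R r) r :=
  (hasDerivAt_mul_S P m r).fun_sub ((hasDerivAt_bessel_sq r).const_mul _)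

theorem continuous_dbarS (P : Profile) (m R : ℝ) : Continuous (P.dbarS m R) :=
  (continuous_const.mul (continuous_dS P)).sub (continuous_const.mul continuous_deriv_bessel_sq)

theorem barS_self (P : Profile) (m R : ℝ) : P.barS m R R = 0 := by
  have := (bessel_pos (sq_nonneg R)).ne'
  rw [Profile.barS]
  field_simp
  ring

/-- The field `σ̄ₘ` in the disk of radius `R`. -/
def Profile.bar (P : Profile) (m R : ℝ) : E → E := swirl (P.barS m R)

theorem contDiff_bar (P : Profile) (m R : ℝ) : ContDiff ℝ 1 (P.bar m R) :=
  contDiff_swirl (hasDerivAt_barS P m R) (continuous_dbarS P m R)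

/-- The angular velocity vanishes at `R` and is continuously differentiable, so it is at most `L (R
- r)`. The remaining factor `|x|` is bounded by `R + |x|`. -/
theorem exists_norm_bar_le (P : Profile) (m : ℝ) {R : ℝ} (hR : 0 < R) :
    ∃ L : ℝ, ∀ x ∈ Metric.ball (0 : E) R, ‖P.bar m R x‖ ≤ L * (R ^ 2 - ‖x‖ ^ 2) := by
  obtain ⟨L, hL⟩ := isCompact_Icc.exists_bound_of_continuousOn (s := Icc (0 : ℝ) R)
    (continuous_dbarS P m R).continuousOn
  have hL0 : 0 ≤ L := (norm_nonneg _).trans (hL 0 (left_mem_Icc.2 hR.le))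
  refine ⟨L, fun x hx => ?_⟩
  rw [mem_ball_zero_iff] at hx
  have h0 := norm_nonneg x
  have h1 := (convex_Icc (0 : ℝ) R).norm_image_sub_le_of_norm_hasDerivWithin_le
    (fun r _ => (hasDerivAt_barS P m R r).hasDerivWithinAt) hL
    (right_mem_Icc.2 hR.le) ⟨h0, hx.le⟩
  rw [barS_self, sub_zero, Real.norm_eq_abs (‖x‖ - R), abs_of_nonpos (by linarith), neg_sub] at h1
  rw [Profile.bar, swirl, norm_smul, norm_rotL]
  have h2 : 0 ≤ L * (R - ‖x‖) := mul_nonneg hL0 (by linarith)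
  calc ‖P.barS m R ‖x‖‖ * ‖x‖ ≤ L * (R - ‖x‖) * (R + ‖x‖) :=
        mul_le_mul h1 (by linarith) h0 h2
    _ = L * (R ^ 2 - ‖x‖ ^ 2) := by ring

theorem sig_eq_bar_add (P : Profile) (m R : ℝ) :
    P.sig m = P.bar m R + (m * (P.S R / bessel (R ^ 2))) • eigenfield := by
  ext1 x
  rw [sig_eq_swirl, Pi.add_apply, Pi.smul_apply, Profile.bar, eigenfield, swirl, swirl, swirl,
    smul_smul, ← add_smul, Profile.barS]
  congr 1
  ring

theorem grad_sig_eq_bar_add (P : Profile) (m R : ℝ) : grad (P.sig m) =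
    grad (P.bar m R) + (m * (P.S R / bessel (R ^ 2))) • grad eigenfield := by
  ext1 x
  have h1 := (contDiff_bar P m R).differentiable one_ne_zero x
  have h2 := contDiff_eigenfield.differentiable one_ne_zero x
  rw [sig_eq_bar_add P m R]
  refine (grad_add h1 (h2.const_smul _)).trans ?_
  rw [Pi.add_apply, Pi.smul_apply]
  congr 1
  exact grad_const_smul _ h2

/-- `σ̄ₘ` as an element of `H¹`. -/
def Profile.barX (P : Profile) (m R : ℝ) : X (Metric.ball 0 R) :=
  fieldX _ (P.bar m R) (memLp_ball_of_continuous (contDiff_bar P m R).continuous 2 R)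
    (memLp_ball_of_continuous (continuous_grad (contDiff_bar P m R)) 2 R)

theorem barX_mem_V (P : Profile) (m : ℝ) {R : ℝ} (hR : 0 < R) :
    P.barX m R ∈ V (Metric.ball 0 R) := by
  obtain ⟨L, hL⟩ := exists_norm_bar_le P m hR
  exact fieldX_mem_V _ _ (fieldX_mem_H10_ball hR (contDiff_bar P m R) _ _ hL)
    (fun x _ => traceL_grad_swirl (hasDerivAt_barS P m R) x) measurableSet_ball

/-- The candidate lies in `V`, and its difference from `σₘ` is a multiple of `eigenfield`, which is
orthogonal to `H¹₀` and hence to `V`. These properties determine the orthogonal projection. -/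
theorem sigBar_eq_barX (P : Profile) (m : ℝ) {R : ℝ} (hR : 0 < R) :
    P.sigBar m R = P.barX m R := by
  have hz := memLp_ball_of_continuous contDiff_eigenfield.continuous 2 R
  have hz' := memLp_ball_of_continuous (continuous_grad contDiff_eigenfield) 2 R
  have h1 : P.sigRestr m R = P.barX m R +
      (m * (P.S R / bessel (R ^ 2))) • fieldX _ eigenfield hz hz' :=
    fieldX_eq_add_smul _ _ _ _ _ _ _ (sig_eq_bar_add P m R) (grad_sig_eq_bar_add P m R)
  rw [Profile.sigBar]
  refine (Submodule.eq_starProjection_of_mem_of_inner_eq_zero (barX_mem_V P m hR)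
    fun p hp => ?_)
  rw [h1, add_sub_cancel_left, real_inner_comm, inner_smul_right,
    inner_fieldX_eigenfield hz hz' hp.1, mul_zero]

/-- The boundary value of `bessel` cancels. What remains is `|S R|`, of order `R⁻²`, times the one
power of `R` from the gradient bound. -/
theorem norm_smul_grad_eigenfield_le (P : Profile) (m : ℝ) {R : ℝ} (hR : 1 ≤ R) {x : E}
    (hx : ‖x‖ ≤ R) : ‖(m * (P.S R / bessel (R ^ 2))) • grad eigenfield x‖ ≤
      4 * P.gradNorm * |m| / R := by
  have hb := bessel_pos (sq_nonneg R)
  have hR0 : 0 < R := zero_lt_one.trans_le hR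
  have h1 := norm_grad_eigenfield_le hR hx
  have h2 := abs_S_mul_sq_le P hR
  rw [norm_smul, Real.norm_eq_abs, abs_mul, abs_div, abs_of_pos hb, le_div_iff₀ hR0]
  calc |m| * (|P.S R| / bessel (R ^ 2)) * ‖grad eigenfield x‖ * R
      ≤ |m| * (|P.S R| / bessel (R ^ 2)) * (4 * R * bessel (R ^ 2)) * R := by gcongr
    _ = 4 * (|P.S R| * R ^ 2) * |m| := by field_simp
    _ ≤ 4 * P.gradNorm * |m| := by gcongr

theorem norm_grad_bar_le (P : Profile) (m : ℝ) {R : ℝ} (hR : 1 ≤ R) {x : E} (hx : ‖x‖ ≤ R) :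
    ‖grad (P.bar m R) x‖ ≤ 5 * P.gradNorm * |m| := by
  have h1 := congrFun (grad_sig_eq_bar_add P m R) x
  rw [grad_sig, Pi.add_apply, Pi.smul_apply, ← sub_eq_iff_eq_add] at h1
  rw [← h1]
  refine (norm_sub_le _ _).trans ?_
  have h2 := norm_smul_grad_eigenfield_le P m hR hx
  have h3 := mul_le_mul_of_nonneg_left (norm_grad_sigma_le P x) (abs_nonneg m)
  have h4 : 4 * P.gradNorm * |m| / R ≤ 4 * P.gradNorm * |m| :=
    div_le_self (by have := gradNorm_nonneg P; positivity) hR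
  rw [norm_smul m, Real.norm_eq_abs]
  linarith

/-- The pointwise bound of order `1 / R` on the correction is multiplied by the square root of the
area, which is at most `2R`. This gives the 8, and `σₘ` itself contributes 1. -/
theorem norm_barX_snd_le (P : Profile) (m : ℝ) {R : ℝ} (hR : 1 ≤ R) :
    ‖(P.barX m R).snd‖ ≤ 9 * P.gradNorm * |m| := by
  have hR0 : 0 < R := zero_lt_one.trans_le hR
  have hN := gradNorm_nonneg P
  have hfin : IsFiniteMeasure (volume.restrict (Metric.ball (0 : E) R)) :=
    isFiniteMeasure_restrict.2 measure_ball_lt_top.ne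
  set c := m * (P.S R / bessel (R ^ 2)) with hc
  have hz := memLp_ball_of_continuous contDiff_eigenfield.continuous 2 R
  have hz' := memLp_ball_of_continuous (continuous_grad contDiff_eigenfield) 2 R
  have h1 : P.sigRestr m R = P.barX m R + c • fieldX _ eigenfield hz hz' :=
    fieldX_eq_add_smul _ _ _ _ _ _ _ (sig_eq_bar_add P m R) (grad_sig_eq_bar_add P m R)
  have h2 : (P.barX m R).snd = (P.sigRestr m R).snd - c • hz'.toLp (grad eigenfield) := by
    rw [h1, WithLp.add_snd, WithLp.smul_snd]
    exact (add_sub_cancel_right _ _).symm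
  have h3 : ‖(P.sigRestr m R).snd‖ ≤ P.gradNorm * |m| := by
    change ‖(memLp_grad_sig P m R).toLp _‖ ≤ _
    rw [Lp.norm_toLp]
    have h4 : eLpNorm (grad (P.sig m)) 2 (volume.restrict (Metric.ball 0 R)) ≤
        ‖m‖ₑ * eLpNorm (grad (sigma P.g)) 2 volume := by
      refine (eLpNorm_restrict_le _ _ _ _).trans (le_of_eq ?_)
      rw [grad_sig]
      exact eLpNorm_const_smul m (grad (sigma P.g)) 2 volume
    refine (ENNReal.toReal_mono (ENNReal.mul_ne_top enorm_ne_top (memLp_grad_sigma P).2.ne)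
      h4).trans ?_
    rw [ENNReal.toReal_mul, toReal_enorm, Real.norm_eq_abs, mul_comm]
    exact mul_le_mul_of_nonneg_right (toReal_eLpNorm_grad_sigma_le P) (abs_nonneg m)
  have h5 : ‖c • hz'.toLp (grad eigenfield)‖ ≤ 8 * P.gradNorm * |m| := by
    have h6 := Lp.norm_le_of_ae_bound (f := c • hz'.toLp (grad eigenfield))
      (C := 4 * P.gradNorm * |m| / R) (by positivity) (by
        filter_upwards [Lp.coeFn_smul c (hz'.toLp (grad eigenfield)), hz'.coeFn_toLp,
          ae_restrict_mem measurableSet_ball] with x e1 e2 e3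
        rw [e1, Pi.smul_apply, e2]
        exact norm_smul_grad_eigenfield_le P m hR (mem_ball_zero_iff.1 e3).le)
    have h7 : (measureUnivNNReal (volume.restrict (Metric.ball (0 : E) R)) : ℝ) =
        R ^ 2 * Real.pi := by
      rw [measureUnivNNReal, Measure.restrict_apply_univ, EuclideanSpace.volume_ball_fin_two]
      change ENNReal.toReal _ = _
      rw [ENNReal.toReal_mul, ENNReal.toReal_pow, ENNReal.toReal_ofReal hR0.le,
        ENNReal.toReal_ofReal Real.pi_nonneg]
    have h8 : (measureUnivNNReal (volume.restrict (Metric.ball (0 : E) R)) : ℝ) ^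
        (ENNReal.toReal 2)⁻¹ ≤ 2 * R := by
      rw [h7, ENNReal.toReal_ofNat, ← one_div, ← Real.sqrt_eq_rpow]
      refine Real.sqrt_le_iff.2 ⟨by positivity, ?_⟩
      have := Real.pi_le_four
      nlinarith [sq_nonneg R]
    refine h6.trans ?_
    calc _ ≤ 2 * R * (4 * P.gradNorm * |m| / R) := by gcongr
      _ = 8 * P.gradNorm * |m| := by field_simp; ring
  rw [h2]
  refine (norm_sub_le _ _).trans ?_
  linarith

theorem integral_conv_barX_eq_zero (P : Profile) (m R : ℝ) {v : X (Metric.ball 0 R)}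
    (hv : v ∈ V (Metric.ball 0 R)) :
    ∫ x in Metric.ball 0 R, ⟪conv (P.barX m R).fst (P.barX m R).snd x, v.fst x⟫ = 0 := by
  have hc : Continuous (P.barS m R) :=
    continuous_iff_continuousAt.2 fun r => (hasDerivAt_barS P m R r).continuousAt
  have hq := exists_pressure hc 0
  rw [← integral_conv_swirl_eq_zero (hasDerivAt_barS P m R) hq
    (memLp_ball_of_continuous (F := ℝ) ((continuous_iff_continuousAt.2 fun r =>
      (hq r).continuousAt).comp continuous_norm) 2 R)
    (memLp_ball_of_continuous
      (((hc.comp continuous_norm).pow 2).mul continuous_norm) 2 R) hv]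
  refine integral_congr_ae ?_
  filter_upwards [coeFn_fieldX_fst (memLp_ball_of_continuous (contDiff_bar P m R).continuous 2 R)
      (memLp_ball_of_continuous (continuous_grad (contDiff_bar P m R)) 2 R),
    coeFn_fieldX_snd (memLp_ball_of_continuous (contDiff_bar P m R).continuous 2 R)
      (memLp_ball_of_continuous (continuous_grad (contDiff_bar P m R)) 2 R)] with x h1 h2
  exact congrArg (⟪·, v.fst x⟫) (conv_congr h1 h2)

end NSEnergy

end

/-! ### The theorem and its constant -/

open NSEnergy MeasureTheory Set in
theorem theoremT :
    ∃ C : ℝ → ℝ, (∀ N, 0 ≤ C N) ∧ ∀ (P : Profile) (m ν T : ℝ), 0 < ν → 0 < T →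
      (∀ (R : ℝ), 1 ≤ R →
        ∀ (f : ℝ → L2 (Metric.ball 0 R) E) (u₀ : L2 (Metric.ball 0 R) E)
          (u : ℝ → X (Metric.ball 0 R)), IsWeakNSDisk R ν T f u₀ u →
        EnergyIntegrable (Metric.ball 0 R) T (P.sigBar m R).snd f (fun s => u s - P.sigBar m R) ∧
        ∃ ubar : ℝ → L2 (Metric.ball 0 R) E, ContinuousOn ubar (Icc 0 T) ∧
          (∀ᵐ t ∂timeMeas T, ubar t = (u t).fst) ∧ ubar 0 = u₀ ∧
          ∀ t ∈ Icc 0 T,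
            EnergyIdentity (Metric.ball 0 R) ν t (P.sigBar m R).snd f
              (u₀ - (P.sigBar m R).fst) (fun s => u s - P.sigBar m R)
              (ubar t - (P.sigBar m R).fst) ∧
            EnergyBound (Metric.ball 0 R) (C P.gradNorm) m ν t f
              (u₀ - (P.sigBar m R).fst) (fun s => u s - P.sigBar m R)
              (ubar t - (P.sigBar m R).fst)) ∧
      (∀ (f : ℝ → L2 univ E) (w₀ : L2 univ E) (w : ℝ → X univ),
        IsWeakNSPlane P m ν T f w₀ w →
        EnergyIntegrable univ T (grad (P.sig m)) f w ∧
        ∃ wbar : ℝ → L2 univ E, ContinuousOn wbar (Icc 0 T) ∧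
          (∀ᵐ t ∂timeMeas T, wbar t = (w t).fst) ∧ wbar 0 = w₀ ∧
          ∀ t ∈ Icc 0 T,
            EnergyIdentity univ ν t (grad (P.sig m)) f w₀ w (wbar t) ∧
            EnergyBound univ (C P.gradNorm) m ν t f w₀ w (wbar t)) := by
  -- In a disk the gradient of the background is at most `5 N |m|` pointwise and `9 N |m|` in `L²`.
  -- The first enters the Gronwall rate doubled, giving `10 N`; the second enters squared, giving
  -- `81 N²`. In the plane both bounds hold with `N |m|`.
  refine ⟨fun N => 10 * |N| + 81 * N ^ 2, fun N => by positivity, fun P m ν T hν hT =>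
    ⟨fun R hR f u₀ u h => ?_, fun f w₀ w h => ?_⟩⟩
  · have hR0 : 0 < R := zero_lt_one.trans_le hR
    have hN := gradNorm_nonneg P
    have hm := abs_nonneg m
    rw [sigBar_eq_barX P m hR0]
    refine energy_disk (C := 5 * P.gradNorm * |m|) Metric.isOpen_ball (barX_mem_V P m hR0) ?_ hT hν
      (by positivity) ?_ (fun v hv => integral_conv_barX_eq_zero P m R hv) ?_ ?_
      (h.1.init_mem.mem_closure_ball hR0) h.1 h.2
    · exact (memLp_ball_of_continuous (contDiff_bar P m R).continuous ⊤ R).ae_eq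
        (coeFn_fieldX_fst _ _).symm
    · filter_upwards [coeFn_fieldX_snd
        (memLp_ball_of_continuous (contDiff_bar P m R).continuous 2 R)
        (memLp_ball_of_continuous (continuous_grad (contDiff_bar P m R)) 2 R),
        ae_restrict_mem measurableSet_ball] with x h1 h2
      rw [Profile.barX, h1]
      exact norm_grad_bar_le P m hR (mem_ball_zero_iff.1 h2).le
    · beta_reduce
      rw [abs_of_nonneg hN]
      nlinarith [mul_nonneg (sq_nonneg P.gradNorm) hm]
    · have h1 := pow_le_pow_left₀ (norm_nonneg _) (norm_barX_snd_le P m hR) 2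
      rw [mul_pow, mul_pow, sq_abs] at h1
      nlinarith [mul_nonneg (abs_nonneg P.gradNorm) (sq_nonneg m)]
  · have hN := gradNorm_nonneg P
    have hm := abs_nonneg m
    have hb : ∀ x, traceL (grad (P.sig m) x) = 0 := fun x => by
      rw [sig_eq_swirl]
      exact traceL_grad_swirl (hasDerivAt_mul_S P m) x
    have hD2 : MemLp (grad (P.sig m)) 2 volume := by
      rw [grad_sig]
      exact (memLp_grad_sigma P).const_smul m
    refine energy_plane (C := P.gradNorm * |m|) (contDiff_sig P m) hb (memLp_top_sig P m) hT hν
      (by positivity) (fun x => ?_) hD2 (fun v hv => integral_conv_sig_eq_zero P m hv) ?_ ?_ h.1 h.2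
    · rw [grad_sig, norm_smul, Real.norm_eq_abs, mul_comm]
      exact mul_le_mul_of_nonneg_right (norm_grad_sigma_le P x) hm
    · beta_reduce
      rw [abs_of_nonneg hN]
      nlinarith [mul_nonneg (sq_nonneg P.gradNorm) hm, mul_nonneg hN hm]
    · have h1 : (eLpNorm (grad (P.sig m)) 2 volume).toReal ≤ |m| * P.gradNorm := by
        rw [grad_sig]
        refine le_trans (le_of_eq ?_) (mul_le_mul_of_nonneg_left
          (toReal_eLpNorm_grad_sigma_le P) hm)
        rw [← Real.norm_eq_abs, ← toReal_enorm, ← ENNReal.toReal_mul]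
        exact congrArg ENNReal.toReal (eLpNorm_const_smul m (grad (sigma P.g)) 2 volume)
      have h2 := pow_le_pow_left₀ ENNReal.toReal_nonneg h1 2
      rw [mul_pow, sq_abs] at h2
      nlinarith [mul_nonneg (abs_nonneg P.gradNorm) (sq_nonneg m),
        mul_nonneg (sq_nonneg P.gradNorm) (sq_nonneg m)]
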